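/- Let $\mathrm{NE}=\mathrm{NTIME}[2^{O(n)}]$ (languages over $\{0,1\}$), and let $\mathrm{FP}^{\mathrm{NE}}$ be the class of functions $\{0,1\}^*\to\{0,1\}^*$ computable by a deterministic polynomial-time oracle Turing machine with an oracle from $\mathrm{NE}$. For $k\ge 0$, an $\mathrm{ACC}^k$ circuit family is a sequence $(C_n)_{n\ge 0}$, where $C_n$ is a circuit with $n$ input bits built from unbounded fan-in AND, OR and $\mathrm{MOD}_m$ gates and NOT gates, for a constant $m\ge 2$ that is the same for the whole family (a $\mathrm{MOD}_m$ gate outputs $1$ iff the number of its inputs equal to $1$ is divisible by $m$), such that the size of $C_n$ is bounded by a polynomial in $n$ and its depth is $O(\log^k n)$. A language $A$ has (nonuniform) $\mathrm{ACC}^k$ circuits if there is an $\mathrm{ACC}^k$ family $(C_n)$ such that for all $x$, $x\in A$ iff $C_{|x|}(x)=1$. It has $\mathrm{P}^{\mathrm{NE}}$-uniform $\mathrm{ACC}^k$ circuits if there are such a family and a function $f\in\mathrm{FP}^{\mathrm{NE}}$ such that for every $j\ge 0$, $f(1^j)$ is the description of $C_j$ under a fixed standard binary encoding of circuits. Theorem.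 For every $k\in\{0,1,2,\ldots\}$: every language in $\mathrm{NE}$ has (nonuniform) $\mathrm{ACC}^k$ circuits if and only if every language in $\mathrm{NE}$ has $\mathrm{P}^{\mathrm{NE}}$-uniform $\mathrm{ACC}^k$ circuits. -/

import Mathlib

namespace ACCUniform

/-! ### Machines

Multi-stack Turing machines over the alphabet `Bool`: a finite control acting on finitely many
stacks (a two-way infinite tape is a pair of stacks, and a larger alphabet is coded in blocks of
bits, so these machines and multi-tape Turing machines simulate each other with polynomial
overhead).  A stack is a `List Bool` whose head is the top of the stack. -/

/-- One instruction of a machine with state set `Q` and stack set `K`. Each costs one step. -/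
inductive Instr (Q K : Type) where
  /-- push the bit `b` on stack `k` and go to state `q` -/
  | push (k : K) (b : Bool) (q : Q)
  /-- pop stack `k`; go to `q₀` or `q₁` according to the removed bit, to `qe` if `k` was empty -/
  | pop (k : K) (qe q₀ q₁ : Q)
  /-- nondeterministic choice: go to `q₀` or to `q₁` -/
  | guess (q₀ q₁ : Q)
  /-- ask the oracle whether the string on stack `k` belongs to it -/
  | query (k : K) (qyes qno : Q)
  /-- halt, accepting or rejecting -/
  | halt (accept : Bool)

/-- A (possibly nondeterministic, possibly oracle) machine. -/
structure Machine where
  /-- the states of the finite control -/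
  State : Type
  /-- the names of the stacks -/
  Stack : Type
  [finState : Fintype State]
  [finStack : Fintype Stack]
  [decStack : DecidableEq Stack]
  /-- the initial state -/
  start : State
  /-- the stack that holds the input -/
  inp : Stack
  /-- the stack that holds the output -/
  out : Stack
  /-- the program -/
  prog : State → Instr State Stack

namespace Machine

attribute [instance] finState finStack decStack

/-- A configuration: the current state and the contents of all stacks. -/
structure Cfg (M : Machine) where
  state : M.State
  stk : M.Stack → List Bool

/-- The initial configuration on input `x`: all stacks but the input stack are empty. -/
def init (M : Machine) (x : List Bool) : M.Cfg :=
  ⟨M.start, fun k => if k = M.inp then x else []⟩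

open Classical in
/-- One step with oracle `O`, where `b` is the bit used if the instruction is a nondeterministic
choice. A halted configuration does not change any more. -/
noncomputable def step (M : Machine) (O : Language Bool) (c : M.Cfg) (b : Bool) : M.Cfg :=
  match M.prog c.state with
  | .push k a q => ⟨q, Function.update c.stk k (a :: c.stk k)⟩
  | .pop k qe q₀ q₁ =>
    match c.stk k with
    | [] => ⟨qe, c.stk⟩
    | false :: s => ⟨q₀, Function.update c.stk k s⟩
    | true :: s => ⟨q₁, Function.update c.stk k s⟩
  | .guess q₀ q₁ => ⟨if b then q₁ else q₀, c.stk⟩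
  | .query k qyes qno => ⟨if c.stk k ∈ O then qyes else qno, c.stk⟩
  | .halt _ => c

/-- `g.length` steps along the computation path given by the choice sequence `g`. -/
noncomputable def run (M : Machine) (O : Language Bool) (g : List Bool) (c : M.Cfg) : M.Cfg :=
  g.foldl (M.step O) c

/-- The configuration is a halted one. -/
def Cfg.Halted {M : Machine} (c : M.Cfg) : Prop :=
  ∃ a, M.prog c.state = .halt a

/-- The configuration is a halted one that accepts. -/
def Cfg.Accepting {M : Machine} (c : M.Cfg) : Prop :=
  M.prog c.state = .halt true

/-- On input `x` with oracle `O`, every computation path halts within `t` steps. -/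
def HaltsWithin (M : Machine) (O : Language Bool) (x : List Bool) (t : ℕ) : Prop :=
  ∀ g : List Bool, g.length = t → (M.run O g (M.init x)).Halted

/-- On input `x` with oracle `O`, some computation path accepts. -/
def Accepts (M : Machine) (O : Language Bool) (x : List Bool) : Prop :=
  ∃ g : List Bool, (M.run O g (M.init x)).Accepting

/-- The program contains no nondeterministic choice. -/
def Deterministic (M : Machine) : Prop :=
  ∀ q q₀ q₁, M.prog q ≠ .guess q₀ q₁

/-- The program contains no oracle query. -/
def QueryFree (M : Machine) : Prop :=
  ∀ q k qyes qno, M.prog q ≠ .query k qyes qno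

end Machine

/-- `NE = NTIME[2^{O(n)}]`. A query-free machine does not depend on the oracle, which is
taken to be empty. -/
def NE : Set (Language Bool) :=
  {L | ∃ M : Machine, M.QueryFree ∧ ∃ c : ℕ, ∀ x : List Bool,
    M.HaltsWithin ⊥ x (c * 2 ^ (c * x.length)) ∧ (x ∈ L ↔ M.Accepts ⊥ x)}

/-- `FP^O`: the functions computed by a deterministic polynomial-time machine with oracle `O`. -/
def FPWith (O : Language Bool) : Set (List Bool → List Bool) :=
  {f | ∃ M : Machine, M.Deterministic ∧ ∃ p : Polynomial ℕ, ∀ x : List Bool,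
    ∀ g : List Bool, g.length = p.eval x.length →
      (M.run O g (M.init x)).Halted ∧ (M.run O g (M.init x)).stk M.out = f x}

/-- `FP^NE`. -/
def FPNE : Set (List Bool → List Bool) :=
  {f | ∃ O ∈ NE, f ∈ FPWith O}

/-! ### Circuits

Circuits with gates AND, OR (both of unbounded fan-in), NOT and MOD_m (of unbounded fan-in), as a
list of gates in topological order: a gate refers to earlier gates through their position in the
list. The AND and the OR of no arguments are the constants true and false. -/

/-- A gate, with the positions of the gates that feed it. -/
inductive Gate where
  /-- the `i`-th input bit -/
  | input (i : ℕ)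
  | not (j : ℕ)
  | and (js : List ℕ)
  | or (js : List ℕ)
  /-- the MOD_m gate: true if and only if the number of true arguments is divisible by `m` -/
  | mod (js : List ℕ)

namespace Gate

/-- The positions of the gates that feed a gate. -/
def args : Gate → List ℕ
  | input _ => []
  | not j => [j]
  | and js => js
  | or js => js
  | mod js => js

/-- The gate may stand at position `pos` of a circuit with `n` inputs. -/
def WellFormed (n pos : ℕ) : Gate → Prop
  | input i => i < n
  | g => ∀ j ∈ g.args, j < pos

/-- The value of a gate on the input `x`, from the list `v` of the values of the earlier gates. -/
def eval (m : ℕ) (x v : List Bool) : Gate → Bool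
  | input i => x.getD i false
  | not j => !v.getD j false
  | and js => js.all fun j => v.getD j false
  | or js => js.any fun j => v.getD j false
  | mod js => decide (m ∣ js.countP fun j => v.getD j false)

/-- The depth of a gate, from the list `d` of the depths of the earlier gates. -/
def depth (d : List ℕ) : Gate → ℕ
  | input _ => 0
  | g => (g.args.map fun j => d.getD j 0).foldr max 0 + 1

end Gate

/-- A circuit with `n` inputs; the last gate is the output. -/
structure Circuit (n : ℕ) where
  gates : List Gate
  nonempty : gates ≠ []
  wellFormed : ∀ (i : ℕ) (h : i < gates.length), gates[i].WellFormed n i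

namespace Circuit

variable {n : ℕ}

/-- The values of all gates on the input `x`, where the MOD gates have modulus `m`. -/
def values (C : Circuit n) (m : ℕ) (x : List Bool) : List Bool :=
  C.gates.foldl (fun v g => v ++ [g.eval m x v]) []

/-- The output of the circuit on the input `x`. -/
def eval (C : Circuit n) (m : ℕ) (x : List Bool) : Bool :=
  (C.values m x).getLastD false

/-- The depth: the maximal number of non-input gates on a path. -/
def depth (C : Circuit n) : ℕ :=
  (C.gates.foldl (fun d g => d ++ [g.depth d]) []).foldr max 0

/-- The size: the number of gates plus the number of wires. -/
def size (C : Circuit n) : ℕ :=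
  (C.gates.map fun g => 1 + g.args.length).sum

end Circuit

/-! ### Descriptions of circuits

The description lists the gates in order. Positions are written in unary, so that the length of
the description is polynomial in the size of the circuit and the number of inputs. -/

/-- The self-delimiting unary code of a natural number. -/
def encodeNat (i : ℕ) : List Bool :=
  List.replicate i true ++ [false]

/-- The self-delimiting code of a list of natural numbers. -/
def encodeArgs (js : List ℕ) : List Bool :=
  (js.flatMap fun j => true :: encodeNat j) ++ [false]

/-- The description of a gate: a tag for its type, then its arguments. -/
def Gate.encode : Gate → List Bool
  | .input i => false :: false :: encodeNat i
  | .not j => false :: true :: encodeNat j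
  | .and js => true :: false :: false :: encodeArgs js
  | .or js => true :: false :: true :: encodeArgs js
  | .mod js => true :: true :: encodeArgs js

/-- The description of a circuit. -/
def Circuit.encode {n : ℕ} (C : Circuit n) : List Bool :=
  C.gates.flatMap Gate.encode

/-! ### ACC^k -/

/-- The size of the family `C` (one circuit per input length) is polynomial and its depth is
`O(log^k n)`. (The `+ 1` only matters for `n ≤ 1`, where the logarithm vanishes.) -/
def IsACCBounded (k : ℕ) (C : (n : ℕ) → Circuit n) : Prop :=
  (∃ p : Polynomial ℕ, ∀ n, (C n).size ≤ p.eval n) ∧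
  ∃ c : ℕ, ∀ n, (C n).depth ≤ c * (Nat.log 2 n + 1) ^ k

/-- The family `C`, with MOD gates of modulus `m`, decides the language `A`. -/
def Decides (m : ℕ) (C : (n : ℕ) → Circuit n) (A : Language Bool) : Prop :=
  ∀ x : List Bool, x ∈ A ↔ (C x.length).eval m x = true

/-- `A` has (nonuniform) `ACC^k` circuits: polynomial size, depth `O(log^k n)`, gates AND, OR, NOT
and MOD_m for one constant `m`. -/
def HasACC (k : ℕ) (A : Language Bool) : Prop :=
  ∃ m : ℕ, 2 ≤ m ∧ ∃ C : (n : ℕ) → Circuit n, IsACCBounded k C ∧ Decides m C A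

/-- `A` has `P^NE`-uniform `ACC^k` circuits: some `ACC^k` family for `A` has a generator in `FP^NE`
that on input `1^j` outputs the description of the circuit for inputs of length `j`. -/
def HasUniformACC (k : ℕ) (A : Language Bool) : Prop :=
  ∃ m : ℕ, 2 ≤ m ∧ ∃ C : (n : ℕ) → Circuit n, IsACCBounded k C ∧ Decides m C A ∧
    ∃ f ∈ FPNE, ∀ j : ℕ, f (List.replicate j true) = (C j).encode

end ACCUniform

/-! The nontrivial direction holds for each language `A` in `NE` separately
(`hasUniformACC_of_hasACC`); the converse forgets the generator. The difficulty is that correctness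
of a circuit for length `n` is not visibly an `NE` property: a nondeterministic exponential-time
machine can confirm that every accepted string lies in `A`, by guessing an accepting computation for
each of them, but not that the rejected strings lie outside. Counting removes the difficulty. Call a
circuit sound if it accepts only members of `A`. If some correct circuit is among the candidates,
then a sound candidate is correct exactly when it accepts the largest number of strings
(`countP_strings`, `iff_of_countP_le`).

Each sound circuit therefore gets a `profile`: the number of accepted strings in binary with `n + 1`
digits, then the depth `d` as `d` zeros followed by a one, then the description. In the
lexicographic order a larger count wins, and among equal counts a smaller depth wins. So the largest
profile of length at most `Q` belongs to a correct circuit whose depth does not exceed that of the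
given `ACC^k` circuit (`of_lexLe_profile`), provided that the profile of the given circuit fits into
`Q`, which a polynomial `Q` in `n` achieves. Its description has length at most `Q`, so its size is
polynomial as well.

The largest profile is found bit by bit, with polynomially many questions whether a prefix extends
to the profile of a sound circuit (`greedy_spec`). These questions form `searchOracle`
(`mem_searchOracle`). It lies in `NE` (`searchOracle_mem_NE`): the certificate consists of a circuit
and choice sequences of the machine for `A`, and the verifier evaluates the circuit on all `2 ^ n`
strings. The length `n` is written in unary in the question, so `2 ^ n` is exponential in the length
of the question.

The rest of the work shows that these algorithms run on the given machine model. Combinators on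
binary trees (`Fn`) are compiled to structured stack programs (`Cmd`), and these to machines
(`Fn.det_toCmd`, `Cmd.Exec.run_eq`). The predicates `PT` and `ET` provide a calculus of functions of
polynomial and exponential cost. The complexity classes enter through `mem_NE_of_verifier` and
`mem_FPWith` only. -/

namespace ACCUniform

/-! ### Stack programs -/

/-- Structured programs on registers `0, 1, 2, …`, each holding a stack of bits. -/
inductive Cmd where
  | skip
  | push (r : ℕ) (b : Bool)
  /-- pop a bit from `r` and continue according to the result -/
  | pop (r : ℕ) (ce c₀ c₁ : Cmd)
  /-- push a nondeterministically chosen bit -/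
  | guess (r : ℕ)
  | query (r : ℕ) (cy cn : Cmd)
  | seq (a b : Cmd)
  /-- pop bits from `r` until it is empty, after each of them running `c₀` or `c₁` -/
  | loop (r : ℕ) (c₀ c₁ : Cmd)

namespace Cmd

/-- The contents of the registers. -/
abbrev Store := ℕ → List Bool

/-- `Exec O c s g s'`: with oracle `O`, the program `c` leads from `s` to `s'` in `g.length` steps
along the path given by the choice sequence `g`. -/
inductive Exec (O : Language Bool) : Cmd → Store → List Bool → Store → Prop
  | skip (s) : Exec O skip s [] s
  | push (r b s x) : Exec O (push r b) s [x] (Function.update s r (b :: s r))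
  | popNil {r ce c₀ c₁ s g s'} (x) (h : s r = []) (he : Exec O ce s g s') :
      Exec O (pop r ce c₀ c₁) s (x :: g) s'
  | popFalse {r ce c₀ c₁ s g s' l} (x) (h : s r = false :: l)
      (he : Exec O c₀ (Function.update s r l) g s') : Exec O (pop r ce c₀ c₁) s (x :: g) s'
  | popTrue {r ce c₀ c₁ s g s' l} (x) (h : s r = true :: l)
      (he : Exec O c₁ (Function.update s r l) g s') : Exec O (pop r ce c₀ c₁) s (x :: g) s'
  | guess (r s b x) : Exec O (guess r) s [b, x] (Function.update s r (b :: s r))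
  | queryYes {r cy cn s g s'} (x) (h : s r ∈ O) (he : Exec O cy s g s') :
      Exec O (query r cy cn) s (x :: g) s'
  | queryNo {r cy cn s g s'} (x) (h : s r ∉ O) (he : Exec O cn s g s') :
      Exec O (query r cy cn) s (x :: g) s'
  | seq {a b s g₁ s₁ g₂ s₂} (ha : Exec O a s g₁ s₁) (hb : Exec O b s₁ g₂ s₂) :
      Exec O (seq a b) s (g₁ ++ g₂) s₂
  | loopNil {r c₀ c₁ s} (x) (h : s r = []) : Exec O (loop r c₀ c₁) s [x] s
  | loopFalse {r c₀ c₁ s l g₁ s₁ g₂ s₂} (x) (h : s r = false :: l)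
      (ha : Exec O c₀ (Function.update s r l) g₁ s₁) (hb : Exec O (loop r c₀ c₁) s₁ g₂ s₂) :
      Exec O (loop r c₀ c₁) s (x :: (g₁ ++ g₂)) s₂
  | loopTrue {r c₀ c₁ s l g₁ s₁ g₂ s₂} (x) (h : s r = true :: l)
      (ha : Exec O c₁ (Function.update s r l) g₁ s₁) (hb : Exec O (loop r c₀ c₁) s₁ g₂ s₂) :
      Exec O (loop r c₀ c₁) s (x :: (g₁ ++ g₂)) s₂

/-- The control points of a program. -/
def Pos : Cmd → Type
  | skip => Empty
  | push _ _ => Unit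
  | pop _ ce c₀ c₁ => Unit ⊕ (Pos ce ⊕ (Pos c₀ ⊕ Pos c₁))
  | guess _ => Unit ⊕ Bool
  | query _ cy cn => Unit ⊕ (Pos cy ⊕ Pos cn)
  | seq a b => Pos a ⊕ Pos b
  | loop _ c₀ c₁ => Unit ⊕ (Pos c₀ ⊕ Pos c₁)

instance instFintypePos : (c : Cmd) → Fintype (Pos c)
  | skip => inferInstanceAs (Fintype Empty)
  | push _ _ => inferInstanceAs (Fintype Unit)
  | pop _ ce c₀ c₁ =>
    letI := instFintypePos ce
    letI := instFintypePos c₀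
    letI := instFintypePos c₁
    inferInstanceAs (Fintype (Unit ⊕ (Pos ce ⊕ (Pos c₀ ⊕ Pos c₁))))
  | guess _ => inferInstanceAs (Fintype (Unit ⊕ Bool))
  | query _ cy cn =>
    letI := instFintypePos cy
    letI := instFintypePos cn
    inferInstanceAs (Fintype (Unit ⊕ (Pos cy ⊕ Pos cn)))
  | seq a b =>
    letI := instFintypePos a
    letI := instFintypePos b
    inferInstanceAs (Fintype (Pos a ⊕ Pos b))
  | loop _ c₀ c₁ =>
    letI := instFintypePos c₀
    letI := instFintypePos c₁
    inferInstanceAs (Fintype (Unit ⊕ (Pos c₀ ⊕ Pos c₁)))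

/-- The state in which a program starts, if its control points are embedded by `ι` and it is left
through `e`. -/
def entry {R : Type} : (c : Cmd) → (Pos c → R) → R → R
  | skip, _, e => e
  | push _ _, ι, _ => ι ()
  | pop _ _ _ _, ι, _ => ι (.inl ())
  | guess _, ι, _ => ι (.inl ())
  | query _ _ _, ι, _ => ι (.inl ())
  | seq a b, ι, e => entry a (fun p => ι (.inl p)) (entry b (fun p => ι (.inr p)) e)
  | loop _ _ _, ι, _ => ι (.inl ())

/-- The instructions of a program, with registers taken modulo `N`. -/
def code {R : Type} (N : ℕ) [NeZero N] :
    (c : Cmd) → (Pos c → R) → R → Pos c → Instr R (Fin N)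
  | push r b, _, e, _ => .push (Fin.ofNat N r) b e
  | pop r ce c₀ c₁, ι, e, p =>
    match p with
    | .inl _ => .pop (Fin.ofNat N r) (entry ce (fun p => ι (.inr (.inl p))) e)
        (entry c₀ (fun p => ι (.inr (.inr (.inl p)))) e)
        (entry c₁ (fun p => ι (.inr (.inr (.inr p)))) e)
    | .inr (.inl p) => code N ce (fun p => ι (.inr (.inl p))) e p
    | .inr (.inr (.inl p)) => code N c₀ (fun p => ι (.inr (.inr (.inl p)))) e p
    | .inr (.inr (.inr p)) => code N c₁ (fun p => ι (.inr (.inr (.inr p)))) e p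
  | guess r, ι, e, p =>
    match p with
    | .inl _ => .guess (ι (.inr false)) (ι (.inr true))
    | .inr b => .push (Fin.ofNat N r) b e
  | query r cy cn, ι, e, p =>
    match p with
    | .inl _ => .query (Fin.ofNat N r) (entry cy (fun p => ι (.inr (.inl p))) e)
        (entry cn (fun p => ι (.inr (.inr p))) e)
    | .inr (.inl p) => code N cy (fun p => ι (.inr (.inl p))) e p
    | .inr (.inr p) => code N cn (fun p => ι (.inr (.inr p))) e p
  | seq a b, ι, e, p =>
    match p with
    | .inl p => code N a (fun p => ι (.inl p)) (entry b (fun p => ι (.inr p)) e) p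
    | .inr p => code N b (fun p => ι (.inr p)) e p
  | loop r c₀ c₁, ι, e, p =>
    match p with
    | .inl _ => .pop (Fin.ofNat N r) e (entry c₀ (fun p => ι (.inr (.inl p))) (ι (.inl ())))
        (entry c₁ (fun p => ι (.inr (.inr p))) (ι (.inl ())))
    | .inr (.inl p) => code N c₀ (fun p => ι (.inr (.inl p))) (ι (.inl ())) p
    | .inr (.inr p) => code N c₁ (fun p => ι (.inr (.inr p))) (ι (.inl ())) p

/-- All registers of the program are below `N`. -/
def Below (N : ℕ) : Cmd → Prop
  | skip => True
  | push r _ => r < N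
  | pop r ce c₀ c₁ => r < N ∧ Below N ce ∧ Below N c₀ ∧ Below N c₁
  | guess r => r < N
  | query r cy cn => r < N ∧ Below N cy ∧ Below N cn
  | seq a b => Below N a ∧ Below N b
  | loop r c₀ c₁ => r < N ∧ Below N c₀ ∧ Below N c₁

theorem Below.mono {N N' : ℕ} (h : N ≤ N') : ∀ {c : Cmd}, Below N c → Below N' c
  | skip, _ => trivial
  | push _ _, hc => lt_of_lt_of_le hc h
  | pop _ _ _ _, hc => ⟨hc.1.trans_le h, hc.2.1.mono h, hc.2.2.1.mono h, hc.2.2.2.mono h⟩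
  | guess _, hc => lt_of_lt_of_le hc h
  | query _ _ _, hc => ⟨hc.1.trans_le h, hc.2.1.mono h, hc.2.2.mono h⟩
  | seq _ _, hc => ⟨hc.1.mono h, hc.2.mono h⟩
  | loop _ _ _, hc => ⟨hc.1.trans_le h, hc.2.1.mono h, hc.2.2.mono h⟩

theorem exists_below : ∀ c : Cmd, ∃ N, Below N c
  | skip => ⟨0, trivial⟩
  | push r _ => ⟨r + 1, Nat.lt_succ_self r⟩
  | pop r ce c₀ c₁ => by
    obtain ⟨a, ha⟩ := exists_below ce
    obtain ⟨b, hb⟩ := exists_below c₀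
    obtain ⟨c, hc⟩ := exists_below c₁
    exact ⟨r + 1 + a + b + c, by omega, ha.mono (by omega), hb.mono (by omega), hc.mono (by omega)⟩
  | guess r => ⟨r + 1, Nat.lt_succ_self r⟩
  | query r cy cn => by
    obtain ⟨a, ha⟩ := exists_below cy
    obtain ⟨b, hb⟩ := exists_below cn
    exact ⟨r + 1 + a + b, by omega, ha.mono (by omega), hb.mono (by omega)⟩
  | seq a b => by
    obtain ⟨m, hm⟩ := exists_below a
    obtain ⟨n, hn⟩ := exists_below b
    exact ⟨m + n, hm.mono (by omega), hn.mono (by omega)⟩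
  | loop r c₀ c₁ => by
    obtain ⟨a, ha⟩ := exists_below c₀
    obtain ⟨b, hb⟩ := exists_below c₁
    exact ⟨r + 1 + a + b, by omega, ha.mono (by omega), hb.mono (by omega)⟩

/-- The program contains no query. -/
def QueryFree : Cmd → Prop
  | skip | push _ _ | guess _ => True
  | pop _ ce c₀ c₁ => QueryFree ce ∧ QueryFree c₀ ∧ QueryFree c₁
  | query _ _ _ => False
  | seq a b => QueryFree a ∧ QueryFree b
  | loop _ c₀ c₁ => QueryFree c₀ ∧ QueryFree c₁

/-- The program contains no nondeterministic choice. -/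
def GuessFree : Cmd → Prop
  | skip | push _ _ => True
  | guess _ => False
  | pop _ ce c₀ c₁ => GuessFree ce ∧ GuessFree c₀ ∧ GuessFree c₁
  | query _ cy cn => GuessFree cy ∧ GuessFree cn
  | seq a b => GuessFree a ∧ GuessFree b
  | loop _ c₀ c₁ => GuessFree c₀ ∧ GuessFree c₁

theorem QueryFree.code_ne {R : Type} {N : ℕ} [NeZero N] {c : Cmd} (h : c.QueryFree)
    (ι : Pos c → R) (e : R) (p : Pos c) (k : Fin N) (q q' : R) :
    code N c ι e p ≠ .query k q q' := by
  induction c generalizing e with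
  | skip => exact p.elim
  | push r b => simp [code]
  | pop r ce c₀ c₁ ihe ih₀ ih₁ =>
    rcases p with p | p | p | p
    · simp [code]
    · exact ihe h.1 _ _ _
    · exact ih₀ h.2.1 _ _ _
    · exact ih₁ h.2.2 _ _ _
  | guess r => rcases p with p | p <;> simp [code]
  | query r cy cn _ _ => exact h.elim
  | seq a b iha ihb =>
    rcases p with p | p
    · exact iha h.1 _ _ _
    · exact ihb h.2 _ _ _
  | loop r c₀ c₁ ih₀ ih₁ =>
    rcases p with p | p | p
    · simp [code]
    · exact ih₀ h.1 _ _ _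
    · exact ih₁ h.2 _ _ _

theorem GuessFree.code_ne {R : Type} {N : ℕ} [NeZero N] {c : Cmd} (h : c.GuessFree)
    (ι : Pos c → R) (e : R) (p : Pos c) (q q' : R) :
    code N c ι e p ≠ .guess q q' := by
  induction c generalizing e with
  | skip => exact p.elim
  | push r b => simp [code]
  | pop r ce c₀ c₁ ihe ih₀ ih₁ =>
    rcases p with p | p | p | p
    · simp [code]
    · exact ihe h.1 _ _ _
    · exact ih₀ h.2.1 _ _ _
    · exact ih₁ h.2.2 _ _ _
  | guess r => exact h.elim
  | query r cy cn ihy ihn =>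
    rcases p with p | p | p
    · simp [code]
    · exact ihy h.1 _ _ _
    · exact ihn h.2 _ _ _
  | seq a b iha ihb =>
    rcases p with p | p
    · exact iha h.1 _ _ _
    · exact ihb h.2 _ _ _
  | loop r c₀ c₁ ih₀ ih₁ =>
    rcases p with p | p | p
    · simp [code]
    · exact ih₀ h.1 _ _ _
    · exact ih₁ h.2 _ _ _

/-- The machine that runs `c`, then pops a bit from register `r` and accepts if it is `true`. -/
def toMachine (c : Cmd) (N : ℕ) [NeZero N] (i o r : ℕ) : Machine where
  State := Pos c ⊕ Option Bool
  Stack := Fin N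
  start := entry c Sum.inl (Sum.inr none)
  inp := Fin.ofNat N i
  out := Fin.ofNat N o
  prog
    | .inl p => code N c Sum.inl (Sum.inr none) p
    | .inr none => .pop (Fin.ofNat N r) (.inr (some false)) (.inr (some false)) (.inr (some true))
    | .inr (some b) => .halt b

theorem toMachine_queryFree {c : Cmd} (h : c.QueryFree) (N : ℕ) [NeZero N] (i o r : ℕ) :
    (c.toMachine N i o r).QueryFree := by
  rintro (p | _ | p) k q q' hq
  · exact h.code_ne _ _ _ _ _ _ hq
  · cases hq
  · cases hq

theorem toMachine_deterministic {c : Cmd} (h : c.GuessFree) (N : ℕ) [NeZero N] (i o r : ℕ) :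
    (c.toMachine N i o r).Deterministic := by
  rintro (p | _ | p) q q' hq
  · exact h.code_ne _ _ _ _ _ hq
  · cases hq
  · cases hq

/-! ### Correctness of the compilation of stack programs -/

theorem restrict_update {N : ℕ} [NeZero N] (s : Store) {r : ℕ} (hr : r < N) (l : List Bool) :
    Function.update (fun i : Fin N => s i) (Fin.ofNat N r) l =
      fun i : Fin N => Function.update s r l i := by
  funext i
  by_cases h : i = Fin.ofNat N r
  · subst h
    simp [Nat.mod_eq_of_lt hr]
  · have : (i : ℕ) ≠ r := by
      rintro rfl
      exact h (by simp)
    rw [Function.update_of_ne h, Function.update_of_ne this]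

theorem ofNat_val_of_lt {N : ℕ} [NeZero N] {r : ℕ} (hr : r < N) : (Fin.ofNat N r : ℕ) = r := by
  simp [Nat.mod_eq_of_lt hr]

/-- The configuration of a machine with stacks `Fin N` that holds the registers `s`. -/
def cfg (c : Cmd) (N : ℕ) [NeZero N] (i o r : ℕ) (q : Pos c ⊕ Option Bool) (s : Store) :
    (c.toMachine N i o r).Cfg :=
  ⟨q, fun i : Fin N => s i⟩

variable {O : Language Bool}

/-- Induction on the derivation. The embedding `ι` and the exit `e` are arbitrary because `c` is a
subprogram of `c₀`: the exit of the first half of a `seq` is the entry of the second half, and the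
exit of a loop body is the head of the loop. Each instruction consumes one bit of `g`, also a
deterministic one, so derivation and machine agree step by step. -/
theorem Exec.run_eq {c₀ : Cmd} {N : ℕ} [NeZero N] {i o r : ℕ} {c : Cmd} {s s' : Store}
    {g : List Bool} (h : Exec O c s g s') (hN : c.Below N) (ι : Pos c → Pos c₀ ⊕ Option Bool)
    (e : Pos c₀ ⊕ Option Bool)
    (hι : ∀ p, (c₀.toMachine N i o r).prog (ι p) = code N c ι e p) :
    (c₀.toMachine N i o r).run O g (cfg c₀ N i o r (entry c ι e) s) = cfg c₀ N i o r e s' := by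
  induction h generalizing e with
  | skip s => rfl
  | push k b s x =>
    have h1 := hι ()
    simp only [Machine.run, List.foldl_cons, List.foldl_nil, Machine.step, cfg, entry, h1, code]
    exact congrArg (Machine.Cfg.mk _) (by
      rw [← restrict_update s hN, ofNat_val_of_lt hN]
      rfl)
  | popNil x h he ih =>
    have h1 := hι (.inl ())
    have h2 := ih hN.2.1 (fun p => ι (.inr (.inl p))) e (fun p => hι _)
    rw [← h2]
    simp only [Machine.run, List.foldl_cons, Machine.step, cfg, entry, h1, code,
      ofNat_val_of_lt hN.1, h]
  | popFalse x h he ih =>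
    have h1 := hι (.inl ())
    have h2 := ih hN.2.2.1 (fun p => ι (.inr (.inr (.inl p)))) e (fun p => hι _)
    rw [← h2]
    simp only [Machine.run, List.foldl_cons, Machine.step, cfg, entry, h1, code,
      ofNat_val_of_lt hN.1, h]
    rw [← restrict_update _ hN.1]
    rfl
  | popTrue x h he ih =>
    have h1 := hι (.inl ())
    have h2 := ih hN.2.2.2 (fun p => ι (.inr (.inr (.inr p)))) e (fun p => hι _)
    rw [← h2]
    simp only [Machine.run, List.foldl_cons, Machine.step, cfg, entry, h1, code,
      ofNat_val_of_lt hN.1, h]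
    rw [← restrict_update _ hN.1]
    rfl
  | guess k s b x =>
    have h1 := hι (.inl ())
    have h2 := hι (.inr b)
    have h3 : (c₀.toMachine N i o r).step O (cfg c₀ N i o r (ι (.inl ())) s) b =
        cfg c₀ N i o r (ι (.inr b)) s := by
      simp only [Machine.step, cfg, h1, code]
      cases b <;> rfl
    simp only [Machine.run, List.foldl_cons, List.foldl_nil, entry]
    rw [h3]
    simp only [Machine.step, cfg, h2, code]
    exact congrArg (Machine.Cfg.mk _) (by
      rw [← restrict_update s hN, ofNat_val_of_lt hN]
      rfl)
  | queryYes x h he ih =>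
    have h1 := hι (.inl ())
    have h2 := ih hN.2.1 (fun p => ι (.inr (.inl p))) e (fun p => hι _)
    rw [← h2]
    simp only [Machine.run, List.foldl_cons, Machine.step, cfg, entry, h1, code,
      ofNat_val_of_lt hN.1]
    exact congrArg (fun q => List.foldl _ (Machine.Cfg.mk q _) _) (if_pos (by rwa [ofNat_val_of_lt hN.1]))
  | queryNo x h he ih =>
    have h1 := hι (.inl ())
    have h2 := ih hN.2.2 (fun p => ι (.inr (.inr p))) e (fun p => hι _)
    rw [← h2]
    simp only [Machine.run, List.foldl_cons, Machine.step, cfg, entry, h1, code,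
      ofNat_val_of_lt hN.1]
    exact congrArg (fun q => List.foldl _ (Machine.Cfg.mk q _) _) (if_neg (by rwa [ofNat_val_of_lt hN.1]))
  | @seq a b _ _ _ _ _ ha hb iha ihb =>
    have h1 := iha hN.1 (fun p => ι (.inl p)) (entry b (fun p => ι (.inr p)) e) (fun p => hι _)
    have h2 := ihb hN.2 (fun p => ι (.inr p)) e (fun p => hι _)
    rw [← h2, ← h1]
    simp only [Machine.run, List.foldl_append]
    rfl
  | loopNil x h =>
    have h1 := hι (.inl ())
    simp only [Machine.run, List.foldl_cons, List.foldl_nil, Machine.step, cfg, entry, h1, code,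
      ofNat_val_of_lt hN.1, h]
  | loopFalse x h ha hb iha ihb =>
    have h1 := hι (.inl ())
    have h2 := iha hN.2.1 (fun p => ι (.inr (.inl p))) (ι (.inl ())) (fun p => hι _)
    have h3 := ihb hN ι e hι
    rw [← h3]
    simp only [entry]
    rw [← h2]
    simp only [Machine.run, List.foldl_cons, List.foldl_append, Machine.step, cfg, h1, code,
      ofNat_val_of_lt hN.1, h]
    rw [← restrict_update _ hN.1]
    rfl
  | loopTrue x h ha hb iha ihb =>
    have h1 := hι (.inl ())
    have h2 := iha hN.2.2 (fun p => ι (.inr (.inr p))) (ι (.inl ())) (fun p => hι _)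
    have h3 := ihb hN ι e hι
    rw [← h3]
    simp only [entry]
    rw [← h2]
    simp only [Machine.run, List.foldl_cons, List.foldl_append, Machine.step, cfg, h1, code,
      ofNat_val_of_lt hN.1, h]
    rw [← restrict_update _ hN.1]
    rfl

end Cmd


/-! ### Deterministic execution with a time bound -/

namespace Cmd

variable {O : Language Bool}

/-- Whatever the choice sequence, `c` leads from `s` to `s'` within `T` steps. -/
def Det (O : Language Bool) (c : Cmd) (s : Store) (T : ℕ) (s' : Store) : Prop :=
  ∃ t ≤ T, ∀ g : List Bool, g.length = t → Exec O c s g s'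

theorem Det.mono {c : Cmd} {s s' : Store} {T T' : ℕ} (h : Det O c s T s') (hT : T ≤ T') :
    Det O c s T' s' := by
  obtain ⟨t, ht, h⟩ := h
  exact ⟨t, ht.trans hT, h⟩

/-- The composition rules produce stores as nested updates and times as sums; this replaces them by
equal stores and a more convenient bound. -/
theorem Det.congr {c : Cmd} {s s' s₁ s₁' : Store} {T T' : ℕ} (h : Det O c s T s')
    (hs : s₁ = s) (hs' : s' = s₁') (hT : T ≤ T') : Det O c s₁ T' s₁' := by
  subst hs hs'
  exact h.mono hT

theorem Det.skip (s : Store) : Det O skip s 0 s :=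
  ⟨0, le_rfl, fun g hg => by
    rw [List.length_eq_zero_iff.mp hg]
    exact Exec.skip s⟩

theorem Det.push (r : ℕ) (b : Bool) (s : Store) :
    Det O (push r b) s 1 (Function.update s r (b :: s r)) :=
  ⟨1, le_rfl, fun g hg => by
    obtain ⟨x, rfl⟩ := List.length_eq_one_iff.mp hg
    exact Exec.push r b s x⟩

/-- `Det` provides an exact running time below its bound that does not depend on the choices; so a
choice sequence can be cut where the first phase ends. -/
theorem Det.seq {a b : Cmd} {s s₁ s₂ : Store} {T₁ T₂ : ℕ} (ha : Det O a s T₁ s₁)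
    (hb : Det O b s₁ T₂ s₂) : Det O (seq a b) s (T₁ + T₂) s₂ := by
  obtain ⟨t₁, h₁, ha⟩ := ha
  obtain ⟨t₂, h₂, hb⟩ := hb
  refine ⟨t₁ + t₂, by omega, fun g hg => ?_⟩
  rw [← List.take_append_drop t₁ g]
  exact Exec.seq (ha _ (by simp; omega)) (hb _ (by simp; omega))

theorem Det.cons {c c' : Cmd} {s s₀ s' : Store} {T : ℕ} (h : Det O c s T s')
    (hc : ∀ x g, Exec O c s g s' → Exec O c' s₀ (x :: g) s') : Det O c' s₀ (T + 1) s' := by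
  obtain ⟨t, ht, h⟩ := h
  refine ⟨t + 1, by omega, fun g hg => ?_⟩
  obtain ⟨x, g, rfl⟩ := List.exists_cons_of_length_eq_add_one hg
  exact hc x g (h g (by simpa using hg))

theorem Det.popNil {r : ℕ} {ce c₀ c₁ : Cmd} {s s' : Store} {T : ℕ} (h : s r = [])
    (he : Det O ce s T s') : Det O (pop r ce c₀ c₁) s (T + 1) s' :=
  he.cons fun x _ => Exec.popNil x h

theorem Det.popFalse {r : ℕ} {ce c₀ c₁ : Cmd} {s s' : Store} {T : ℕ} {l : List Bool}
    (h : s r = false :: l) (he : Det O c₀ (Function.update s r l) T s') :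
    Det O (pop r ce c₀ c₁) s (T + 1) s' :=
  he.cons fun x _ => Exec.popFalse x h

theorem Det.popTrue {r : ℕ} {ce c₀ c₁ : Cmd} {s s' : Store} {T : ℕ} {l : List Bool}
    (h : s r = true :: l) (he : Det O c₁ (Function.update s r l) T s') :
    Det O (pop r ce c₀ c₁) s (T + 1) s' :=
  he.cons fun x _ => Exec.popTrue x h

theorem Det.queryYes {r : ℕ} {cy cn : Cmd} {s s' : Store} {T : ℕ} (h : s r ∈ O)
    (he : Det O cy s T s') : Det O (query r cy cn) s (T + 1) s' :=
  he.cons fun x _ => Exec.queryYes x h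

theorem Det.queryNo {r : ℕ} {cy cn : Cmd} {s s' : Store} {T : ℕ} (h : s r ∉ O)
    (he : Det O cn s T s') : Det O (query r cy cn) s (T + 1) s' :=
  he.cons fun x _ => Exec.queryNo x h

theorem Det.loopNil {r : ℕ} {c₀ c₁ : Cmd} {s : Store} (h : s r = []) :
    Det O (loop r c₀ c₁) s 1 s :=
  ⟨1, le_rfl, fun g hg => by
    obtain ⟨x, rfl⟩ := List.length_eq_one_iff.mp hg
    exact Exec.loopNil x h⟩

theorem Det.loopCons {r : ℕ} {c₀ c₁ : Cmd} {s s₁ s₂ : Store} {T₁ T₂ : ℕ} {b : Bool}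
    {l : List Bool} (h : s r = b :: l)
    (ha : Det O (bif b then c₁ else c₀) (Function.update s r l) T₁ s₁)
    (hb : Det O (loop r c₀ c₁) s₁ T₂ s₂) : Det O (loop r c₀ c₁) s (T₁ + T₂ + 1) s₂ := by
  obtain ⟨t₁, h₁, ha⟩ := ha
  obtain ⟨t₂, h₂, hb⟩ := hb
  refine ⟨t₁ + t₂ + 1, by omega, fun g hg => ?_⟩
  obtain ⟨x, g, rfl⟩ := List.exists_cons_of_length_eq_add_one hg
  simp only [List.length_cons, add_left_inj] at hg
  rw [← List.take_append_drop t₁ g]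
  cases b
  · exact Exec.loopFalse x h (ha _ (by simp; omega)) (hb _ (by simp; omega))
  · exact Exec.loopTrue x h (ha _ (by simp; omega)) (hb _ (by simp; omega))

/-! ### Stores given by a list -/

/-- The store that agrees with `σ` below `d` and holds the entries of `L` from `d` on. -/
def mk (σ : Store) (d : ℕ) (L : List (List Bool)) : Store :=
  fun r => if r < d then σ r else L.getD (r - d) []

theorem mk_self (σ : Store) (d : ℕ) (L : List (List Bool)) : mk σ d L d = L.getD 0 [] := by
  simp [mk]

theorem mk_add (σ : Store) (d i : ℕ) (L : List (List Bool)) : mk σ d L (d + i) = L.getD i [] := by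
  simp [mk]

theorem update_mk_add (σ : Store) (d i : ℕ) (L : List (List Bool)) (l : List Bool)
    (h : i < L.length) : Function.update (mk σ d L) (d + i) l = mk σ d (L.set i l) := by
  funext r
  by_cases hr : r = d + i
  · subst hr
    simp [mk, h]
  · rw [Function.update_of_ne hr]
    unfold mk
    split_ifs with h'
    · rfl
    · simp only [List.getD_eq_getElem?_getD]
      rw [List.getElem?_set_ne (by omega)]

theorem update_mk_self (σ : Store) (d : ℕ) (a : List Bool) (L : List (List Bool)) (l : List Bool) :
    Function.update (mk σ d (a :: L)) d l = mk σ d (l :: L) := by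
  simpa using update_mk_add σ d 0 (a :: L) l (by simp)

/-- Registers beyond the list are empty by the default of `getD`, so an empty scratch register may
be added to the list or dropped from it. -/
theorem mk_append_nil (σ : Store) (d : ℕ) (L : List (List Bool)) :
    mk σ d (L ++ [[]]) = mk σ d L := by
  funext r
  unfold mk
  split_ifs with h
  · rfl
  · simp only [List.getD_eq_getElem?_getD, List.getElem?_append]
    split_ifs with h'
    · rfl
    · rw [List.getElem?_eq_none (by omega : L.length ≤ r - d)]
      rcases Nat.eq_zero_or_pos (r - d - L.length) with h0 | h0
      · simp [h0]
      · rw [List.getElem?_eq_none (by simp; omega)]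

/-- A subprogram that works from register `d'` on regards the lower registers as part of its base
store. This turns its specification into one about the whole frame. -/
theorem mk_nest (σ : Store) (d d' : ℕ) (L L' : List (List Bool)) (hd : d' = d + L.length) :
    mk (mk σ d L) d' L' = mk σ d (L ++ L') := by
  subst hd
  funext r
  unfold mk
  split_ifs with h h' h'
  · rfl
  · simp only [List.getD_eq_getElem?_getD]
    rw [List.getElem?_append_left (by omega)]
  · omega
  · simp only [List.getD_eq_getElem?_getD]
    rw [List.getElem?_append_right (by omega)]
    congr 2
    omega

/-! ### Moving and copying -/

/-- Clear a register. -/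
def clr (i : ℕ) : Cmd := loop i skip skip

/-- Move the bits of `i` to `j`, in reverse order. -/
def mv (i j : ℕ) : Cmd := loop i (push j false) (push j true)

/-- Move the bits of `i` to `j`, in the same order, through the empty register `k`. -/
def mv₂ (i j k : ℕ) : Cmd := seq (mv i k) (mv k j)

/-- Copy `i` to the empty register `j`, through the empty register `k`. -/
def dup (i j k : ℕ) : Cmd :=
  seq (mv i k) (loop k (seq (push i false) (push j false)) (seq (push i true) (push j true)))

theorem det_clr (i : ℕ) (s : Store) :
    Det O (clr i) s ((s i).length + 1) (Function.update s i []) := by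
  generalize hl : s i = l
  induction l generalizing s with
  | nil => exact (Det.loopNil hl).congr rfl (by simp [← hl]) (by simp)
  | cons b l ih =>
    have h1 : Det O (bif b then skip else skip) (Function.update s i l) 0
        (Function.update s i l) := by
      cases b <;> exact Det.skip _
    exact (Det.loopCons hl h1 (ih _ (by simp))).congr rfl (by simp)
      (by simp)

theorem det_mv {i j : ℕ} (hij : i ≠ j) (s : Store) :
    Det O (mv i j) s (2 * (s i).length + 1)
      (Function.update (Function.update s i []) j ((s i).reverse ++ s j)) := by
  generalize hl : s i = l
  induction l generalizing s with
  | nil =>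
    refine (Det.loopNil hl).congr rfl ?_ (by simp)
    rw [List.reverse_nil, List.nil_append, ← hl, Function.update_eq_self, Function.update_eq_self]
  | cons b l ih =>
    have h1 : Det O (bif b then push j true else push j false) (Function.update s i l) 1
        (Function.update (Function.update s i l) j (b :: Function.update s i l j)) := by
      cases b <;> exact Det.push _ _ _
    refine (Det.loopCons hl h1 (ih _ ?_)).congr rfl ?_ (by simp; omega)
    · simp [Function.update_of_ne hij]
    · funext r
      by_cases h : r = j
      · subst h; simp [Function.update_of_ne hij.symm]
      · by_cases h' : r = i
        · subst h'; simp [Function.update_of_ne hij]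
        · simp [Function.update_of_ne h, Function.update_of_ne h']

theorem det_mv₂ {i j k : ℕ} (hij : i ≠ j) (hik : i ≠ k) (hjk : j ≠ k) (s : Store)
    (hk : s k = []) : Det O (mv₂ i j k) s (4 * (s i).length + 2)
      (Function.update (Function.update s i []) j (s i ++ s j)) := by
  refine ((det_mv hik s).seq (det_mv hjk.symm _)).congr rfl ?_ ?_
  · funext r
    by_cases h : r = j
    · subst h; simp [hjk, hij.symm, hk]
    · by_cases h' : r = k
      · subst h'; simp [h, hik.symm, hk]
      · simp [h, h']
  · simp [hk]; omega

theorem det_dup {i j k : ℕ} (hij : i ≠ j) (hik : i ≠ k) (hjk : j ≠ k) (s : Store)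
    (hj : s j = []) (hk : s k = []) : Det O (dup i j k) s (5 * (s i).length + 2)
      (Function.update s j (s i)) := by
  have key : ∀ (l : List Bool) (s : Store), s k = l →
      Det O (loop k (seq (push i false) (push j false)) (seq (push i true) (push j true))) s
        (3 * l.length + 1) (Function.update (Function.update (Function.update s k [])
          i (l.reverse ++ s i)) j (l.reverse ++ s j)) := by
    intro l
    induction l with
    | nil =>
      intro s hl
      refine (Det.loopNil hl).congr rfl ?_ (by simp)
      rw [List.reverse_nil, List.nil_append, List.nil_append, ← hl, Function.update_eq_self,
        Function.update_eq_self, Function.update_eq_self]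
    | cons b l ih =>
      intro s hl
      have h1 : Det O (bif b then (seq (push i true) (push j true)) else
          (seq (push i false) (push j false))) (Function.update s k l) 2
          (Function.update (Function.update (Function.update s k l) i (b :: s i)) j (b :: s j)) := by
        cases b <;>
        · refine ((Det.push i _ _).seq (Det.push j _ _)).congr rfl ?_ le_rfl
          simp [hik, hjk, hij.symm]
      refine (Det.loopCons hl h1 (ih _ ?_)).congr rfl ?_ (by simp; omega)
      · simp [hik.symm, hjk.symm]
      · funext r
        by_cases h : r = j
        · subst h; simp
        · by_cases h' : r = i
          · subst h'; simp [hij]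
          · by_cases h'' : r = k
            · subst h''; simp [h, h']
            · simp [h, h', h'']
  refine ((det_mv hik s).seq (key _ _ rfl)).congr rfl ?_ ?_
  · funext r
    by_cases h : r = j
    · subst h; simp [hjk, hij.symm, hj, hk]
    · by_cases h' : r = i
      · subst h'; simp [hij, hik, hk]
      · by_cases h'' : r = k
        · subst h''; simp [h, h', hk]
        · simp [h, h', h'']
  · simp [hk]; omega

end Cmd


/-! ### Binary trees as data -/

/-- Binary trees. -/
inductive Dat where
  | nil
  | cons (a b : Dat)

namespace Dat

/-- The number of inner nodes. -/
def size : Dat → ℕ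
  | nil => 0
  | cons a b => size a + size b + 1

/-- The prefix code of a tree. -/
def code : Dat → List Bool
  | nil => [false]
  | cons a b => true :: (code a ++ code b)

theorem length_code (t : Dat) : t.code.length = 2 * t.size + 1 := by
  induction t with
  | nil => rfl
  | cons a b iha ihb => simp [code, size, iha, ihb]; omega

theorem count_code (t : Dat) : t.code.count true = t.size := by
  induction t with
  | nil => rfl
  | cons a b iha ihb => simp [code, size, iha, ihb]

/-- Read `c` trees from a bit string, which is continued by zeros if necessary; the second component
is the unread part. -/
def parse : List Bool → ℕ → List Dat × List Bool
  | x, 0 => ([], x)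
  | [], c + 1 => (List.replicate (c + 1) nil, [])
  | false :: x, c + 1 => (nil :: (parse x c).1, (parse x c).2)
  | true :: x, c + 1 =>
    (cons ((parse x (c + 2)).1.headD nil) ((parse x (c + 2)).1.tail.headD nil) ::
      (parse x (c + 2)).1.tail.tail, (parse x (c + 2)).2)

theorem parse_zero (x : List Bool) : parse x 0 = ([], x) := by
  cases x <;> rfl

theorem length_parse (x : List Bool) (c : ℕ) : (parse x c).1.length = c := by
  induction x generalizing c with
  | nil => cases c <;> simp [parse]
  | cons b x ih =>
    cases c with
    | zero => simp [parse]
    | succ c => cases b <;> simp [parse, ih]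

/-- The code is prefix-free: reading stops by itself at the end of `t`. -/
theorem parse_code_append (t : Dat) (x : List Bool) (c : ℕ) :
    parse (t.code ++ x) (c + 1) = (t :: (parse x c).1, (parse x c).2) := by
  induction t generalizing x c with
  | nil => rfl
  | cons a b iha ihb => simp [code, parse, iha, ihb]

/-- Each bit read raises the number of trees still wanted by at most one. So at most `x.length + c`
zeros have to be supplied at the end, in addition to the bits of `x`. -/
theorem length_code_parse_le (x : List Bool) (c : ℕ) :
    ((parse x c).1.flatMap code).length ≤ 2 * x.length + c := by
  induction x generalizing c with
  | nil => cases c <;> simp [parse, code]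
  | cons b x ih =>
    cases c with
    | zero => simp [parse]
    | succ c =>
      cases b
      · have := ih c
        simp [parse, code] at *
        omega
      · have h1 := ih (c + 2)
        have h2 := length_parse x (c + 2)
        match h : (parse x (c + 2)).1, h2 with
        | a :: b :: ts, _ =>
          simp [parse, code, h] at *
          omega

theorem length_parse_snd_le (x : List Bool) (c : ℕ) : (parse x c).2.length ≤ x.length := by
  induction x generalizing c with
  | nil => cases c <;> simp [parse]
  | cons a x ih =>
    cases c with
    | zero => simp [parse]
    | succ c =>
      have h1 := ih c
      have h2 := ih (c + 2)
      cases a <;> simp only [parse, List.length_cons] <;> omega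

/-- The tree at the beginning of a bit string, which is continued by zeros if necessary. -/
def ofCode (x : List Bool) : Dat := (parse x 1).1.headD nil

theorem ofCode_code_append (t : Dat) (x : List Bool) : ofCode (t.code ++ x) = t := by
  simp [ofCode, parse_code_append]

theorem ofCode_code (t : Dat) : ofCode t.code = t := by
  simpa using ofCode_code_append t []

theorem parse_one (x : List Bool) : (parse x 1).1 = [ofCode x] := by
  have := length_parse x 1
  match h : (parse x 1).1, this with
  | [a], _ => simp [ofCode, h]

/-- Valid for every bit string, also for one that is not a code; hence neither inputs nor
certificates need a syntactic check. -/
theorem size_ofCode_le (x : List Bool) : (ofCode x).size ≤ x.length := by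
  have := length_code_parse_le x 1
  simp [parse_one, length_code] at this
  omega

end Dat

/-! ### Reading trees from a stack -/

namespace Cmd

variable {O : Language Bool}

/-- Move trees from `i` to `j` (in reverse order), one for each bit of `k`. -/
def parseLoop (i j k : ℕ) : Cmd :=
  loop k skip (pop i (push j false) (push j false)
    (seq (push j true) (seq (push k true) (push k true))))

theorem det_parseLoop_nil {i j k : ℕ} (hij : i ≠ j) (hik : i ≠ k) (hjk : j ≠ k) (c : ℕ) (s : Store)
    (hi : s i = []) (hk : s k = List.replicate c true) :
    Det O (parseLoop i j k) s (5 * c + 1)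
      (Function.update (Function.update s k []) j (List.replicate c false ++ s j)) := by
  induction c generalizing s with
  | zero =>
    refine (Det.loopNil (by simpa using hk)).congr rfl ?_ le_rfl
    rw [List.replicate_zero, List.nil_append, ← show s k = [] by simpa using hk,
      Function.update_eq_self, Function.update_eq_self]
  | succ c ih =>
    rw [List.replicate_succ] at hk
    refine (Det.loopCons hk ((Det.popNil (T := 1) ?_ (Det.push _ _ _)).mono (T' := 4) (by omega))
      (ih _ ?_ ?_)).congr rfl ?_ (by omega)
    · simp [hik, hi]
    · simp [hij, hik, hi]
    · simp [hjk.symm]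
    · funext r
      by_cases h : r = j
      · subst h; simp [hjk, List.replicate_succ']
      · by_cases h' : r = k
        · subst h'; simp [h]
        · simp [h, h']

/-- Register `k` counts in unary the trees still to be read. A leaf uses up one of them; an inner
node replaces one by its two subtrees, which is why its `true` bit pushes two bits on `k`. -/
theorem det_parseLoop {i j k : ℕ} (hij : i ≠ j) (hik : i ≠ k) (hjk : j ≠ k) (x : List Bool)
    (c : ℕ) (s : Store) (hi : s i = x) (hk : s k = List.replicate c true) :
    Det O (parseLoop i j k) s (5 * ((Dat.parse x c).1.flatMap Dat.code).length + 1)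
      (Function.update (Function.update (Function.update s k []) i (Dat.parse x c).2) j
        (((Dat.parse x c).1.flatMap Dat.code).reverse ++ s j)) := by
  induction x generalizing c s with
  | nil =>
    cases c with
    | zero =>
      refine (det_parseLoop_nil hij hik hjk 0 s hi hk).congr rfl ?_ (by simp)
      simp only [Dat.parse]
      rw [← hi, Function.update_comm hik.symm, Function.update_eq_self]
      rfl
    | succ c =>
      refine (det_parseLoop_nil hij hik hjk _ s hi hk).congr rfl ?_ (by simp [Dat.parse, Dat.code])
      have h : ((List.replicate (c + 1) Dat.nil).flatMap Dat.code) =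
          List.replicate (c + 1) false := by
        clear hk
        induction c with
        | zero => rfl
        | succ c ih =>
          rw [List.replicate_succ, List.flatMap_cons, ih]
          rfl
      simp only [Dat.parse]
      rw [h, List.reverse_replicate, ← hi, Function.update_comm hik.symm, Function.update_eq_self]
  | cons b x ih =>
    cases c with
    | zero =>
      refine (Det.loopNil (by simpa using hk)).congr rfl ?_ (by simp)
      simp only [Dat.parse, List.flatMap_nil, List.reverse_nil, List.nil_append]
      rw [← hi, ← show s k = [] by simpa using hk, Function.update_eq_self, Function.update_eq_self,
        Function.update_eq_self]
    | succ c =>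
      rw [List.replicate_succ] at hk
      cases b
      · refine (Det.loopCons hk ((Det.popFalse (T := 1) (l := x) ?_ (Det.push _ _ _)).mono
          (T' := 4) (by omega)) (ih c _ ?_ ?_)).congr rfl ?_ ?_
        · simp [hik, hi]
        · simp [hij]
        · simp [hjk.symm, hik.symm]
        · funext r
          by_cases h : r = j
          · subst h; simp [hjk, hij.symm, Dat.parse, Dat.code]
          · by_cases h' : r = k
            · subst h'; simp [h, hik.symm]
            · by_cases h'' : r = i
              · subst h''; simp [h, Dat.parse]
              · simp [h, h', h'']
        · simp [Dat.parse, Dat.code]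
          omega
      · refine (Det.loopCons hk ((Det.popTrue (T := 3) (l := x) ?_
          ((Det.push _ _ _).seq ((Det.push _ _ _).seq (Det.push _ _ _)))).mono
          (T' := 4) (by omega)) (ih (c + 2) _ ?_ ?_)).congr rfl ?_ ?_
        · simp [hik, hi]
        · simp [hij, hik]
        · simp [hjk.symm, hik.symm, List.replicate_succ]
        · have h2 := Dat.length_parse x (c + 2)
          match hp : (Dat.parse x (c + 2)).1, h2 with
          | a :: b :: ts, _ =>
            funext r
            by_cases h : r = j
            · subst h; simp [hjk, hij.symm, Dat.parse, Dat.code, hp]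
            · by_cases h' : r = k
              · subst h'; simp [h, hik.symm]
              · by_cases h'' : r = i
                · subst h''; simp [h, Dat.parse]
                · simp [h, h', h'']
        · have h2 := Dat.length_parse x (c + 2)
          match hp : (Dat.parse x (c + 2)).1, h2 with
          | a :: b :: ts, _ =>
            simp [Dat.parse, Dat.code, hp]
            omega

/-- Move the first tree from `i` to the empty register `j` (in reverse order), where `k` is empty. -/
def parse (i j k : ℕ) : Cmd := seq (push k true) (parseLoop i j k)

theorem det_parse {i j k : ℕ} (hij : i ≠ j) (hik : i ≠ k) (hjk : j ≠ k) (s : Store)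
    (hj : s j = []) (hk : s k = []) :
    Det O (parse i j k) s (5 * (Dat.ofCode (s i)).code.length + 2)
      (Function.update (Function.update s i (Dat.parse (s i) 1).2) j
        (Dat.ofCode (s i)).code.reverse) := by
  refine ((Det.push k true s).seq (det_parseLoop hij hik hjk (s i) 1 _ (by simp [hik])
    (by simp [hk]))).congr rfl ?_ (by simp [Dat.parse_one]; omega)
  funext r
  by_cases h : r = j
  · subst h; simp [hjk, hj, Dat.parse_one]
  · by_cases h' : r = k
    · subst h'; simp [h, hik.symm, hk]
    · by_cases h'' : r = i
      · subst h''; simp [h]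
      · simp [h, h', h'']

end Cmd


/-! ### Tree programs -/

/-- Combinators for functions on trees. -/
inductive Fn where
  | id
  | nil
  | pair (f g : Fn)
  | hd
  | tl
  | comp (g f : Fn)
  /-- on `cons b x`, apply `f` to `x` if `b = nil` and `g` to `x` otherwise -/
  | branch (f g : Fn)
  /-- on `cons n x`, iterate `f` on `x`, as often as `n` has inner nodes -/
  | iter (f : Fn)
  /-- ask whether the code of the tree is in the oracle -/
  | query

namespace Dat

def hd : Dat → Dat
  | nil => nil
  | cons a _ => a

def tl : Dat → Dat
  | nil => nil
  | cons _ b => b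

theorem size_hd_le (t : Dat) : t.hd.size ≤ t.size := by
  cases t <;> simp [hd, size]; omega

theorem size_tl_le (t : Dat) : t.tl.size ≤ t.size := by
  cases t <;> simp [tl, size]; omega

end Dat

namespace Fn

open Dat in
open Classical in
/-- The function computed by a tree program. -/
noncomputable def eval (O : Language Bool) : Fn → Dat → Dat
  | id, v => v
  | nil, _ => Dat.nil
  | pair f g, v => cons (f.eval O v) (g.eval O v)
  | hd, v => v.hd
  | tl, v => v.tl
  | comp g f, v => g.eval O (f.eval O v)
  | branch f g, v =>
    match v with
    | .nil => .nil
    | .cons .nil x => f.eval O x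
    | .cons (.cons _ _) x => g.eval O x
  | iter f, v =>
    match v with
    | .nil => .nil
    | .cons n x => (f.eval O)^[n.size] x
  | query, v => if v.code ∈ O then cons .nil .nil else .nil

/-- The total cost of iterating `f`, where a single application costs `c`. -/
def iterCost (f : Dat → Dat) (c : Dat → ℕ) : ℕ → Dat → ℕ
  | 0, x => x.size
  | n + 1, x => c x + iterCost f c n (f x)

open Dat in
/-- A bound for the running time of the stack program for `f`. -/
noncomputable def cost (O : Language Bool) : Fn → Dat → ℕ
  | id, v => v.size
  | nil, v => 4 * (v.size + 1)
  | pair f g, v => f.cost O v + g.cost O v +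
      30 * (v.size + (f.eval O v).size + (g.eval O v).size + 1)
  | hd, v => 30 * (v.size + 1)
  | tl, v => 30 * (v.size + 1)
  | comp g f, v => f.cost O v + g.cost O (f.eval O v)
  | branch f g, v =>
    30 * (v.size + 1) +
    match v with
    | .nil => 0
    | .cons .nil x => f.cost O x
    | .cons (.cons _ _) x => g.cost O x
  | iter f, v =>
    30 * (v.size + 1) +
    match v with
    | .nil => 0
    | .cons n x => 30 * iterCost (f.eval O) (f.cost O) n.size x
  | query, v => 30 * (v.size + 1)

theorem size_iterate_le_iterCost (f : Dat → Dat) (c : Dat → ℕ) (n : ℕ) (x : Dat) :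
    (f^[n] x).size ≤ iterCost f c n x := by
  induction n generalizing x with
  | zero => exact le_rfl
  | succ n ih => exact (ih (f x)).trans (Nat.le_add_left _ _)

/-- Bounds on costs thus bound sizes too, so only costs have to be tracked. For this reason `cost`
charges the identity, and `iterCost` an empty iteration, for the size of the argument although no
step is executed. -/
theorem size_eval_le_cost (O : Language Bool) (f : Fn) (v : Dat) :
    (f.eval O v).size ≤ f.cost O v := by
  induction f generalizing v with
  | id => exact le_rfl
  | nil => exact Nat.zero_le _
  | pair f g ihf ihg =>
    simp only [eval, Dat.size, cost]
    omega
  | hd =>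
    have := v.size_hd_le
    simp only [eval, cost]
    omega
  | tl =>
    have := v.size_tl_le
    simp only [eval, cost]
    omega
  | comp g f ihg ihf => exact (ihg _).trans (Nat.le_add_left _ _)
  | branch f g ihf ihg =>
    match v with
    | .nil => simp [eval, Dat.size]
    | .cons .nil x => exact (ihf x).trans (Nat.le_add_left _ _)
    | .cons (.cons _ _) x => exact (ihg x).trans (Nat.le_add_left _ _)
  | iter f ih =>
    match v with
    | .nil => simp [eval, Dat.size]
    | .cons n x =>
      have := size_iterate_le_iterCost (f.eval O) (f.cost O) n.size x
      simp only [eval, cost]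
      omega
  | query =>
    simp only [eval, cost]
    split_ifs <;> simp only [Dat.size] <;> omega

open Cmd in
/-- The stack program for `f`: it replaces the code of a tree in register `d` by that of its image.
The registers above `d` have to be empty. -/
def toCmd : Fn → ℕ → Cmd
  | id, _ => skip
  | nil, d => seq (clr d) (push d false)
  | pair f g, d =>
    seq (dup d (d + 1) (d + 2)) <| seq (g.toCmd (d + 1)) <| seq (dup d (d + 2) (d + 3)) <|
    seq (f.toCmd (d + 2)) <| seq (clr d) <| seq (mv₂ (d + 1) d (d + 3)) <|
    seq (mv₂ (d + 2) d (d + 3)) (push d true)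
  | hd, d => pop d skip (push d false) <|
    seq (parse d (d + 1) (d + 2)) <| seq (clr d) (mv (d + 1) d)
  | tl, d => pop d skip (push d false) <|
    seq (parse d (d + 1) (d + 2)) (clr (d + 1))
  | comp g f, d => seq (f.toCmd d) (g.toCmd d)
  | branch f g, d => pop d skip (push d false) <|
    pop d skip (f.toCmd d) <|
    seq (push d true) <| seq (parse d (d + 1) (d + 2)) <| seq (clr (d + 1)) (g.toCmd d)
  | iter f, d => pop d skip (push d false) <|
    seq (parse d (d + 1) (d + 2)) <| seq (mv d (d + 2)) <| seq (mv (d + 1) d) <|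
    seq (mv (d + 2) (d + 1)) <| seq (loop d skip (f.toCmd (d + 1))) <|
    mv₂ (d + 1) d (d + 2)
  | query, d => Cmd.query d (seq (clr d) (seq (push d false) (seq (push d false) (push d true))))
    (seq (clr d) (push d false))

end Fn

/-! ### Correctness and running time of compiled tree programs -/

namespace Cmd

variable {O : Language Bool}

theorem det_parse_mk (σ : Store) (d : ℕ) (t : Dat) (x : List Bool) :
    Det O (parse d (d + 1) (d + 2)) (mk σ d [t.code ++ x]) (10 * t.size + 7)
      (mk σ d [x, t.code.reverse]) := by
  have h : mk σ d [t.code ++ x] = mk σ d [t.code ++ x, [], []] := by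
    rw [← mk_append_nil, ← mk_append_nil]; rfl
  refine (det_parse (by omega) (by omega) (by omega) _ ?_ ?_).congr h ?_ ?_
  · simp [mk_add]
  · simp [mk_add]
  · have h' : mk σ d [x, t.code.reverse] = mk σ d [x, t.code.reverse, []] := by
      rw [← mk_append_nil]; rfl
    rw [h', update_mk_self, update_mk_add _ _ _ _ _ (by simp)]
    simp [mk_self, Dat.parse_code_append, Dat.ofCode_code_append, Dat.parse_zero]
  · simp [mk_self, Dat.ofCode_code_append, Dat.length_code]
    omega

/-- Only a `true` bit triggers the body. The code of a tree has one such bit per inner node, so the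
code itself serves as loop counter. -/
theorem det_mk_iterate {c : Cmd} {F : Dat → Dat} {C : Dat → ℕ} {d : ℕ}
    (hc : ∀ σ v, Det O c (mk σ (d + 1) [v.code]) (C v) (mk σ (d + 1) [(F v).code]))
    (σ : Store) (l : List Bool) (x : Dat) :
    Det O (loop d skip c) (mk σ d [l, x.code])
      (l.length + 1 + Fn.iterCost F C (l.count true) x)
      (mk σ d [[], (F^[l.count true] x).code]) := by
  induction l generalizing x with
  | nil => exact (Det.loopNil (by simp [mk_self])).mono (by omega)
  | cons b l ih =>
    cases b
    · refine (Det.loopCons (b := false) (l := l) (by simp [mk_self]) (Det.skip _)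
        (by rw [update_mk_self]; exact ih x)).congr rfl ?_ ?_
      · simp
      · simp
    · have h : Det O c (Function.update (mk σ d [true :: l, x.code]) d l) (C x)
          (mk σ d [l, (F x).code]) := by
        rw [update_mk_self]
        have := hc (mk σ d [l]) x
        rwa [mk_nest _ _ _ _ _ (by simp), mk_nest _ _ _ _ _ (by simp)] at this
      refine (Det.loopCons (b := true) (l := l) (by simp [mk_self]) h (ih (F x))).congr rfl ?_ ?_
      · simp
      · simp [Fn.iterCost]; omega

end Cmd

open Cmd in
-- Structural induction. The one-element list says that all registers above `d` are empty before and
-- after, so subprograms can use them as scratch space. The generous constants in `cost` pay for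
-- copying, parsing and clearing, which are linear in the trees involved.
theorem Fn.det_toCmd (O : Language Bool) (f : Fn) (σ : Store) (d : ℕ) (v : Dat) :
    Det O (f.toCmd d) (mk σ d [v.code]) (f.cost O v) (mk σ d [(f.eval O v).code]) := by
  have two : ∀ (σ : Store) d (x y : List Bool), mk σ d [x, y, []] = mk σ d [x, y] :=
    fun σ d x y => mk_append_nil σ d [x, y]
  have one : ∀ (σ : Store) d (x : List Bool), mk σ d [x, []] = mk σ d [x] :=
    fun σ d x => mk_append_nil σ d [x]
  have three : ∀ (σ : Store) d (x y z : List Bool), mk σ d [x, y, z, []] = mk σ d [x, y, z] :=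
    fun σ d x y z => mk_append_nil σ d [x, y, z]
  have hdrop : ∀ (σ : Store) d (x : List Bool) (t : Dat), Det O (clr (d + 1))
      (mk σ d [x, t.code.reverse]) (2 * t.size + 2) (mk σ d [x]) := by
    intro σ d x t
    refine (det_clr _ _).congr rfl ?_ ?_
    · rw [update_mk_add _ _ _ _ _ (by simp), ← one]
      rfl
    · simp [mk_add, Dat.length_code]
  induction f generalizing σ d v with
  | id => exact (Det.skip _).mono (Nat.zero_le _)
  | nil =>
    refine ((det_clr _ _).seq (Det.push _ _ _)).congr rfl ?_ ?_
    · simp [update_mk_self, eval, Dat.code]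
    · simp [cost, mk_self, Dat.length_code]
      omega
  | pair f g ihf ihg =>
    have h1 : Det O (dup d (d + 1) (d + 2)) (mk σ d [v.code]) (10 * v.size + 7)
        (mk σ d [v.code, v.code]) := by
      refine (det_dup (by omega) (by omega) (by omega) (mk σ d [v.code, [], []]) ?_ ?_).congr
        ?_ ?_ ?_
      · simp [mk_add]
      · simp [mk_add]
      · rw [two, one]
      · rw [update_mk_add _ _ _ _ _ (by simp), ← two]
        simp [mk_self]
      · simp [mk_self, Dat.length_code]
        omega
    have h2 := ihg (mk σ d [v.code]) (d + 1) v
    rw [mk_nest _ _ _ _ _ (by simp), mk_nest _ _ _ _ _ (by simp)] at h2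
    have h3 : Det O (dup d (d + 2) (d + 3)) (mk σ d [v.code, (g.eval O v).code]) (10 * v.size + 7)
        (mk σ d [v.code, (g.eval O v).code, v.code]) := by
      refine (det_dup (by omega) (by omega) (by omega)
        (mk σ d [v.code, (g.eval O v).code, [], []]) ?_ ?_).congr ?_ ?_ ?_
      · simp [mk_add]
      · simp [mk_add]
      · rw [three, two]
      · rw [update_mk_add _ _ _ _ _ (by simp), ← three]
        simp [mk_self]
      · simp [mk_self, Dat.length_code]
        omega
    have h4 := ihf (mk σ d [v.code, (g.eval O v).code]) (d + 2) v
    rw [mk_nest _ _ _ _ _ (by simp), mk_nest _ _ _ _ _ (by simp)] at h4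
    have h5 : Det O (clr d) (mk σ d [v.code, (g.eval O v).code, (f.eval O v).code])
        (2 * v.size + 2) (mk σ d [[], (g.eval O v).code, (f.eval O v).code]) := by
      refine (det_clr _ _).congr rfl ?_ ?_
      · rw [update_mk_self]
      · simp [mk_self, Dat.length_code]
    -- The second component goes down first, so that the first one ends up on top of it, as the
    -- prefix code demands.
    have h6 : Det O (mv₂ (d + 1) d (d + 3)) (mk σ d [[], (g.eval O v).code, (f.eval O v).code])
        (8 * (g.eval O v).size + 6) (mk σ d [(g.eval O v).code, [], (f.eval O v).code]) := by
      refine (det_mv₂ (by omega) (by omega) (by omega) _ ?_).congr rfl ?_ ?_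
      · simp [mk_add]
      · rw [update_mk_add _ _ _ _ _ (by simp)]
        simp [mk_self, mk_add, update_mk_self]
      · simp [mk_add, Dat.length_code]
        omega
    have h7 : Det O (mv₂ (d + 2) d (d + 3)) (mk σ d [(g.eval O v).code, [], (f.eval O v).code])
        (8 * (f.eval O v).size + 6) (mk σ d [(f.eval O v).code ++ (g.eval O v).code]) := by
      refine (det_mv₂ (by omega) (by omega) (by omega) _ ?_).congr rfl ?_ ?_
      · simp [mk_add]
      · rw [update_mk_add _ _ _ _ _ (by simp)]
        simp [mk_self, mk_add, update_mk_self, two, one]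
      · simp [mk_add, Dat.length_code]
        omega
    refine (h1.seq <| h2.seq <| h3.seq <| h4.seq <| h5.seq <| h6.seq <| h7.seq <|
      Det.push _ _ _).congr rfl ?_ ?_
    · simp [update_mk_self, mk_self, eval, Dat.code]
    · simp only [cost]
      omega
  | hd =>
    cases v with
    | nil =>
      refine (Det.popFalse (l := []) (by simp [mk_self, Dat.code]) (Det.push _ _ _)).congr rfl ?_ ?_
      · simp [update_mk_self, eval, Dat.hd, Dat.code]
      · simp [cost, Dat.size]
    | cons a b =>
      have h1 := det_parse_mk (O := O) σ d a b.code
      refine (Det.popTrue (l := a.code ++ b.code) (by simp [mk_self, Dat.code])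
        (Det.seq (by rw [update_mk_self]; exact h1)
          ((det_clr _ _).seq (det_mv (by omega) _)))).congr rfl ?_ ?_
      · simp [update_mk_self, mk_add, update_mk_add, eval, Dat.hd, one]
      · simp [mk_self, mk_add, Dat.length_code, cost, Dat.size]
        omega
  | tl =>
    cases v with
    | nil =>
      refine (Det.popFalse (l := []) (by simp [mk_self, Dat.code]) (Det.push _ _ _)).congr rfl ?_ ?_
      · simp [update_mk_self, eval, Dat.tl, Dat.code]
      · simp [cost, Dat.size]
    | cons a b =>
      have h1 := det_parse_mk (O := O) σ d a b.code
      refine (Det.popTrue (l := a.code ++ b.code) (by simp [mk_self, Dat.code])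
        (Det.seq (by rw [update_mk_self]; exact h1) (hdrop _ _ _ _))).congr rfl rfl ?_
      simp [cost, Dat.size]
      omega
  | comp g f ihg ihf => exact (ihf σ d v).seq (ihg σ d _)
  | branch f g ihf ihg =>
    match v with
    | .nil =>
      refine (Det.popFalse (l := []) (by simp [mk_self, Dat.code]) (Det.push _ _ _)).congr rfl ?_ ?_
      · simp [update_mk_self, eval, Dat.code]
      · simp [cost, Dat.size]
    | .cons .nil x =>
      refine (Det.popTrue (l := false :: x.code) (by simp [mk_self, Dat.code])
        (Det.popFalse (l := x.code) (by simp) ?_)).congr (T := f.cost O x + 1 + 1) rfl rfl ?_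
      · rw [update_mk_self, update_mk_self]
        exact ihf σ d x
      · simp [cost, Dat.size]
        omega
    | .cons (.cons a b) x =>
      have h1 := det_parse_mk (O := O) σ d (.cons a b) x.code
      refine (Det.popTrue (l := true :: (a.code ++ b.code) ++ x.code) (by simp [mk_self, Dat.code])
        (Det.popTrue (l := (a.code ++ b.code) ++ x.code) (by simp)
        ((Det.push _ _ _).seq (Det.seq (s₁ := mk σ d [x.code, (Dat.cons a b).code.reverse])
          (by simp only [update_mk_self, mk_self]; exact h1)
          ((hdrop _ _ _ _).seq (ihg σ d x)))))).congr rfl rfl ?_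
      simp [cost, Dat.size]
      omega
  | iter f ih =>
    match v with
    | .nil =>
      refine (Det.popFalse (l := []) (by simp [mk_self, Dat.code]) (Det.push _ _ _)).congr rfl ?_ ?_
      · simp [update_mk_self, eval, Dat.code]
      · simp [cost, Dat.size]
    | .cons n x =>
      have h1 := det_parse_mk (O := O) σ d n x.code
      have h2 : Det O (mv d (d + 2)) (mk σ d [x.code, n.code.reverse]) (4 * x.size + 3)
          (mk σ d [[], n.code.reverse, x.code.reverse]) := by
        refine (det_mv (by omega) _).congr (two _ _ _ _).symm ?_ ?_
        · simp [mk_self, update_mk_self, mk_add, update_mk_add]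
        · simp [mk_self, Dat.length_code]
          omega
      have h3 : Det O (mv (d + 1) d) (mk σ d [[], n.code.reverse, x.code.reverse]) (4 * n.size + 3)
          (mk σ d [n.code, [], x.code.reverse]) := by
        refine (det_mv (by omega) _).congr rfl ?_ ?_
        · simp [mk_self, update_mk_self, mk_add, update_mk_add]
        · simp [mk_add, Dat.length_code]
          omega
      have h4 : Det O (mv (d + 2) (d + 1)) (mk σ d [n.code, [], x.code.reverse]) (4 * x.size + 3)
          (mk σ d [n.code, x.code]) := by
        refine (det_mv (by omega) _).congr rfl ?_ ?_
        · simp [mk_add, update_mk_add, two]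
        · simp [mk_add, Dat.length_code]
          omega
      have h5 := det_mk_iterate (fun σ v => ih σ (d + 1) v) σ n.code x
      rw [Dat.count_code] at h5
      have h6 : Det O (mv₂ (d + 1) d (d + 2)) (mk σ d [[], ((f.eval O)^[n.size] x).code])
          (8 * ((f.eval O)^[n.size] x).size + 6) (mk σ d [((f.eval O)^[n.size] x).code]) := by
        refine (det_mv₂ (by omega) (by omega) (by omega) _ ?_).congr rfl ?_ ?_
        · simp [mk_add]
        · simp [mk_self, mk_add, update_mk_self, update_mk_add, one]
        · simp [mk_add, Dat.length_code]
          omega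
      refine (Det.popTrue (l := n.code ++ x.code) (by simp [mk_self, Dat.code])
        (Det.seq (by rw [update_mk_self]; exact h1)
          (h2.seq <| h3.seq <| h4.seq <| h5.seq h6))).congr rfl rfl ?_
      have h7 := size_iterate_le_iterCost (f.eval O) (f.cost O) n.size x
      simp only [cost, Dat.size, Dat.length_code]
      omega
  | query =>
    by_cases hv : v.code ∈ O
    · refine (Det.queryYes (by simpa [mk_self] using hv) ((det_clr _ _).seq ((Det.push _ _ _).seq
        ((Det.push _ _ _).seq (Det.push _ _ _))))).congr rfl ?_ ?_
      · simp [update_mk_self, eval, hv, Dat.code]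
      · simp [cost, mk_self, Dat.length_code]
        omega
    · refine (Det.queryNo (by simpa [mk_self] using hv) ((det_clr _ _).seq
        (Det.push _ _ _))).congr rfl ?_ ?_
      · simp [update_mk_self, eval, hv, Dat.code]
      · simp [cost, mk_self, Dat.length_code]
        omega


/-! ### Encodings of data by trees -/

/-- Types whose elements are represented by trees. -/
class Enc (α : Type) where
  enc : α → Dat

open Enc (enc)

instance : Enc Dat := ⟨fun t => t⟩

instance : Enc Bool := ⟨fun b => bif b then .cons .nil .nil else .nil⟩

instance {α β : Type} [Enc α] [Enc β] : Enc (α × β) := ⟨fun p => .cons (enc p.1) (enc p.2)⟩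

instance {α : Type} [Enc α] : Enc (List α) := ⟨fun l => l.foldr (fun a t => .cons (enc a) t) .nil⟩

/-- Unary, so that the size of a number is the number itself and cost bounds in the size are bounds
in the number. -/
instance : Enc ℕ := ⟨fun n => (Dat.cons .nil)^[n] .nil⟩

section

variable {α β : Type} [Enc α] [Enc β]

@[simp] theorem enc_dat (t : Dat) : enc t = t := rfl
@[simp] theorem enc_true : enc true = .cons .nil .nil := rfl
@[simp] theorem enc_false : enc false = .nil := rfl
@[simp] theorem enc_pair (a : α) (b : β) : enc (a, b) = .cons (enc a) (enc b) := rfl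
@[simp] theorem enc_nil : enc ([] : List α) = .nil := rfl
@[simp] theorem enc_cons (a : α) (l : List α) : enc (a :: l) = .cons (enc a) (enc l) := rfl
@[simp] theorem enc_zero : enc 0 = .nil := rfl
@[simp] theorem enc_succ (n : ℕ) : enc (n + 1) = .cons .nil (enc n) :=
  Function.iterate_succ_apply' _ _ _

/-- The size of the representation. -/
def sz (a : α) : ℕ := (enc a).size

@[simp] theorem sz_dat (t : Dat) : sz t = t.size := rfl
@[simp] theorem sz_true : sz true = 1 := rfl
@[simp] theorem sz_false : sz false = 0 := rfl
@[simp] theorem sz_pair (a : α) (b : β) : sz (a, b) = sz a + sz b + 1 := rfl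
@[simp] theorem sz_nil : sz ([] : List α) = 0 := rfl
@[simp] theorem sz_cons (a : α) (l : List α) : sz (a :: l) = sz a + sz l + 1 := rfl

@[simp] theorem sz_nat (n : ℕ) : sz n = n := by
  induction n with
  | zero => rfl
  | succ n ih => simpa [sz, Dat.size] using ih

theorem sz_prod (p : α × β) : sz p = sz p.1 + sz p.2 + 1 := rfl

theorem sz_bool_le (b : Bool) : sz b ≤ 1 := by cases b <;> simp

end

/-! ### Exponential bounds -/

/-- `T n = 2^{O(n)}`. -/
def ExpBound (T : ℕ → ℕ) : Prop := ∃ c : ℕ, ∀ n, T n ≤ c * 2 ^ (c * n)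

namespace ExpBound

variable {T T' : ℕ → ℕ}

theorem const (a : ℕ) : ExpBound fun _ => a :=
  ⟨a, fun _ => Nat.le_mul_of_pos_right _ (by positivity)⟩

theorem id : ExpBound fun n => n :=
  ⟨1, fun n => by simpa using n.lt_two_pow_self.le⟩

theorem add (h : ExpBound T) (h' : ExpBound T') : ExpBound fun n => T n + T' n := by
  obtain ⟨c, hc⟩ := h
  obtain ⟨d, hd⟩ := h'
  refine ⟨c + d, fun n => (Nat.add_le_add (hc n) (hd n)).trans ?_⟩
  rw [add_mul c d (2 ^ _)]
  gcongr <;> omega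

theorem mul (h : ExpBound T) (h' : ExpBound T') : ExpBound fun n => T n * T' n := by
  obtain ⟨c, hc⟩ := h
  obtain ⟨d, hd⟩ := h'
  refine ⟨c * d + (c + d), fun n => (Nat.mul_le_mul (hc n) (hd n)).trans ?_⟩
  calc c * 2 ^ (c * n) * (d * 2 ^ (d * n)) = c * d * 2 ^ ((c + d) * n) := by ring
    _ ≤ _ := Nat.mul_le_mul (Nat.le_add_right _ _)
      (Nat.pow_le_pow_right (by norm_num) (Nat.mul_le_mul_right n (Nat.le_add_left _ _)))

theorem pow (h : ExpBound T) (k : ℕ) : ExpBound fun n => T n ^ k := by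
  induction k with
  | zero => simpa using const 1
  | succ k ih => simpa [pow_succ] using ih.mul h

end ExpBound

/-! ### Removing queries -/

namespace Fn

/-- Replace all queries by a negative answer. -/
def strip : Fn → Fn
  | pair f g => pair f.strip g.strip
  | comp g f => comp g.strip f.strip
  | branch f g => branch f.strip g.strip
  | iter f => iter f.strip
  | query => nil
  | f => f

/-- `NE` is defined by query-free machines with the empty oracle. That oracle always answers no, and
`nil` represents this answer. -/
theorem eval_strip (f : Fn) : f.strip.eval ⊥ = f.eval ⊥ := by
  induction f with
  | pair f g ihf ihg => funext v; simp [strip, eval, ihf, ihg]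
  | comp g f ihg ihf => funext v; simp [strip, eval, ihf, ihg]
  | branch f g ihf ihg => funext v; simp [strip, eval, ihf, ihg]
  | iter f ih => funext v; simp [strip, eval, ih]
  | query =>
    funext v
    simp only [strip, eval]
    rw [if_neg (show v.code ∉ (⊥ : Language Bool) from fun h => Set.notMem_empty _ h)]
  | _ => rfl

theorem iterCost_mono (f : Dat → Dat) {c c' : Dat → ℕ} (h : ∀ v, c v ≤ c' v) (n : ℕ) (x : Dat) :
    iterCost f c n x ≤ iterCost f c' n x := by
  induction n generalizing x with
  | zero => exact le_rfl
  | succ n ih => exact Nat.add_le_add (h x) (ih _)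

theorem cost_strip_le (f : Fn) (v : Dat) : f.strip.cost ⊥ v ≤ f.cost ⊥ v := by
  induction f generalizing v with
  | pair f g ihf ihg =>
    have := ihf v
    have := ihg v
    simp only [strip, cost, eval_strip]
    omega
  | comp g f ihg ihf =>
    simp only [strip, cost, eval_strip]
    exact Nat.add_le_add (ihf _) (ihg _)
  | branch f g ihf ihg =>
    simp only [strip, cost]
    rcases v with _ | ⟨_ | ⟨a, b⟩, x⟩
    · exact le_rfl
    · exact Nat.add_le_add_left (ihf _) _
    · exact Nat.add_le_add_left (ihg _) _
  | iter f ih =>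
    simp only [strip, cost, eval_strip]
    rcases v with _ | ⟨n, x⟩
    · exact le_rfl
    · have := iterCost_mono (f.eval ⊥) ih n.size x
      simp only
      omega
  | query =>
    simp only [strip, cost]
    omega
  | _ => exact le_rfl

theorem queryFree_toCmd_strip (f : Fn) (d : ℕ) : (f.strip.toCmd d).QueryFree := by
  induction f generalizing d with
  | pair f g ihf ihg =>
    simp [strip, toCmd, Cmd.QueryFree, Cmd.dup, Cmd.mv, Cmd.clr, Cmd.mv₂, ihf, ihg]
  | comp g f ihg ihf => simp [strip, toCmd, Cmd.QueryFree, ihf, ihg]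
  | branch f g ihf ihg =>
    simp [strip, toCmd, Cmd.QueryFree, Cmd.parse, Cmd.parseLoop, Cmd.clr, ihf, ihg]
  | iter f ih =>
    simp [strip, toCmd, Cmd.QueryFree, Cmd.parse, Cmd.parseLoop, Cmd.mv, Cmd.mv₂, ih]
  | _ => simp [strip, toCmd, Cmd.QueryFree, Cmd.parse, Cmd.parseLoop, Cmd.clr, Cmd.mv]

theorem guessFree_toCmd (f : Fn) (d : ℕ) : (f.toCmd d).GuessFree := by
  induction f generalizing d with
  | pair f g ihf ihg =>
    simp [toCmd, Cmd.GuessFree, Cmd.dup, Cmd.mv, Cmd.clr, Cmd.mv₂, ihf, ihg]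
  | comp g f ihg ihf => simp [toCmd, Cmd.GuessFree, ihf, ihg]
  | branch f g ihf ihg =>
    simp [toCmd, Cmd.GuessFree, Cmd.parse, Cmd.parseLoop, Cmd.clr, ihf, ihg]
  | iter f ih =>
    simp [toCmd, Cmd.GuessFree, Cmd.parse, Cmd.parseLoop, Cmd.mv, Cmd.mv₂, ih]
  | _ => simp [toCmd, Cmd.GuessFree, Cmd.parse, Cmd.parseLoop, Cmd.clr, Cmd.mv]

end Fn

/-! ### Runs of compiled machines, and guessing -/

namespace Machine

variable {M : Machine} {O : Language Bool}

theorem run_append (g g' : List Bool) (c : M.Cfg) :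
    M.run O (g ++ g') c = M.run O g' (M.run O g c) := by
  simp [run]

/-- Allows a path that has halted to be padded to any length. -/
theorem Cfg.Halted.run_eq {c : M.Cfg} (h : c.Halted) (g : List Bool) : M.run O g c = c := by
  obtain ⟨a, ha⟩ := h
  induction g with
  | nil => rfl
  | cons b g ih =>
    have : M.step O c b = c := by simp [step, ha]
    simpa [run, this] using ih

theorem Cfg.Accepting.halted {c : M.Cfg} (h : c.Accepting) : c.Halted := ⟨true, h⟩

end Machine

namespace Cmd

variable {O : Language Bool}

theorem init_toMachine (c : Cmd) (N : ℕ) [NeZero N] (o r : ℕ) (x : List Bool) :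
    (c.toMachine N 0 o r).init x =
      cfg c N 0 o r (entry c Sum.inl (Sum.inr none)) (mk (fun _ => []) 0 [x]) := by
  refine congrArg (Machine.Cfg.mk _) (funext fun i : Fin N => ?_)
  change (if i = Fin.ofNat N 0 then x else []) = mk (fun _ => []) 0 [x] i
  split_ifs with h
  · simp [h, mk]
  · have : (i : ℕ) ≠ 0 := fun h' => h (by ext; simp [h'])
    obtain ⟨k, hk⟩ := Nat.exists_eq_succ_of_ne_zero this
    simp [mk, hk]

/-- The final state of a machine that pops a bit from a register with contents `l`. -/
def verdict (l : List Bool) : Bool := l.headD false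

/-- After the program one more step pops the verdict, and from then on the machine idles; so `g'`
only has to be nonempty. -/
theorem Exec.run_toMachine {c : Cmd} {N : ℕ} [NeZero N] {o r : ℕ} {x g g' : List Bool} {s' : Store}
    (h : Exec O c (mk (fun _ => []) 0 [x]) g s') (hN : c.Below N) (hr : r < N) (hg : g' ≠ []) :
    (c.toMachine N 0 o r).run O (g ++ g') ((c.toMachine N 0 o r).init x) =
      cfg c N 0 o r (.inr (some (verdict (s' r)))) (Function.update s' r (s' r).tail) := by
  obtain ⟨b, g', rfl⟩ := List.exists_cons_of_ne_nil hg
  rw [Machine.run_append, init_toMachine, h.run_eq hN _ _ (fun _ => rfl)]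
  have hstep : (c.toMachine N 0 o r).step O (cfg c N 0 o r (.inr none) s') b =
      cfg c N 0 o r (.inr (some (verdict (s' r)))) (Function.update s' r (s' r).tail) := by
    have hprog : (c.toMachine N 0 o r).prog (.inr none) = .pop (Fin.ofNat N r)
      (.inr (some false)) (.inr (some false)) (.inr (some true)) := rfl
    have hupd := restrict_update s' hr
    unfold cfg at *
    rcases hs : s' r with _ | ⟨_ | _, l⟩
    · simp only [Machine.step, hprog, ofNat_val_of_lt hr, hs, List.tail_nil]
      have h0 : Function.update s' r [] = s' := by rw [← hs, Function.update_eq_self]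
      rw [h0]
      rfl
    · simp only [Machine.step, hprog, ofNat_val_of_lt hr, hs, List.tail_cons]
      rw [← hupd l]
      rfl
    · simp only [Machine.step, hprog, ofNat_val_of_lt hr, hs, List.tail_cons]
      rw [← hupd l]
      rfl
  change (c.toMachine N 0 o r).run O g' ((c.toMachine N 0 o r).step O _ b) = _
  rw [hstep]
  exact Machine.Cfg.Halted.run_eq ⟨_, rfl⟩ _

/-- Push a guessed bit on `j` for each `true` in `i`. -/
def guessLoop (i j : ℕ) : Cmd := loop i skip (guess j)

/-- Every `w` of the right length is reached by some path. The length of the path consists of one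
pop per bit of `l`, two steps per guess and the final test for emptiness. -/
theorem exec_guessLoop {i j : ℕ} (hij : i ≠ j) (l w : List Bool) (hw : w.length = l.count true)
    (s : Store) (hl : s i = l) : ∃ g : List Bool, g.length = l.length + 2 * l.count true + 1 ∧
      Exec O (guessLoop i j) s g
        (Function.update (Function.update s i []) j (w.reverse ++ s j)) := by
  induction l generalizing s w with
  | nil =>
    refine ⟨[true], by simp, ?_⟩
    have : w = [] := by simpa using hw
    subst this
    have h0 : Function.update (Function.update s i []) j (([] : List Bool).reverse ++ s j) = s := by
      rw [List.reverse_nil, List.nil_append, ← hl, Function.update_eq_self, Function.update_eq_self]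
    rw [h0]
    exact Exec.loopNil _ hl
  | cons b l ih =>
    cases b
    · obtain ⟨g, hg, h⟩ := ih w (by simpa using hw) (Function.update s i l) (by simp)
      refine ⟨true :: ([] ++ g), by simp [hg]; omega, ?_⟩
      have := Exec.loopFalse (O := O) true hl (Exec.skip _) h
      simpa [guessLoop, Function.update_of_ne hij.symm] using this
    · obtain ⟨b, w, rfl⟩ := List.exists_cons_of_length_eq_add_one
        (show w.length = l.count true + 1 by simpa using hw)
      obtain ⟨g, hg, h⟩ := ih w (by simpa using hw)
        (Function.update (Function.update s i l) j (b :: s j)) (by simp [hij])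
      refine ⟨true :: ([b, true] ++ g), by simp [hg]; omega, ?_⟩
      have h1 := Exec.guess (O := O) j (Function.update s i l) b true
      rw [Function.update_of_ne hij.symm] at h1
      have := Exec.loopTrue (O := O) true hl h1 h
      refine (congrArg _ ?_).mp this
      funext r
      by_cases h : r = j
      · subst h; simp
      · by_cases h' : r = i
        · subst h'; simp [hij]
        · simp [h, h']

/-- Conversely, every path of that length guesses some `w`, since the number of steps does not
depend on the guessed bits. -/
theorem exists_exec_guessLoop {i j : ℕ} (hij : i ≠ j) (l g : List Bool)
    (s : Store) (hl : s i = l) (hg : g.length = l.length + 2 * l.count true + 1) :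
    ∃ w : List Bool, w.length = l.count true ∧ Exec O (guessLoop i j) s g
        (Function.update (Function.update s i []) j (w.reverse ++ s j)) := by
  induction l generalizing s g with
  | nil =>
    refine ⟨[], by simp, ?_⟩
    obtain ⟨x, rfl⟩ := List.length_eq_one_iff.mp (by simpa using hg)
    have h0 : Function.update (Function.update s i []) j (([] : List Bool).reverse ++ s j) = s := by
      rw [List.reverse_nil, List.nil_append, ← hl, Function.update_eq_self, Function.update_eq_self]
    rw [h0]
    exact Exec.loopNil _ hl
  | cons b l ih =>
    obtain ⟨x, g, rfl⟩ := List.exists_cons_of_length_eq_add_one hg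
    cases b
    · obtain ⟨w, hw, h⟩ := ih g (Function.update s i l) (by simp) (by simp at hg; omega)
      refine ⟨w, by simpa using hw, ?_⟩
      have := Exec.loopFalse (O := O) x hl (Exec.skip _) h
      simpa [guessLoop, Function.update_of_ne hij.symm] using this
    · obtain ⟨b, g, rfl⟩ := List.exists_cons_of_length_pos
        (show 0 < g.length by simp at hg; omega)
      obtain ⟨y, g, rfl⟩ := List.exists_cons_of_length_pos
        (show 0 < g.length by simp at hg; omega)
      obtain ⟨w, hw, h⟩ := ih g
        (Function.update (Function.update s i l) j (b :: s j)) (by simp [hij])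
        (by simp at hg; omega)
      refine ⟨b :: w, by simpa using hw, ?_⟩
      have h1 := Exec.guess (O := O) j (Function.update s i l) b y
      rw [Function.update_of_ne hij.symm] at h1
      have := Exec.loopTrue (O := O) x hl h1 h
      refine (congrArg _ ?_).mp this
      funext r
      by_cases h : r = j
      · subst h; simp
      · by_cases h' : r = i
        · subst h'; simp [hij]
        · simp [h, h']

end Cmd


/-! ### Verification of certificates in `NE` -/

namespace Cmd

/-- The deterministic preparation of `verifier`: read a tree `z` and compute `B z` twice. -/
def prepare (B : Fn) : Cmd :=
  seq (parse 0 1 2) <| seq (clr 0) <| seq (mv 1 0) <| seq (dup 0 1 2) <| seq (B.toCmd 1)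
    (dup 1 2 3)

/-- The deterministic end of `verifier`: apply `V` to `z`, `B z` and the tree given by the guess. -/
def conclude (V : Fn) : Cmd :=
  seq (parse 3 4 5) <| seq (clr 3) <| seq (mv 4 3) <| seq (mv₂ 1 3 2) <| seq (push 3 true) <|
    seq (mv₂ 0 3 2) <| seq (push 3 true) (V.toCmd 3)

/-- Read a tree `z`, compute `B z`, guess as many bits as this tree has inner nodes and apply `V`. -/
def verifier (B V : Fn) : Cmd :=
  seq (prepare B) (seq (guessLoop 2 3) (conclude V))

variable {O : Language Bool}

theorem det_prepare (B : Fn) (σ : Store) (x : List Bool) (z b : Dat) (hz : Dat.ofCode x = z)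
    (hb : B.eval O z = b) :
    Det O (prepare B) (mk σ 0 [x]) (40 * (x.length + b.size + 1) + B.cost O z)
      (mk σ 0 [z.code, b.code, b.code]) := by
  have h1 : Det O (parse 0 1 2) (mk σ 0 [x]) (10 * z.size + 7)
      (mk σ 0 [(Dat.parse x 1).2, z.code.reverse]) := by
    refine (det_parse (by omega) (by omega) (by omega) (mk σ 0 [x, []]) ?_ ?_).congr
      (mk_append_nil σ 0 [x]).symm ?_ ?_
    · simp [mk]
    · simp [mk]
    · rw [update_mk_self, show (1 : ℕ) = 0 + 1 from rfl, update_mk_add _ _ _ _ _ (by simp)]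
      simp [mk, hz]
    · simp [mk, hz, Dat.length_code]
      omega
  have h2 : Det O (clr 0) (mk σ 0 [(Dat.parse x 1).2, z.code.reverse]) (x.length + 1)
      (mk σ 0 [[], z.code.reverse]) := by
    refine (det_clr _ _).congr rfl ?_ ?_
    · rw [update_mk_self]
    · simpa [mk] using Dat.length_parse_snd_le x 1
  have h3 : Det O (mv 1 0) (mk σ 0 [[], z.code.reverse]) (4 * z.size + 3) (mk σ 0 [z.code]) := by
    refine (det_mv (by omega) _).congr rfl ?_ ?_
    · rw [show (1 : ℕ) = 0 + 1 from rfl, update_mk_add _ _ _ _ _ (by simp)]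
      simp only [List.set_cons_succ, List.set_cons_zero, update_mk_self]
      rw [← mk_append_nil σ 0 [z.code]]
      simp [mk]
    · simp [mk, Dat.length_code]
      omega
  have h4 : Det O (dup 0 1 2) (mk σ 0 [z.code]) (10 * z.size + 7) (mk σ 0 [z.code, z.code]) := by
    refine (det_dup (by omega) (by omega) (by omega) (mk σ 0 [z.code, []]) ?_ ?_).congr
      (mk_append_nil σ 0 [z.code]).symm ?_ ?_
    · simp [mk]
    · simp [mk]
    · rw [show (1 : ℕ) = 0 + 1 from rfl, update_mk_add _ _ _ _ _ (by simp)]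
      simp [mk]
    · simp [mk, Dat.length_code]
      omega
  have h5 := B.det_toCmd O (mk σ 0 [z.code]) 1 z
  rw [mk_nest _ _ _ _ _ (by simp), mk_nest _ _ _ _ _ (by simp), hb] at h5
  have h6 : Det O (dup 1 2 3) (mk σ 0 [z.code, b.code]) (10 * b.size + 7)
      (mk σ 0 [z.code, b.code, b.code]) := by
    refine (det_dup (by omega) (by omega) (by omega) (mk σ 0 [z.code, b.code, []]) ?_ ?_).congr
      (mk_append_nil σ 0 [z.code, b.code]).symm ?_ ?_
    · simp [mk]
    · simp [mk]
    · rw [show (2 : ℕ) = 0 + 2 from rfl, update_mk_add _ _ _ _ _ (by simp)]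
      simp [mk]
    · simp [mk, Dat.length_code]
      omega
  have hs : z.size ≤ x.length := hz ▸ Dat.size_ofCode_le x
  refine (h1.seq <| h2.seq <| h3.seq <| h4.seq <| h5.seq h6).mono ?_
  omega

/-- The guessed bits, whatever they are, are read as a tree. The argument of `V` is then assembled
on register `3` from the rear: this tree, then `b`, then `z`, with a `true` for each of the two
pairs. -/
theorem det_conclude (V : Fn) (σ : Store) (z b : Dat) (w : List Bool) :
    Det O (conclude V) (mk σ 0 [z.code, b.code, [], w])
      (40 * (z.size + b.size + w.length + 1) + V.cost O (.cons z (.cons b (Dat.ofCode w))))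
      (mk σ 0 [[], [], [], (V.eval O (.cons z (.cons b (Dat.ofCode w)))).code]) := by
  set t := Dat.ofCode w with ht
  have hs : t.size ≤ w.length := Dat.size_ofCode_le w
  have h1 : Det O (parse 3 4 5) (mk σ 0 [z.code, b.code, [], w]) (10 * t.size + 7)
      (mk σ 0 [z.code, b.code, [], (Dat.parse w 1).2, t.code.reverse]) := by
    refine (det_parse (by omega) (by omega) (by omega) (mk σ 0 [z.code, b.code, [], w, []])
      ?_ ?_).congr (mk_append_nil σ 0 _).symm ?_ ?_
    · simp [mk]
    · simp [mk]
    · rw [show (3 : ℕ) = 0 + 3 from rfl, show (4 : ℕ) = 0 + 4 from rfl,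
        update_mk_add _ _ _ _ _ (by simp), update_mk_add _ _ _ _ _ (by simp)]
      simp [mk, ht]
    · simp [mk, ← ht, Dat.length_code]
      omega
  have h2 : Det O (clr 3) (mk σ 0 [z.code, b.code, [], (Dat.parse w 1).2, t.code.reverse])
      (w.length + 1) (mk σ 0 [z.code, b.code, [], [], t.code.reverse]) := by
    refine (det_clr _ _).congr rfl ?_ ?_
    · rw [show (3 : ℕ) = 0 + 3 from rfl, update_mk_add _ _ _ _ _ (by simp)]
      simp
    · simpa [mk] using Dat.length_parse_snd_le w 1
  have h3 : Det O (mv 4 3) (mk σ 0 [z.code, b.code, [], [], t.code.reverse]) (4 * t.size + 3)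
      (mk σ 0 [z.code, b.code, [], t.code]) := by
    refine (det_mv (by omega) _).congr rfl ?_ ?_
    · rw [show (3 : ℕ) = 0 + 3 from rfl, show (4 : ℕ) = 0 + 4 from rfl,
        update_mk_add _ _ _ _ _ (by simp), update_mk_add _ _ _ _ _ (by simp),
        ← mk_append_nil σ 0 [z.code, b.code, [], t.code]]
      simp [mk]
    · simp [mk, Dat.length_code]
      omega
  have h4 : Det O (mv₂ 1 3 2) (mk σ 0 [z.code, b.code, [], t.code]) (8 * b.size + 6)
      (mk σ 0 [z.code, [], [], b.code ++ t.code]) := by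
    refine (det_mv₂ (by omega) (by omega) (by omega) _ ?_).congr rfl ?_ ?_
    · simp [mk]
    · rw [show (3 : ℕ) = 0 + 3 from rfl, show (1 : ℕ) = 0 + 1 from rfl,
        update_mk_add _ _ _ _ _ (by simp), update_mk_add _ _ _ _ _ (by simp)]
      simp [mk]
    · simp [mk, Dat.length_code]
      omega
  have h5 : Det O (push 3 true) (mk σ 0 [z.code, [], [], b.code ++ t.code]) 1
      (mk σ 0 [z.code, [], [], true :: (b.code ++ t.code)]) := by
    refine (Det.push _ _ _).congr rfl ?_ le_rfl
    rw [show (3 : ℕ) = 0 + 3 from rfl, update_mk_add _ _ _ _ _ (by simp)]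
    simp [mk]
  have h6 : Det O (mv₂ 0 3 2) (mk σ 0 [z.code, [], [], true :: (b.code ++ t.code)])
      (8 * z.size + 6) (mk σ 0 [[], [], [], z.code ++ true :: (b.code ++ t.code)]) := by
    refine (det_mv₂ (by omega) (by omega) (by omega) _ ?_).congr rfl ?_ ?_
    · simp [mk]
    · rw [update_mk_self, show (3 : ℕ) = 0 + 3 from rfl, update_mk_add _ _ _ _ _ (by simp)]
      simp [mk]
    · simp [mk, Dat.length_code]
      omega
  have h7 : Det O (push 3 true) (mk σ 0 [[], [], [], z.code ++ true :: (b.code ++ t.code)]) 1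
      (mk σ 0 [[], [], [], (Dat.cons z (.cons b t)).code]) := by
    refine (Det.push _ _ _).congr rfl ?_ le_rfl
    rw [show (3 : ℕ) = 0 + 3 from rfl, update_mk_add _ _ _ _ _ (by simp)]
    simp [mk, Dat.code]
  have h8 := V.det_toCmd O (mk σ 0 [[], [], []]) 3 (.cons z (.cons b t))
  rw [mk_nest _ _ _ _ _ (by simp), mk_nest _ _ _ _ _ (by simp)] at h8
  refine (h1.seq <| h2.seq <| h3.seq <| h4.seq <| h5.seq <| h6.seq <| h7.seq h8).mono ?_
  omega

theorem verdict_code (t : Dat) : verdict t.code = true ↔ t ≠ .nil := by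
  cases t <;> simp [verdict, Dat.code]

end Cmd

open Cmd in
/-- A language is in `NE` if membership is witnessed by certificates of the same length as the
output of a program `B` of exponential cost, which are checked by a program of polynomial cost. -/
theorem mem_NE_of_verifier (B V : Fn) {b : ℕ → ℕ} (hb : ExpBound b)
    (hB : ∀ z, B.cost ⊥ z ≤ b z.size) (hmono : Monotone b) (k : ℕ)
    (hV : ∀ v, V.cost ⊥ v ≤ (v.size + 2) ^ k) (L : Language Bool)
    (hL : ∀ x, x ∈ L ↔ ∃ w : List Bool, w.length = (B.eval ⊥ (Dat.ofCode x)).size ∧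
      V.eval ⊥ (.cons (Dat.ofCode x) (.cons (B.eval ⊥ (Dat.ofCode x)) (Dat.ofCode w))) ≠ .nil) :
    L ∈ NE := by
  set B' := B.strip
  set V' := V.strip
  have hBe : B'.eval ⊥ = B.eval ⊥ := B.eval_strip
  have hVe : V'.eval ⊥ = V.eval ⊥ := V.eval_strip
  set c := verifier B' V' with hc
  obtain ⟨N, hN⟩ := exists_below c
  have hN' : c.Below (N + 4) := hN.mono (by omega)
  set M := c.toMachine (N + 4) 0 0 3 with hM
  -- Preparation, guessing (`4 * s + 2` steps for a tree of size `s`), conclusion, and one step for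
  -- the verdict. The argument of `V` consists of trees of sizes at most `n`, `b n`, `b n` and two
  -- pair nodes, whence the base `n + 2 * b n + 4`.
  let T : ℕ → ℕ := fun n => 40 * (n + b n + 1) + b n + (4 * b n + 2) +
    (40 * (n + 2 * b n + 1) + (n + 2 * b n + 4) ^ k) + 1
  have hT : ExpBound T := by
    have hid := ExpBound.id
    exact ((((((ExpBound.const 40).mul ((hid.add hb).add (.const 1))).add hb).add
      (((ExpBound.const 4).mul hb).add (.const 2))).add
      (((ExpBound.const 40).mul ((hid.add ((ExpBound.const 2).mul hb)).add (.const 1))).add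
      (((hid.add ((ExpBound.const 2).mul hb)).add (.const 4)).pow k))).add (.const 1))
  have hcosts : ∀ x : List Bool, B'.cost ⊥ (Dat.ofCode x) ≤ b x.length := fun x =>
    (B.cost_strip_le _).trans ((hB _).trans (hmono (Dat.size_ofCode_le x)))
  have hprep : ∀ x : List Bool, ∃ tA, tA ≤ 40 * (x.length + b x.length + 1) + b x.length ∧
      ∀ g : List Bool, g.length = tA → Exec ⊥ (prepare B') (mk (fun _ => []) 0 [x]) g
        (mk (fun _ => []) 0 [(Dat.ofCode x).code, (B.eval ⊥ (Dat.ofCode x)).code,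
          (B.eval ⊥ (Dat.ofCode x)).code]) := by
    intro x
    have h1 := hcosts x
    have h2 := B'.size_eval_le_cost ⊥ (Dat.ofCode x)
    obtain ⟨t, ht, h⟩ := det_prepare (O := ⊥) B' (fun _ => []) x _ _ rfl rfl
    rw [hBe] at h ht h2
    exact ⟨t, by omega, h⟩
  have hconc : ∀ (x w : List Bool), w.length = (B.eval ⊥ (Dat.ofCode x)).size → ∃ tC,
      tC ≤ 40 * (x.length + 2 * b x.length + 1) + (x.length + 2 * b x.length + 4) ^ k ∧
      ∀ g : List Bool, g.length = tC → Exec ⊥ (conclude V')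
        (mk (fun _ => []) 0 [(Dat.ofCode x).code, (B.eval ⊥ (Dat.ofCode x)).code, [], w]) g
        (mk (fun _ => []) 0 [[], [], [], (V.eval ⊥ (.cons (Dat.ofCode x)
          (.cons (B.eval ⊥ (Dat.ofCode x)) (Dat.ofCode w)))).code]) := by
    intro x w hw
    have h1 := hcosts x
    have h2 := B'.size_eval_le_cost ⊥ (Dat.ofCode x)
    rw [hBe] at h2
    have h3 := Dat.size_ofCode_le x
    have h4 := Dat.size_ofCode_le w
    obtain ⟨t, ht, h⟩ := det_conclude (O := ⊥) V' (fun _ => []) (Dat.ofCode x)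
      (B.eval ⊥ (Dat.ofCode x)) w
    rw [hVe] at h
    refine ⟨t, ht.trans (Nat.add_le_add (by omega) ?_), h⟩
    refine (V.cost_strip_le _).trans ((hV _).trans (Nat.pow_le_pow_left ?_ k))
    simp only [Dat.size]
    omega
  have hguess : ∀ (x w : List Bool),
      Function.update (Function.update (mk (fun _ => []) 0 [(Dat.ofCode x).code,
        (B.eval ⊥ (Dat.ofCode x)).code, (B.eval ⊥ (Dat.ofCode x)).code]) 2 []) 3 (w.reverse ++
          mk (fun _ => []) 0 [(Dat.ofCode x).code,
        (B.eval ⊥ (Dat.ofCode x)).code, (B.eval ⊥ (Dat.ofCode x)).code] 3) =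
      mk (fun _ => []) 0 [(Dat.ofCode x).code, (B.eval ⊥ (Dat.ofCode x)).code, [], w.reverse] := by
    intro x w
    rw [← mk_append_nil (fun _ => []) 0 [_, _, _]]
    rw [show (3 : ℕ) = 0 + 3 from rfl, show (2 : ℕ) = 0 + 2 from rfl,
        update_mk_add _ _ _ _ _ (by simp), update_mk_add _ _ _ _ _ (by simp)]
    simp [mk]
  -- Every sufficiently long path ends with the verdict on some certificate. This yields the time
  -- bound and also one direction of the acceptance criterion.
  have hall : ∀ x g : List Bool, T x.length ≤ g.length → ∃ w : List Bool,
      w.length = (B.eval ⊥ (Dat.ofCode x)).size ∧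
      (M.run ⊥ g (M.init x)).state = .inr (some (verdict (V.eval ⊥ (.cons (Dat.ofCode x)
          (.cons (B.eval ⊥ (Dat.ofCode x)) (Dat.ofCode w)))).code)) := by
    intro x g hg
    obtain ⟨tA, htA, hA⟩ := hprep x
    have h1 := hcosts x
    have h2 := B'.size_eval_le_cost ⊥ (Dat.ofCode x)
    rw [hBe] at h2
    set l := (B.eval ⊥ (Dat.ofCode x)).code with hl
    have hcount : l.count true = (B.eval ⊥ (Dat.ofCode x)).size := Dat.count_code _
    have hlen : l.length = 2 * (B.eval ⊥ (Dat.ofCode x)).size + 1 := Dat.length_code _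
    have hTx : T x.length = 40 * (x.length + b x.length + 1) + b x.length + (4 * b x.length + 2) +
      (40 * (x.length + 2 * b x.length + 1) + (x.length + 2 * b x.length + 4) ^ k) + 1 := rfl
    rw [hTx] at hg
    obtain ⟨w, hw, hG⟩ := exists_exec_guessLoop (O := ⊥) (i := 2) (j := 3) (by omega) l
      ((g.drop tA).take (l.length + 2 * l.count true + 1))
      (mk (fun _ => []) 0 [(Dat.ofCode x).code, l, l]) (by simp [mk]) (by simp; omega)
    rw [hguess] at hG
    obtain ⟨tC, htC, hC⟩ := hconc x w.reverse (by simp [hw, hcount])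
    have hex := Exec.seq (hA (g.take tA) (by simp; omega)) (Exec.seq hG
      (hC (((g.drop tA).drop (l.length + 2 * l.count true + 1)).take tC) (by simp; omega)))
    have hrun := hex.run_toMachine (o := 0) (r := 3) hN' (by omega)
      (g' := ((g.drop tA).drop (l.length + 2 * l.count true + 1)).drop tC) (by
        rw [← List.length_pos_iff]
        simp
        omega)
    simp only [List.append_assoc, List.take_append_drop] at hrun
    refine ⟨w.reverse, by simp [hw, hcount], ?_⟩
    refine (congrArg Machine.Cfg.state hrun).trans ?_
    simp [cfg, mk]
    rfl
  obtain ⟨C, hC⟩ := hT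
  refine ⟨M, toMachine_queryFree ?_ _ _ _ _, C, fun x => ⟨fun g hg => ?_, ?_⟩⟩
  · simp [hc, verifier, prepare, conclude, QueryFree, guessLoop, parse, parseLoop, clr, mv, dup, mv₂,
      B', V', Fn.queryFree_toCmd_strip]
  · obtain ⟨w, -, h⟩ := hall x g ((hC _).trans hg.ge)
    exact ⟨_, congrArg M.prog h⟩
  · rw [hL]
    constructor
    · rintro ⟨w, hw, hv⟩
      obtain ⟨tA, htA, hA⟩ := hprep x
      obtain ⟨tC, htC, hC⟩ := hconc x w hw
      -- Pushing reverses the order of the guesses, so `w` is guessed backwards.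
      obtain ⟨g, hg, hG⟩ := exec_guessLoop (O := ⊥) (i := 2) (j := 3) (by omega)
        (B.eval ⊥ (Dat.ofCode x)).code w.reverse (by simp [hw, Dat.count_code])
        (mk (fun _ => []) 0 [(Dat.ofCode x).code, (B.eval ⊥ (Dat.ofCode x)).code,
          (B.eval ⊥ (Dat.ofCode x)).code]) (by simp [mk])
      rw [hguess, List.reverse_reverse] at hG
      have hex := Exec.seq (hA (List.replicate tA true) (by simp)) (Exec.seq hG
        (hC (List.replicate tC true) (by simp)))
      have hrun := hex.run_toMachine (o := 0) (r := 3) hN' (by omega) (g' := [true]) (by simp)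
      refine ⟨_, (congrArg (fun q => M.prog (Machine.Cfg.state q)) hrun).trans ?_⟩
      have : verdict (V.eval ⊥ (.cons (Dat.ofCode x)
          (.cons (B.eval ⊥ (Dat.ofCode x)) (Dat.ofCode w)))).code = true := (verdict_code _).mpr hv
      simp [cfg, mk, this, M, toMachine]
    · rintro ⟨g, hg⟩
      -- The accepting path may be short; padding makes `hall` applicable without changing the
      -- halted configuration.
      obtain ⟨w, hw, h⟩ := hall x (g ++ List.replicate (T x.length) true) (by simp)
      rw [Machine.run_append, hg.halted.run_eq] at h
      refine ⟨w, hw, (verdict_code _).mp ?_⟩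
      have h1 : M.prog (M.run ⊥ g (M.init x)).state = .halt true := hg
      rw [h] at h1
      simpa [M, toMachine] using h1

/-! ### Input and output of functions in `FPWith` -/

namespace Cmd

/-- Write the unary code of the length of register `0` to register `1`. -/
def unary : Cmd :=
  seq (push 1 false)
    (loop 0 (seq (push 1 false) (push 1 true)) (seq (push 1 false) (push 1 true)))

/-- Write the bit list coded in register `1` to register `0`, in reverse order. -/
def output : Cmd :=
  loop 1 skip (pop 1 skip (push 0 false) (pop 1 skip (pop 1 skip (push 0 true) skip) skip))

variable {O : Language Bool}

theorem det_unary (σ : Store) (x : List Bool) :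
    Det O unary (mk σ 0 [x]) (3 * x.length + 2) (mk σ 0 [[], (enc x.length).code]) := by
  have key : ∀ (x : List Bool) (n : ℕ),
      Det O (loop 0 (seq (push 1 false) (push 1 true)) (seq (push 1 false) (push 1 true)))
      (mk σ 0 [x, (enc n).code]) (3 * x.length + 1) (mk σ 0 [[], (enc (n + x.length)).code]) := by
    intro x
    induction x with
    | nil => exact fun n => Det.loopNil (by simp [mk])
    | cons a x ih =>
      intro n
      have h1 : Det O (bif a then (seq (push 1 false) (push 1 true)) else
          (seq (push 1 false) (push 1 true)))
          (Function.update (mk σ 0 [a :: x, (enc n).code]) 0 x) 2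
          (mk σ 0 [x, (enc (n + 1)).code]) := by
        rw [Bool.cond_self]
        refine ((Det.push _ _ _).seq (Det.push _ _ _)).congr rfl ?_ le_rfl
        rw [update_mk_self, show (1 : ℕ) = 0 + 1 from rfl, update_mk_add _ _ _ _ _ (by simp),
          update_mk_add _ _ _ _ _ (by simp)]
        simp [mk, Dat.code]
      refine (Det.loopCons (l := x) (by simp [mk]) h1 (ih (n + 1))).congr rfl ?_ ?_
      · simp only [List.length_cons]
        congr 5
        omega
      · simp
        omega
  have h0 : Det O (push 1 false) (mk σ 0 [x]) 1 (mk σ 0 [x, (enc 0).code]) := by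
    refine (Det.push _ _ _).congr (mk_append_nil σ 0 [x]).symm ?_ le_rfl
    rw [show (1 : ℕ) = 0 + 1 from rfl]
    simp only [List.cons_append, List.nil_append]
    rw [update_mk_add _ _ _ _ _ (by simp)]
    simp [mk, Dat.code]
  refine (h0.seq (key x 0)).congr rfl ?_ ?_
  · simp
  · omega

/-- A list cell is coded by `true`, then the bit as `false` or as `true, false, false`, then the
tail. The loop pops the leading `true` and its body the code of the bit; the last `false` stands for
the empty list. -/
theorem det_output (σ : Store) (w : List Bool) :
    Det O output (mk σ 0 [[], (enc w).code]) (5 * w.length + 2) (mk σ 0 [w.reverse]) := by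
  have key : ∀ (w l : List Bool),
      Det O output (mk σ 0 [l, (enc w).code]) (5 * w.length + 2) (mk σ 0 [w.reverse ++ l]) := by
    intro w
    induction w with
    | nil =>
      intro l
      refine (Det.loopCons (b := false) (l := []) (by simp [mk, Dat.code]) (Det.skip _)
        (Det.loopNil (by simp))).congr rfl ?_ (by simp)
      rw [show (1 : ℕ) = 0 + 1 from rfl, update_mk_add _ _ _ _ _ (by simp)]
      simpa using mk_append_nil σ 0 [l]
    | cons b w ih =>
      intro l
      have h1 : Det O (pop 1 skip (push 0 false) (pop 1 skip (pop 1 skip (push 0 true) skip) skip))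
          (Function.update (mk σ 0 [l, (enc (b :: w)).code]) 1 ((enc b).code ++ (enc w).code)) 4
          (mk σ 0 [b :: l, (enc w).code]) := by
        rw [show (1 : ℕ) = 0 + 1 from rfl, update_mk_add _ _ _ _ _ (by simp)]
        cases b
        · refine (Det.popFalse (l := (enc w).code) (by simp [mk, Dat.code])
            (Det.push _ _ _)).congr rfl ?_ (by omega)
          rw [update_mk_add _ _ _ _ _ (by simp)]
          simp [update_mk_self, mk]
        · refine (Det.popTrue (l := false :: false :: (enc w).code) (by simp [mk, Dat.code])
            (Det.popFalse (l := false :: (enc w).code) (by simp)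
            (Det.popFalse (l := (enc w).code) (by simp)
            (Det.push _ _ _)))).congr rfl ?_ (by omega)
          rw [update_mk_add _ _ _ _ _ (by simp), update_mk_add _ _ _ _ _ (by simp),
            update_mk_add _ _ _ _ _ (by simp)]
          simp [update_mk_self, mk]
      refine (Det.loopCons (b := true) (l := (enc b).code ++ (enc w).code) ?_ h1
        (ih (b :: l))).congr rfl ?_ ?_
      · simp [mk, Dat.code]
      · simp
      · simp
        omega
  simpa using key w []

end Cmd

open Cmd in
/-- Functions of the length of the input that are computed by a program of polynomial cost. -/
theorem mem_FPWith {O : Language Bool} (F : Fn) (k : ℕ) (w : ℕ → List Bool)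
    (hF : ∀ n : ℕ, F.eval O (enc n) = enc (w n)) (hk : ∀ n : ℕ, F.cost O (enc n) ≤ (n + 2) ^ k) :
    (fun x : List Bool => (w x.length).reverse) ∈ FPWith O := by
  set c := seq unary (seq (F.toCmd 1) output) with hc
  obtain ⟨N, hN⟩ := exists_below c
  have hN' : c.Below (N + 2) := hN.mono (by omega)
  have hlen : ∀ l : List Bool, l.length ≤ sz l := by
    intro l
    induction l with
    | nil => simp
    | cons a l ih => simp; omega
  -- The input takes `3 * n + 2` steps, `F` at most `(n + 2) ^ k`, and the output at most `5 * (n +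
  -- 2) ^ k + 2`, because the length of the output is bounded by the cost of `F`. One more step is
  -- needed for the final pop.
  refine ⟨c.toMachine (N + 2) 0 0 1, toMachine_deterministic ?_ _ _ _ _,
    3 * Polynomial.X + 5 + 6 * (Polynomial.X + 2) ^ k, fun x g hg => ?_⟩
  · simp [hc, unary, output, GuessFree, Fn.guessFree_toCmd]
  · have h1 := F.det_toCmd O (mk (fun _ => []) 0 [[]]) 1 (enc x.length)
    rw [mk_nest _ _ _ _ _ (by simp), mk_nest _ _ _ _ _ (by simp), hF] at h1
    obtain ⟨t, ht, hex⟩ := (det_unary (O := O) (fun _ => []) x).seq (h1.seq (det_output _ _))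
    have h2 := hlen (w x.length)
    have h3 := F.size_eval_le_cost O (enc x.length)
    rw [hF] at h3
    have h4 := hk x.length
    have h5 : t < g.length := by
      rw [hg]
      simp only [Polynomial.eval_add, Polynomial.eval_mul, Polynomial.eval_pow, Polynomial.eval_X,
        Polynomial.eval_ofNat]
      simp only [sz] at h2
      omega
    have hrun := (hex (g.take t) (by simp; omega)).run_toMachine (o := 0) (r := 1) hN' (by omega)
      (g' := g.drop t) (by
        rw [← List.length_pos_iff]
        simp
        omega)
    rw [List.take_append_drop] at hrun
    rw [hrun]
    refine ⟨⟨_, rfl⟩, ?_⟩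
    simp [cfg, mk, toMachine, Function.update]


/-! ### Polynomial bounds -/

/-- `u` is bounded by a polynomial in the size of its argument. -/
def PolyBound {α : Type} [Enc α] (u : α → ℕ) : Prop := ∃ k, ∀ a, u a ≤ (sz a + 2) ^ k

namespace PolyBound

variable {α β : Type} [Enc α] [Enc β] {u v : α → ℕ}

theorem mono (h : PolyBound u) (hv : ∀ a, v a ≤ u a) : PolyBound v := by
  obtain ⟨k, hk⟩ := h
  exact ⟨k, fun a => (hv a).trans (hk a)⟩

theorem const (c : ℕ) : PolyBound fun _ : α => c := by
  refine ⟨c, fun a => c.lt_two_pow_self.le.trans ?_⟩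
  gcongr
  omega

theorem size : PolyBound fun a : α => sz a := ⟨1, fun a => by simp⟩

theorem mul (h : PolyBound u) (h' : PolyBound v) : PolyBound fun a => u a * v a := by
  obtain ⟨k, hk⟩ := h
  obtain ⟨l, hl⟩ := h'
  refine ⟨k + l, fun a => (Nat.mul_le_mul (hk a) (hl a)).trans ?_⟩
  rw [pow_add]

theorem add (h : PolyBound u) (h' : PolyBound v) : PolyBound fun a => u a + v a := by
  obtain ⟨k, hk⟩ := h
  obtain ⟨l, hl⟩ := h'
  refine ⟨k + l + 1, fun a => (Nat.add_le_add (hk a) (hl a)).trans ?_⟩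
  have h1 : (sz a + 2) ^ k ≤ (sz a + 2) ^ (k + l) := Nat.pow_le_pow_right (by omega) (by omega)
  have h2 : (sz a + 2) ^ l ≤ (sz a + 2) ^ (k + l) := Nat.pow_le_pow_right (by omega) (by omega)
  rw [pow_succ, Nat.mul_add]
  omega

theorem pow (h : PolyBound u) (k : ℕ) : PolyBound fun a => u a ^ k := by
  induction k with
  | zero => simpa using const 1
  | succ k ih => simpa [pow_succ] using ih.mul h

theorem comp {u : β → ℕ} (h : PolyBound u) {f : α → β} (hf : PolyBound fun a => sz (f a)) :
    PolyBound fun a => u (f a) := by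
  obtain ⟨k, hk⟩ := h
  exact ((hf.add (const 2)).pow k).mono fun a => hk (f a)

end PolyBound

/-! ### Functions computed in polynomial time -/

/-- `f` is computed by a tree program of polynomial cost. -/
def PT (O : Language Bool) {α β : Type} [Enc α] [Enc β] (f : α → β) : Prop :=
  ∃ t : Fn, (∀ a, t.eval O (enc a) = enc (f a)) ∧ PolyBound fun a : α => t.cost O (enc a)

namespace PT

variable {O : Language Bool} {α β γ δ : Type} [Enc α] [Enc β] [Enc γ] [Enc δ]

/-- Cost dominates output size. This is what makes `PT` closed under composition. -/
theorem polyBound {f : α → β} (h : PT O f) : PolyBound fun a => sz (f a) := by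
  obtain ⟨t, ht, hp⟩ := h
  refine hp.mono fun a => ?_
  rw [sz, ← ht]
  exact t.size_eval_le_cost O _

/-- `PT` sees encodings only. A value may thus be regarded as an element of another type with the
same tree, which makes constructors and destructors free. -/
theorem congr_enc {f : α → β} (h : PT O f) {g : α → γ} (hg : ∀ a, enc (g a) = enc (f a)) :
    PT O g := by
  obtain ⟨t, ht, hp⟩ := h
  exact ⟨t, fun a => by rw [ht, hg], hp⟩

theorem of_eq {f g : α → β} (h : PT O f) (hg : ∀ a, g a = f a) : PT O g :=
  h.congr_enc fun a => by rw [hg]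

protected theorem id : PT O fun a : α => a :=
  ⟨.id, fun _ => rfl, PolyBound.size⟩

theorem comp {g : β → γ} {f : α → β} (hg : PT O g) (hf : PT O f) : PT O fun a => g (f a) := by
  have hs := hf.polyBound
  obtain ⟨t, ht, hp⟩ := hf
  obtain ⟨u, hu, hq⟩ := hg
  refine ⟨.comp u t, fun a => by simp [Fn.eval, ht, hu], ?_⟩
  refine (hp.add (hq.comp hs)).mono fun a => ?_
  simp [Fn.cost, ht]

theorem pair {f : α → β} {g : α → γ} (hf : PT O f) (hg : PT O g) : PT O fun a => (f a, g a) := by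
  have hs := hf.polyBound
  have hs' := hg.polyBound
  obtain ⟨t, ht, hp⟩ := hf
  obtain ⟨u, hu, hq⟩ := hg
  refine ⟨.pair t u, fun a => by simp [Fn.eval, ht, hu], ?_⟩
  refine ((hp.add hq).add ((PolyBound.const 30).mul
    (((PolyBound.size.add hs).add hs').add (.const 1)))).mono fun a => ?_
  simp [Fn.cost, ht, hu, sz]

theorem fst {f : α → β × γ} (hf : PT O f) : PT O fun a => (f a).1 := by
  refine comp (g := fun p : β × γ => p.1) ⟨.hd, fun _ => rfl, ?_⟩ hf
  exact ((PolyBound.const 30).mul (PolyBound.size.add (.const 1))).mono fun a => le_rfl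

theorem snd {f : α → β × γ} (hf : PT O f) : PT O fun a => (f a).2 := by
  refine comp (g := fun p : β × γ => p.2) ⟨.tl, fun _ => rfl, ?_⟩ hf
  exact ((PolyBound.const 30).mul (PolyBound.size.add (.const 1))).mono fun a => le_rfl

theorem hd {f : α → Dat} (hf : PT O f) : PT O fun a => (f a).hd := by
  refine comp (g := fun p : Dat => p.hd) ⟨.hd, fun _ => rfl, ?_⟩ hf
  exact ((PolyBound.const 30).mul (PolyBound.size.add (.const 1))).mono fun a => le_rfl

theorem tl {f : α → Dat} (hf : PT O f) : PT O fun a => (f a).tl := by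
  refine comp (g := fun p : Dat => p.tl) ⟨.tl, fun _ => rfl, ?_⟩ hf
  exact ((PolyBound.const 30).mul (PolyBound.size.add (.const 1))).mono fun a => le_rfl

theorem const_dat (t : Dat) : PT O fun _ : α => t := by
  induction t with
  | nil =>
    refine ⟨.nil, fun _ => rfl, ?_⟩
    exact ((PolyBound.const 4).mul (PolyBound.size.add (.const 1))).mono fun a => le_rfl
  | cons a b iha ihb => exact (pair iha ihb).congr_enc fun _ => rfl

theorem const (b : β) : PT O fun _ : α => b :=
  (const_dat (enc b)).congr_enc fun _ => rfl

theorem encode {f : α → β} (hf : PT O f) : PT O fun a => enc (f a) :=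
  hf.congr_enc fun _ => rfl

open Classical in
theorem query {f : α → β} (hf : PT O f) : PT O fun a => decide ((enc (f a)).code ∈ O) := by
  refine comp (g := fun b : β => decide ((enc b).code ∈ O)) ⟨.query, fun b => ?_, ?_⟩ hf
  · by_cases h : (enc b).code ∈ O <;> simp [Fn.eval, h]
  · exact ((PolyBound.const 30).mul (PolyBound.size.add (.const 1))).mono fun a => le_rfl

/-- Case distinction by whether a tree is empty. -/
theorem branch {e : α → Dat} {f g h : α → β} (he : PT O e) (hf : PT O f) (hg : PT O g)
    (h₀ : ∀ a, e a = .nil → h a = f a) (h₁ : ∀ a, e a ≠ .nil → h a = g a) : PT O h := by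
  have hs := he.polyBound
  obtain ⟨t, ht, hp⟩ := he
  obtain ⟨u, hu, hq⟩ := hf
  obtain ⟨v, hv, hr⟩ := hg
  refine ⟨.comp (.branch u v) (.pair t .id), fun a => ?_, ?_⟩
  · cases hea : e a with
    | nil => simp [Fn.eval, ht, hea, hu, h₀]
    | cons x y => simp [Fn.eval, ht, hea, hv, h₁]
  · refine (((hp.add hq).add hr).add ((PolyBound.const 100).mul
      ((PolyBound.size.add hs).add (.const 1)))).mono fun a => ?_
    cases hea : e a with
    | nil => simp [Fn.cost, Fn.eval, ht, hea, Dat.size, sz]; omega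
    | cons x y => simp [Fn.cost, Fn.eval, ht, hea, Dat.size, sz]; omega

theorem cond {c : α → Bool} {f g : α → β} (hc : PT O c) (hf : PT O f) (hg : PT O g) :
    PT O fun a => bif c a then f a else g a := by
  refine branch (e := fun a => enc (c a)) (hc.congr_enc fun _ => rfl) hg hf ?_ ?_
  · intro a h
    cases hca : c a
    · rfl
    · simp [hca] at h
  · intro a h
    cases hca : c a
    · simp [hca] at h
    · rfl

theorem ite {c : α → Prop} [DecidablePred c] {f g : α → β} (hc : PT O fun a => decide (c a))
    (hf : PT O f) (hg : PT O g) : PT O fun a => if c a then f a else g a :=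
  (cond hc hf hg).of_eq fun a => by by_cases h : c a <;> simp [h]

/-- A nonempty list has the same tree as the pair of its head and its tail, so `(a, l a)` can be
handed to the program for `g` without repacking. -/
theorem listCases {l : α → List β} {f : α → γ} {g : α × β × List β → γ} {h : α → γ}
    (hl : PT O l) (hf : PT O f) (hg : PT O g) (h₀ : ∀ a, l a = [] → h a = f a)
    (h₁ : ∀ a b t, l a = b :: t → h a = g (a, b, t)) : PT O h := by
  have hs := hl.polyBound
  obtain ⟨t, ht, hp⟩ := hl
  obtain ⟨u, hu, hq⟩ := hf
  obtain ⟨v, hv, k, hr⟩ := hg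
  refine ⟨.comp (.branch (.comp u .hd) v) (.pair t (.pair .id t)), fun a => ?_, ?_⟩
  · cases hla : l a with
    | nil => simp [Fn.eval, ht, hla, hu, h₀, Dat.hd]
    | cons b m =>
      have := hv (a, b, m)
      simp only [enc_pair] at this
      simp [Fn.eval, ht, hla, h₁ a b m hla, this]
  · refine (((hp.add hp).add hq).add (((PolyBound.const 300).mul
      ((PolyBound.size.add hs).add (.const 1))).add
        (((PolyBound.size.add hs).add (.const 4)).pow k))).mono fun a => ?_
    cases hla : l a with
    | nil =>
      simp [Fn.cost, Fn.eval, ht, hla, Dat.size, sz, Dat.hd]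
      omega
    | cons b m =>
      have h2 : v.cost O (.cons (enc a) (.cons (enc b) (enc m))) ≤
          (sz a + (sz b + sz m + 1) + 1 + 2) ^ k := by
        simpa using hr (a, b, m)
      have h3 : (sz a + (sz b + sz m + 1) + 1 + 2) ^ k ≤ (sz a + (sz b + sz m + 1) + 4) ^ k :=
        Nat.pow_le_pow_left (by omega) k
      simp [Fn.cost, Fn.eval, ht, hla, Dat.size, sz] at *
      omega

end PT

/-! ### Bounded iteration and folds over lists -/

theorem Fn.iterCost_le (f : Dat → Dat) (c : Dat → ℕ) (C S : ℕ) (n : ℕ) (x : Dat)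
    (hc : ∀ i < n, c (f^[i] x) ≤ C) (hS : (f^[n] x).size ≤ S) : iterCost f c n x ≤ n * C + S := by
  induction n generalizing x with
  | zero => simpa [iterCost] using hS
  | succ n ih =>
    have h1 := ih (f x) (fun i hi => hc (i + 1) (by omega)) hS
    have h2 := hc 0 (by omega)
    simp only [iterCost, Function.iterate_zero, id_eq] at *
    rw [Nat.succ_mul]
    omega

theorem eval_iterate {O : Language Bool} {σ : Type} [Enc σ] {t : Fn} {step : σ → σ}
    (ht : ∀ a, t.eval O (enc a) = enc (step a)) (n : ℕ) (a : σ) :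
    (t.eval O)^[n] (enc a) = enc (step^[n] a) := by
  induction n generalizing a with
  | zero => rfl
  | succ n ih => simp [ht, ih]

/-- The cost of an iteration, in terms of a bound for the size of the intermediate results. -/
theorem Fn.cost_iter_le {O : Language Bool} {σ : Type} [Enc σ] {t : Fn} {step : σ → σ}
    (ht : ∀ a, t.eval O (enc a) = enc (step a)) {k : ℕ} (hk : ∀ a : σ, t.cost O (enc a) ≤ (sz a + 2) ^ k)
    (n : Dat) (a : σ) (B : ℕ) (hB : ∀ i ≤ n.size, sz (step^[i] a) ≤ B) :
    (Fn.iter t).cost O (.cons n (enc a)) ≤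
      30 * (n.size + B + 2) + 30 * (n.size * (B + 2) ^ k + B) := by
  have h1 := Fn.iterCost_le (t.eval O) (t.cost O) ((B + 2) ^ k) B n.size (enc a)
    (fun i hi => by
      rw [eval_iterate ht]
      exact (hk _).trans (Nat.pow_le_pow_left (by have := hB i hi.le; omega) k))
    (by rw [eval_iterate ht]; exact hB _ le_rfl)
  have h2 := hB 0 (Nat.zero_le _)
  simp only [Fn.cost, Dat.size, Function.iterate_zero, id_eq, sz] at *
  omega

namespace PT

variable {O : Language Bool} {α β γ δ : Type} [Enc α] [Enc β] [Enc γ] [Enc δ]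

/-- The bound `B` on the intermediate values is essential: a step of polynomial cost may double its
argument, and iterating such a step leads out of polynomial cost. -/
theorem iterateTree {e : α → Dat} {init : α → γ} {step : γ → γ} (he : PT O e) (hi : PT O init)
    (hs : PT O step) {B : α → ℕ} (hB : PolyBound B)
    (hb : ∀ a, ∀ i ≤ (e a).size, sz (step^[i] (init a)) ≤ B a) :
    PT O fun a => step^[(e a).size] (init a) := by
  have hes := he.polyBound
  have his := hi.polyBound
  obtain ⟨t, ht, hp⟩ := he
  obtain ⟨u, hu, hq⟩ := hi
  obtain ⟨v, hv, k, hr⟩ := hs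
  refine ⟨.comp (.iter v) (.pair t u), fun a => ?_, ?_⟩
  · simp [Fn.eval, ht, hu, eval_iterate hv]
  · refine (((hp.add hq).add ((PolyBound.const 30).mul (((PolyBound.size.add hes).add his).add
      (.const 1)))).add (((PolyBound.const 30).mul ((hes.add hB).add (.const 2))).add
      ((PolyBound.const 30).mul ((hes.mul ((hB.add (.const 2)).pow k)).add hB)))).mono fun a => ?_
    have h1 := Fn.cost_iter_le hv hr (e a) (init a) (B a) (hb a)
    have h2 : (Fn.comp (.iter v) (.pair t u)).cost O (enc a) = t.cost O (enc a) +
        u.cost O (enc a) + 30 * (sz a + sz (e a) + sz (init a) + 1) +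
          (Fn.iter v).cost O (.cons (e a) (enc (init a))) := by
      simp only [Fn.cost, Fn.eval, ht, hu, sz, enc_dat]
    rw [h2]
    exact Nat.add_le_add_left h1 _

theorem iterate {n : α → ℕ} {init : α → γ} {step : α → γ → γ} (hn : PT O n) (hi : PT O init)
    (hs : PT O fun p : α × γ => step p.1 p.2) {B : α → ℕ} (hB : PolyBound B)
    (hb : ∀ a, ∀ i ≤ n a, sz ((step a)^[i] (init a)) ≤ B a) :
    PT O fun a => (step a)^[n a] (init a) := by
  have key : ∀ a i, (fun p : α × γ => (p.1, step p.1 p.2))^[i] (a, init a) =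
      (a, (step a)^[i] (init a)) := by
    intro a i
    induction i with
    | zero => rfl
    | succ i ih => rw [Function.iterate_succ_apply', ih, Function.iterate_succ_apply']
  have hsize : ∀ m : ℕ, (enc m).size = m := sz_nat
  have := (iterateTree (e := fun a => enc (n a)) (init := fun a => (a, init a))
    (step := fun p => (p.1, step p.1 p.2)) (hn.congr_enc fun _ => rfl) (PT.id.pair hi)
    (PT.id.fst.pair hs) ((PolyBound.size.add hB).add (.const 1)) (fun a i h => by
      rw [key, sz_pair]
      rw [hsize] at h
      have := hb a i h
      omega)).snd
  refine this.of_eq fun a => ?_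
  rw [key, hsize]

theorem length_le_sz (l : List β) : l.length ≤ sz l := by
  induction l with
  | nil => simp
  | cons a l ih => simp; omega

/-- The state carries the parameter, the unread part of the list and the accumulator. The iteration
count is the size of the encoded list, which is at least its length; surplus rounds find an empty
list and change nothing. -/
theorem foldl {l : α → List β} {init : α → γ} {step : α → γ → β → γ} (hl : PT O l)
    (hi : PT O init) (hs : PT O fun p : α × γ × β => step p.1 p.2.1 p.2.2) {B : α → ℕ}
    (hB : PolyBound B)
    (hb : ∀ a l', l' <+: l a → sz (l'.foldl (step a) (init a)) ≤ B a) :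
    PT O fun a => (l a).foldl (step a) (init a) := by
  let st : α × List β × γ → α × List β × γ := fun p =>
    match p.2.1 with
    | [] => p
    | b :: t => (p.1, t, step p.1 p.2.2 b)
  have hst : PT O st := by
    refine listCases (l := fun p : α × List β × γ => p.2.1) PT.id.snd.fst PT.id
      (g := fun q : (α × List β × γ) × β × List β => (q.1.1, q.2.2, step q.1.1 q.1.2.2 q.2.1))
      ?_ ?_ ?_
    · refine PT.id.fst.fst.pair (PT.id.snd.snd.pair ?_)
      exact hs.comp (f := fun q : (α × List β × γ) × β × List β => (q.1.1, q.1.2.2, q.2.1))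
        (PT.id.fst.fst.pair (PT.id.fst.snd.snd.pair PT.id.snd.fst))
    · intro p h
      simp only [st, h]
    · intro p b t h
      simp only [st, h]
  have key : ∀ a i, st^[i] (a, l a, init a) =
      (a, (l a).drop i, ((l a).take i).foldl (step a) (init a)) := by
    intro a i
    induction i with
    | zero => simp
    | succ i ih =>
      rw [Function.iterate_succ_apply', ih]
      by_cases h : i < (l a).length
      · rw [List.drop_eq_getElem_cons h, List.take_add_one, List.getElem?_eq_getElem h]
        simp only [st, Option.toList_some, List.foldl_append, List.foldl_cons, List.foldl_nil]
      · simp [st, List.drop_eq_nil_of_le (show (l a).length ≤ i by omega),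
          List.drop_eq_nil_of_le (show (l a).length ≤ i + 1 by omega),
          List.take_of_length_le (show (l a).length ≤ i by omega),
          List.take_of_length_le (show (l a).length ≤ i + 1 by omega)]
  have hdrop : ∀ (m : List β) i, sz (m.drop i) ≤ sz m := by
    intro m
    induction m with
    | nil => simp
    | cons b m ih =>
      intro i
      cases i with
      | zero => simp
      | succ i => simpa using (ih i).trans (by omega)
  have := (iterateTree (e := fun a => enc (l a)) (init := fun a => (a, l a, init a)) (step := st)
    (hl.congr_enc fun _ => rfl) (PT.id.pair (hl.pair hi)) hst
    (((PolyBound.size.add hl.polyBound).add hB).add (.const 2)) (fun a i h => by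
      rw [key, sz_pair, sz_pair]
      have h1 := hb a _ (List.take_prefix i (l a))
      have h2 := hdrop (l a) i
      omega)).snd.snd
  refine this.of_eq fun a => ?_
  rw [key]
  simp only
  rw [List.take_of_length_le (show (l a).length ≤ (enc (l a)).size from length_le_sz _)]

end PT


/-! ### Sizes of encoded lists -/

section

variable {α : Type} [Enc α]

theorem sz_append (l m : List α) : sz (l ++ m) = sz l + sz m := by
  induction l with
  | nil => simp
  | cons a l ih => simp [ih]; omega

theorem sz_reverse (l : List α) : sz l.reverse = sz l := by
  induction l with
  | nil => simp
  | cons a l ih => simp [sz_append, ih]; omega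

theorem sz_le_of_prefix {l m : List α} (h : l <+: m) : sz l ≤ sz m := by
  obtain ⟨t, rfl⟩ := h
  rw [sz_append]
  omega

theorem sz_le_of_suffix {l m : List α} (h : l <:+ m) : sz l ≤ sz m := by
  obtain ⟨t, rfl⟩ := h
  rw [sz_append]
  omega

theorem sz_le_of_mem {l : List α} {a : α} (h : a ∈ l) : sz a < sz l := by
  induction l with
  | nil => simp at h
  | cons b l ih =>
    rcases List.mem_cons.mp h with rfl | h
    · simp
    · have := ih h
      simp
      omega

theorem sz_le_length_mul {l : List α} {c : ℕ} (h : ∀ a ∈ l, sz a ≤ c) :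
    sz l ≤ l.length * (c + 1) := by
  induction l with
  | nil => simp
  | cons a l ih =>
    have h1 := h a (by simp)
    have h2 := ih fun b hb => h b (by simp [hb])
    simp only [sz_cons, List.length_cons]
    rw [Nat.succ_mul]
    omega

theorem sz_bits_le (l : List Bool) : sz l ≤ 2 * l.length := by
  have := sz_le_length_mul (l := l) (c := 1) fun a _ => sz_bool_le a
  omega

end

/-! ### Polynomial-time operations on basic data -/

namespace PT

variable {O : Language Bool} {α β γ δ : Type} [Enc α] [Enc β] [Enc γ] [Enc δ]

theorem natBound {n : α → ℕ} (hn : PT O n) : PolyBound n := by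
  simpa using hn.polyBound

/-! #### Booleans -/

theorem and {f g : α → Bool} (hf : PT O f) (hg : PT O g) : PT O fun a => f a && g a :=
  (cond hf hg (const false)).of_eq fun a => by cases f a <;> rfl

theorem or {f g : α → Bool} (hf : PT O f) (hg : PT O g) : PT O fun a => f a || g a :=
  (cond hf (const true) hg).of_eq fun a => by cases f a <;> rfl

theorem not {f : α → Bool} (hf : PT O f) : PT O fun a => !f a :=
  (cond hf (const false) (const true)).of_eq fun a => by cases f a <;> rfl

theorem xor {f g : α → Bool} (hf : PT O f) (hg : PT O g) : PT O fun a => Bool.xor (f a) (g a) :=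
  (cond hf hg.not hg).of_eq fun a => by cases f a <;> simp

theorem beq {f g : α → Bool} (hf : PT O f) (hg : PT O g) : PT O fun a => f a == g a :=
  (cond hf hg hg.not).of_eq fun a => by cases f a <;> simp

/-! #### Numbers -/

theorem succ {n : α → ℕ} (hn : PT O n) : PT O fun a => n a + 1 :=
  ((const_dat .nil).pair hn).congr_enc fun a => by simp

theorem pred {n : α → ℕ} (hn : PT O n) : PT O fun a => n a - 1 := by
  refine hn.encode.tl.congr_enc fun a => ?_
  cases n a <;> simp [Dat.tl]

theorem natCases {n : α → ℕ} {f : α → γ} {g : α × ℕ → γ} {h : α → γ} (hn : PT O n) (hf : PT O f)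
    (hg : PT O g) (h₀ : ∀ a, n a = 0 → h a = f a) (h₁ : ∀ a m, n a = m + 1 → h a = g (a, m)) :
    PT O h := by
  refine branch hn.encode hf (hg.comp (PT.id.pair hn.pred)) ?_ ?_
  · intro a ha
    refine h₀ a ?_
    cases hna : n a with
    | zero => rfl
    | succ m => simp [hna] at ha
  · intro a ha
    cases hna : n a with
    | zero => simp [hna] at ha
    | succ m => simpa using h₁ a m hna

theorem isZero {n : α → ℕ} (hn : PT O n) : PT O fun a => decide (n a = 0) :=
  natCases hn (const true) (const false) (fun a h => by simp [h]) (fun a m h => by simp [h])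

theorem add {m n : α → ℕ} (hm : PT O m) (hn : PT O n) : PT O fun a => m a + n a := by
  have h : ∀ i k : ℕ, (fun x => x + 1)^[i] k = k + i := fun i k => by
    simp
  refine (iterate (step := fun _ x => x + 1) hn hm PT.id.snd.succ (hm.natBound.add hn.natBound)
    ?_).of_eq ?_
  · intro a i hi
    rw [h]
    simpa using hi
  · intro a
    rw [h]

theorem sub {m n : α → ℕ} (hm : PT O m) (hn : PT O n) : PT O fun a => m a - n a := by
  have h : ∀ i k : ℕ, (fun x => x - 1)^[i] k = k - i := fun i k => Nat.pred_iterate k i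
  refine (iterate (step := fun _ x => x - 1) hn hm PT.id.snd.pred hm.natBound ?_).of_eq ?_
  · intro a i hi
    rw [h]
    simp
  · intro a
    rw [h]

theorem mul {m n : α → ℕ} (hm : PT O m) (hn : PT O n) : PT O fun a => m a * n a := by
  have h : ∀ c i : ℕ, (fun x => x + c)^[i] 0 = c * i := fun c i => by
    induction i with
    | zero => rfl
    | succ i ih => rw [Function.iterate_succ_apply', ih, Nat.mul_succ]
  refine (iterate (step := fun a x => x + m a) hn (const 0) (PT.id.snd.add (hm.comp PT.id.fst))
    (hm.natBound.mul hn.natBound) ?_).of_eq ?_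
  · intro a i hi
    rw [h, sz_nat]
    gcongr
  · intro a
    rw [h]

theorem pow {n : α → ℕ} (hn : PT O n) (k : ℕ) : PT O fun a => n a ^ k := by
  induction k with
  | zero => simpa using const 1
  | succ k ih => simpa [pow_succ] using ih.mul hn

theorem le {m n : α → ℕ} (hm : PT O m) (hn : PT O n) : PT O fun a => decide (m a ≤ n a) :=
  (hm.sub hn).isZero.of_eq fun a => by simp [Nat.sub_eq_zero_iff_le]

theorem lt {m n : α → ℕ} (hm : PT O m) (hn : PT O n) : PT O fun a => decide (m a < n a) :=
  le hm.succ hn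

theorem max {m n : α → ℕ} (hm : PT O m) (hn : PT O n) : PT O fun a => Max.max (m a) (n a) :=
  (hm.add (hn.sub hm)).of_eq fun a => by omega

theorem size {e : α → Dat} (he : PT O e) : PT O fun a => (e a).size := by
  have h : ∀ i k : ℕ, (fun x => x + 1)^[i] k = k + i := fun i k => by
    simp
  refine (iterateTree (init := fun _ => 0) (step := fun x : ℕ => x + 1) he (const 0) PT.id.succ
    he.polyBound ?_).of_eq ?_
  · intro a i hi
    rw [h]
    simpa using hi
  · intro a
    rw [h, Nat.zero_add]

/-! #### Lists -/

theorem cons {f : α → β} {l : α → List β} (hf : PT O f) (hl : PT O l) : PT O fun a => f a :: l a :=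
  (hf.pair hl).congr_enc fun _ => rfl

theorem tail {l : α → List β} (hl : PT O l) : PT O fun a => (l a).tail :=
  hl.encode.tl.congr_enc fun a => by cases l a <;> rfl

theorem headD {l : α → List β} {d : α → β} (hl : PT O l) (hd : PT O d) :
    PT O fun a => (l a).headD (d a) :=
  listCases hl hd PT.id.snd.fst (fun a h => by simp [h]) (fun a b t h => by simp [h])

theorem isEmpty {l : α → List β} (hl : PT O l) : PT O fun a => (l a).isEmpty :=
  listCases hl (const true) (const false) (fun a h => by simp [h]) (fun a b t h => by simp [h])

theorem reverse {l : α → List β} (hl : PT O l) : PT O fun a => (l a).reverse := by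
  have h : ∀ l m : List β, l.foldl (fun acc b => b :: acc) m = l.reverse ++ m := fun l => by
    induction l with
    | nil => simp
    | cons b l ih => intro m; simp [ih]
  refine (foldl (step := fun _ acc b => b :: acc) hl (const []) (PT.id.snd.snd.cons PT.id.snd.fst)
    hl.polyBound ?_).of_eq ?_
  · intro a l' hl'
    rw [h, List.append_nil, sz_reverse]
    exact sz_le_of_prefix hl'
  · intro a
    rw [h, List.append_nil]

theorem append {l m : α → List β} (hl : PT O l) (hm : PT O m) : PT O fun a => l a ++ m a := by
  have h : ∀ l m : List β, l.foldl (fun acc b => b :: acc) m = l.reverse ++ m := fun l => by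
    induction l with
    | nil => simp
    | cons b l ih => intro m; simp [ih]
  refine (foldl (step := fun _ acc b => b :: acc) hl.reverse hm (PT.id.snd.snd.cons PT.id.snd.fst)
    (hl.polyBound.add hm.polyBound) ?_).of_eq ?_
  · intro a l' hl'
    rw [h, sz_append, sz_reverse, ← sz_reverse (l a)]
    have := sz_le_of_prefix hl'
    omega
  · intro a
    rw [h, List.reverse_reverse]

theorem foldr {l : α → List β} {init : α → γ} {step : α → β → γ → γ} (hl : PT O l)
    (hi : PT O init) (hs : PT O fun p : α × β × γ => step p.1 p.2.1 p.2.2) {B : α → ℕ}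
    (hB : PolyBound B)
    (hb : ∀ a l', l' <:+ l a → sz (l'.foldr (step a) (init a)) ≤ B a) :
    PT O fun a => (l a).foldr (step a) (init a) := by
  refine (foldl (step := fun a c b => step a b c) hl.reverse hi
    (hs.comp (f := fun p : α × γ × β => (p.1, p.2.2, p.2.1))
      (PT.id.fst.pair (PT.id.snd.snd.pair PT.id.snd.fst))) hB ?_).of_eq ?_
  · intro a l' hl'
    have := hb a l'.reverse (by simpa using List.reverse_suffix.mpr hl')
    simpa using this
  · intro a
    simp

theorem flatMap {l : α → List β} {f : α → β → List γ} (hl : PT O l)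
    (hf : PT O fun p : α × β => f p.1 p.2) : PT O fun a => (l a).flatMap (f a) := by
  obtain ⟨k, hk⟩ := hf.polyBound
  refine (foldr (step := fun a b acc => f a b ++ acc) hl (const [])
    ((hf.comp (f := fun p : α × β × List γ => (p.1, p.2.1)) (PT.id.fst.pair PT.id.snd.fst)).append
      PT.id.snd.snd) (hl.polyBound.mul (((PolyBound.size.add hl.polyBound).add
        (.const 3)).pow k)) ?_).of_eq ?_
  · intro a l' hl'
    refine le_trans ?_ (Nat.mul_le_mul_right _
      ((length_le_sz l').trans (sz_le_of_suffix hl')))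
    have hmem : ∀ b ∈ l', sz b ≤ sz (l a) := fun b hb => (sz_le_of_mem (hl'.subset hb)).le
    clear hl'
    induction l' with
    | nil => simp
    | cons b l' ih =>
      have h1 := ih fun c hc => hmem c (by simp [hc])
      have h2 := (hk (a, b)).trans (Nat.pow_le_pow_left
        (show sz (a, b) + 2 ≤ sz a + sz (l a) + 3 by
          have := hmem b (by simp); simp; omega) k)
      simp only [List.foldr_cons, sz_append, List.length_cons] at *
      rw [Nat.succ_mul]
      omega
  · intro a
    induction l a with
    | nil => rfl
    | cons b l ih => simp [ih]

theorem map {l : α → List β} {f : α → β → γ} (hl : PT O l)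
    (hf : PT O fun p : α × β => f p.1 p.2) : PT O fun a => (l a).map (f a) :=
  (flatMap (f := fun a b => [f a b]) hl (hf.cons (const []))).of_eq fun a => by
    rw [List.map_eq_flatMap]

theorem all {l : α → List β} {f : α → β → Bool} (hl : PT O l)
    (hf : PT O fun p : α × β => f p.1 p.2) : PT O fun a => (l a).all (f a) := by
  refine (foldr (step := fun a b acc => f a b && acc) hl (const true)
    ((hf.comp (f := fun p : α × β × Bool => (p.1, p.2.1)) (PT.id.fst.pair PT.id.snd.fst)).and
      PT.id.snd.snd) (.const 1) fun a l' _ => sz_bool_le _).of_eq fun a => ?_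
  induction l a with
  | nil => rfl
  | cons b l ih => simp [ih]

theorem any {l : α → List β} {f : α → β → Bool} (hl : PT O l)
    (hf : PT O fun p : α × β => f p.1 p.2) : PT O fun a => (l a).any (f a) := by
  refine (foldr (step := fun a b acc => f a b || acc) hl (const false)
    ((hf.comp (f := fun p : α × β × Bool => (p.1, p.2.1)) (PT.id.fst.pair PT.id.snd.fst)).or
      PT.id.snd.snd) (.const 1) fun a l' _ => sz_bool_le _).of_eq fun a => ?_
  induction l a with
  | nil => rfl
  | cons b l ih => simp [ih]

theorem countP {l : α → List β} {f : α → β → Bool} (hl : PT O l)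
    (hf : PT O fun p : α × β => f p.1 p.2) : PT O fun a => (l a).countP (f a) := by
  have h : ∀ a (l : List β), l.foldr (fun b n => bif f a b then n + 1 else n) 0 =
      l.countP (f a) := by
    intro a l
    induction l with
    | nil => rfl
    | cons b l ih =>
      rw [List.countP_cons, List.foldr_cons, ih]
      cases f a b <;> simp
  refine (foldr (step := fun a b n => bif f a b then n + 1 else n) hl (const 0)
    (cond (hf.comp (f := fun p : α × β × ℕ => (p.1, p.2.1)) (PT.id.fst.pair PT.id.snd.fst))
      PT.id.snd.snd.succ PT.id.snd.snd) hl.polyBound ?_).of_eq fun a => (h a _).symm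
  intro a l' hl'
  rw [h, sz_nat]
  exact List.countP_le_length.trans ((length_le_sz _).trans (sz_le_of_suffix hl'))

theorem length {l : α → List β} (hl : PT O l) : PT O fun a => (l a).length :=
  (countP (f := fun _ _ => true) hl (const true)).of_eq fun a => by simp

theorem drop {l : α → List β} {n : α → ℕ} (hl : PT O l) (hn : PT O n) :
    PT O fun a => (l a).drop (n a) := by
  have h : ∀ (l : List β) i, List.tail^[i] l = l.drop i := by
    intro l i
    induction i generalizing l with
    | zero => rfl
    | succ i ih => cases l <;> simp [ih]
  refine (iterate (step := fun _ x => List.tail x) hn hl PT.id.snd.tail hl.polyBound ?_).of_eq ?_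
  · intro a i hi
    rw [h]
    exact sz_le_of_suffix (List.drop_suffix _ _)
  · intro a
    rw [h]

theorem getD {l : α → List β} {n : α → ℕ} {d : α → β} (hl : PT O l) (hn : PT O n) (hd : PT O d) :
    PT O fun a => (l a).getD (n a) (d a) :=
  ((hl.drop hn).headD hd).of_eq fun a => by
    rw [List.headD_eq_head?_getD, List.head?_drop, List.getD_eq_getElem?_getD]

theorem getLastD {l : α → List β} {d : α → β} (hl : PT O l) (hd : PT O d) :
    PT O fun a => (l a).getLastD (d a) :=
  (hl.reverse.headD hd).of_eq fun a => by
    rw [List.headD_eq_head?_getD, List.head?_reverse, List.getLastD_eq_getLast?]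

theorem replicate {f : α → β} {n : α → ℕ} (hf : PT O f) (hn : PT O n) :
    PT O fun a => List.replicate (n a) (f a) := by
  have h : ∀ (b : β) i, (List.cons b)^[i] [] = List.replicate i b := by
    intro b i
    induction i with
    | zero => rfl
    | succ i ih => rw [Function.iterate_succ_apply', ih, List.replicate_succ]
  refine (iterate (step := fun a x => f a :: x) hn (const []) ((hf.comp PT.id.fst).cons PT.id.snd)
    (hn.natBound.mul (hf.polyBound.add (.const 1))) ?_).of_eq fun a => (h _ _).symm
  intro a i hi
  rw [h]
  refine (sz_le_length_mul (c := sz (f a)) fun b hb => ?_).trans ?_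
  · rw [(List.mem_replicate.mp hb).2]
  · rw [List.length_replicate]
    gcongr

/-- The step removes a head that satisfies `f` and is stationary otherwise, so iterating it as often
as the list is long is enough. -/
theorem dropWhile {l : α → List β} {f : β → Bool} (hl : PT O l) (hf : PT O f) :
    PT O fun a => (l a).dropWhile f := by
  let st : List β → List β := fun x =>
    match x with
    | [] => []
    | b :: t => bif f b then t else x
  have hst : PT O st := by
    refine listCases (l := fun x : List β => x) PT.id (const [])
      (g := fun q : List β × β × List β => bif f q.2.1 then q.2.2 else q.1)
      (cond (hf.comp PT.id.snd.fst) PT.id.snd.snd PT.id.fst) ?_ ?_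
    · rintro _ rfl; rfl
    · rintro _ b t rfl; rfl
  have h0 : ∀ (i : ℕ) (x : List β), st^[i] x <:+ x := by
    intro i
    induction i with
    | zero => exact fun x => List.suffix_rfl
    | succ i ih =>
      intro x
      refine (ih (st x)).trans ?_
      cases x with
      | nil => exact List.suffix_rfl
      | cons b t =>
        simp only [st]
        cases f b
        · exact List.suffix_rfl
        · exact List.suffix_cons b t
  have h1 : ∀ (i : ℕ) (x : List β), x.length ≤ i → st^[i] x = x.dropWhile f := by
    intro i
    induction i with
    | zero =>
      intro x hx
      rw [List.length_eq_zero_iff.mp (Nat.le_zero.mp hx)]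
      rfl
    | succ i ih =>
      intro x hx
      rw [Function.iterate_succ_apply]
      cases x with
      | nil => rw [ih _ (by simp [st])]
      | cons b t =>
        cases hb : f b
        · have hfix : st (b :: t) = b :: t := by simp [st, hb]
          rw [hfix, Function.iterate_fixed hfix]
          simp [hb]
        · have : st (b :: t) = t := by simp [st, hb]
          rw [this, ih _ (by simpa using hx)]
          simp [hb]
  refine (iterate (step := fun _ x => st x) hl.length hl (hst.comp PT.id.snd) hl.polyBound
    ?_).of_eq fun a => (h1 _ _ le_rfl).symm
  exact fun a i _ => sz_le_of_suffix (h0 i _)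

/-- One pass over the candidate prefix, with a flag for agreement so far and the part of the other
string that is not yet compared. -/
theorem isPrefixOf {l m : α → List Bool} (hl : PT O l) (hm : PT O m) :
    PT O fun a => (l a).isPrefixOf (m a) := by
  let st : Bool × List Bool → Bool → Bool × List Bool := fun p b =>
    (p.1 && (!p.2.isEmpty && (p.2.headD false == b)), p.2.tail)
  have hst : PT O fun p : α × (Bool × List Bool) × Bool => st p.2.1 p.2.2 :=
    (PT.id.snd.fst.fst.and (PT.id.snd.fst.snd.isEmpty.not.and
      ((PT.id.snd.fst.snd.headD (const false)).beq PT.id.snd.snd))).pair PT.id.snd.fst.snd.tail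
  have h1 : ∀ (l : List Bool) (p : Bool × List Bool), (l.foldl st p).2 <:+ p.2 := by
    intro l
    induction l with
    | nil => exact fun p => List.suffix_rfl
    | cons b l ih => exact fun p => (ih _).trans (List.tail_suffix _)
  have h2 : ∀ (l : List Bool) (p : Bool × List Bool),
      (l.foldl st p).1 = (p.1 && l.isPrefixOf p.2) := by
    intro l
    induction l with
    | nil => simp
    | cons b l ih =>
      rintro ⟨ok, m⟩
      rw [List.foldl_cons, ih]
      cases m with
      | nil => simp [st]
      | cons c m => cases b <;> cases c <;> simp [st, List.isPrefixOf]
  refine (foldl (step := fun _ p b => st p b) hl ((const true).pair hm) hst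
    (hm.polyBound.add (.const 2)) ?_).fst.of_eq fun a => ?_
  · intro a l' _
    have h3 := sz_le_of_suffix (h1 l' (true, m a))
    have h4 := sz_bool_le (l'.foldl st (true, m a)).1
    change sz (l'.foldl st (true, m a)) ≤ _
    rw [sz_prod]
    simp only at h3
    omega
  · rw [h2]
    simp

theorem mod {n : α → ℕ} (hn : PT O n) (m : ℕ) (hm : 0 < m) : PT O fun a => n a % m := by
  have h : ∀ i, (fun x => if x + 1 < m then x + 1 else 0)^[i] 0 = i % m := by
    intro i
    induction i with
    | zero => simp
    | succ i ih =>
      rw [Function.iterate_succ_apply', ih]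
      have := Nat.mod_lt i hm
      split_ifs with h
      · rw [Nat.add_mod, Nat.mod_eq_of_lt (show 1 < m by omega), Nat.mod_eq_of_lt h]
      · have h1 : i % m + 1 = m := by omega
        rw [← Nat.mod_add_mod, h1, Nat.mod_self]
  refine (iterate (step := fun _ x => if x + 1 < m then x + 1 else 0) hn (const 0)
    (ite (PT.id.snd.succ.lt (const m)) PT.id.snd.succ (const 0)) (.const m) ?_).of_eq fun a =>
      (h _).symm
  intro a i _
  rw [h, sz_nat]
  exact (Nat.mod_lt i hm).le

end PT

/-! ### Reading data from arbitrary trees -/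

namespace Dat

/-- The list of the left subtrees along the right spine. -/
def toList : Dat → List Dat
  | nil => []
  | cons a b => a :: toList b

/-- `false` for the empty tree only. -/
def toBool : Dat → Bool
  | nil => false
  | cons _ _ => true

/-- The bits along the right spine. -/
def toBits (t : Dat) : List Bool := t.toList.map toBool

theorem enc_toList (t : Dat) : enc t.toList = t := by
  induction t with
  | nil => rfl
  | cons a b _ ih => simp [toList, ih]

theorem toList_enc {α : Type} [Enc α] (l : List α) : (enc l).toList = l.map enc := by
  induction l with
  | nil => rfl
  | cons a l ih => simp [toList, ih]

theorem toBits_enc (l : List Bool) : (enc l).toBits = l := by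
  rw [toBits, toList_enc, List.map_map]
  conv_rhs => rw [← List.map_id l]
  refine List.map_congr_left fun b _ => ?_
  cases b <;> rfl

theorem size_enc (n : ℕ) : (enc n).size = n := sz_nat n

end Dat

namespace PT

variable {O : Language Bool} {α : Type} [Enc α]

theorem toList {e : α → Dat} (he : PT O e) : PT O fun a => (e a).toList :=
  he.congr_enc fun a => (e a).enc_toList

theorem toBool {e : α → Dat} (he : PT O e) : PT O fun a => (e a).toBool :=
  branch he (const false) (const true) (fun a h => by simp [h, Dat.toBool]) (fun a h => by
    cases hea : e a with
    | nil => exact absurd hea h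
    | cons x y => rfl)

theorem toBits {e : α → Dat} (he : PT O e) : PT O fun a => (e a).toBits :=
  map (f := fun _ b => Dat.toBool b) he.toList PT.id.snd.toBool

end PT


/-! ### Simulation of machines -/

namespace PT

variable {O : Language Bool}

/-- Peels off one successor at a time; the truncation at `N` makes the number of cases finite. -/
theorem natMinCases (N : ℕ) : ∀ {α β : Type} [Enc α] [Enc β] {n : α → ℕ} {h : ℕ → α → β},
    PT O n → (∀ i, PT O (h i)) → PT O fun a => h (min (n a) N) a := by
  induction N with
  | zero => exact fun _ hh => (hh 0).of_eq fun a => by simp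
  | succ N ih =>
    intro α β _ _ n h hn hh
    refine natCases hn (hh 0) (g := fun p : α × ℕ => h (min p.2 N + 1) p.1)
      (ih (h := fun i (p : α × ℕ) => h (i + 1) p.1) PT.id.snd fun i => (hh (i + 1)).comp PT.id.fst)
      ?_ ?_
    · intro a ha
      simp [ha]
    · intro a m ha
      simp [ha, Nat.succ_min_succ]

/-- The program contains a subprogram for each of the finitely many `s`. In this way the transition
table of a fixed machine is built into a program. -/
theorem finCases {α β σ : Type} [Enc α] [Enc β] [Fintype σ] {q : α → σ} {h : σ → α → β}
    (hq : PT O fun a => (Fintype.equivFin σ (q a) : ℕ)) (hh : ∀ s, PT O (h s)) :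
    PT O fun a => h (q a) a := by
  -- An element of `α` is needed only to have a value for numbers that do not belong to any `s`.
  rcases isEmpty_or_nonempty α with hα | ⟨⟨a₀⟩⟩
  · exact ⟨.id, fun a => hα.elim a, 0, fun a => hα.elim a⟩
  · let h' : ℕ → α → β := fun i a =>
      if hi : i < Fintype.card σ then h ((Fintype.equivFin σ).symm ⟨i, hi⟩) a else h (q a₀) a
    refine (natMinCases (Fintype.card σ) (h := h') hq fun i => ?_).of_eq fun a => ?_
    · simp only [h']
      split_ifs with hi
      · exact hh _
      · exact hh _
    · simp [h']

theorem ofFn {α β : Type} [Enc α] [Enc β] {r : ℕ} {F : Fin r → α → β} (hF : ∀ i, PT O (F i)) :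
    PT O fun a => List.ofFn fun i => F i a := by
  induction r with
  | zero => simpa using const []
  | succ r ih =>
    simp only [List.ofFn_succ]
    exact (hF 0).cons (ih fun i => hF i.succ)

end PT

namespace Machine

variable (M : Machine)

/-- The contents of all stacks, as a list. -/
noncomputable def stackList (c : M.Cfg) : List (List Bool) :=
  List.ofFn fun i => c.stk ((Fintype.equivFin M.Stack).symm i)

noncomputable instance : Enc M.Cfg :=
  ⟨fun c => enc ((Fintype.equivFin M.State c.state : ℕ), M.stackList c)⟩

variable {M} {O : Language Bool} {α β : Type} [Enc α] [Enc β]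

theorem pt_state {c : α → M.Cfg} (hc : PT O c) :
    PT O fun a => (Fintype.equivFin M.State (c a).state : ℕ) :=
  (hc.congr_enc (g := fun a => ((Fintype.equivFin M.State (c a).state : ℕ), M.stackList (c a)))
    fun _ => rfl).fst

theorem pt_stk {c : α → M.Cfg} (hc : PT O c) (k : M.Stack) : PT O fun a => (c a).stk k := by
  have h := (hc.congr_enc
    (g := fun a => ((Fintype.equivFin M.State (c a).state : ℕ), M.stackList (c a))) fun _ => rfl).snd
  refine (h.getD (PT.const (Fintype.equivFin M.Stack k : ℕ)) (PT.const [])).of_eq fun a => ?_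
  simp [stackList, List.getD_eq_getElem?_getD]

theorem pt_mk (q : M.State) {F : α → M.Stack → List Bool} (hF : ∀ k, PT O fun a => F a k) :
    PT O fun a => (⟨q, F a⟩ : M.Cfg) := by
  refine ((PT.const (Fintype.equivFin M.State q : ℕ)).pair (PT.ofFn
    (F := fun i a => F a ((Fintype.equivFin M.Stack).symm i)) fun i => hF _)).congr_enc fun a => ?_
  rfl

theorem pt_mk_update (q : M.State) {c : α → M.Cfg} (hc : PT O c) (k : M.Stack) {l : α → List Bool}
    (hl : PT O l) : PT O fun a => (⟨q, Function.update (c a).stk k (l a)⟩ : M.Cfg) := by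
  refine pt_mk q fun k' => ?_
  by_cases h : k' = k
  · subst h
    simpa using hl
  · simpa [Function.update_of_ne h] using pt_stk hc k'

/-- For a fixed state the instruction is fixed and touches at most one stack. The simulating program
may have any oracle `O`, as the simulated machine asks nothing. -/
theorem pt_step (hM : M.QueryFree) : PT O fun p : M.Cfg × Bool => M.step ⊥ p.1 p.2 := by
  unfold step
  refine PT.finCases (β := M.Cfg) (h := fun q (p : M.Cfg × Bool) => match M.prog q with
    | .push k a q => ⟨q, Function.update p.1.stk k (a :: p.1.stk k)⟩
    | .pop k qe q₀ q₁ =>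
      match p.1.stk k with
      | [] => ⟨qe, p.1.stk⟩
      | false :: s => ⟨q₀, Function.update p.1.stk k s⟩
      | true :: s => ⟨q₁, Function.update p.1.stk k s⟩
    | .guess q₀ q₁ => ⟨if p.2 then q₁ else q₀, p.1.stk⟩
    | .query k qyes qno => ⟨open Classical in if p.1.stk k ∈ (⊥ : Language Bool) then qyes else qno,
      p.1.stk⟩
    | .halt _ => p.1) (pt_state PT.id.fst) fun q => ?_
  match hq : M.prog q with
  | .push k a q => exact pt_mk_update q PT.id.fst k ((PT.const a).cons (pt_stk PT.id.fst k))
  | .pop k qe q₀ q₁ =>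
    refine PT.listCases (pt_stk PT.id.fst k) (pt_mk qe fun k => pt_stk PT.id.fst k)
      (g := fun r : (M.Cfg × Bool) × Bool × List Bool =>
        bif r.2.1 then ⟨q₁, Function.update r.1.1.stk k r.2.2⟩
        else ⟨q₀, Function.update r.1.1.stk k r.2.2⟩)
      (PT.cond (f := fun r : (M.Cfg × Bool) × Bool × List Bool =>
          (⟨q₁, Function.update r.1.1.stk k r.2.2⟩ : M.Cfg))
        (g := fun r => ⟨q₀, Function.update r.1.1.stk k r.2.2⟩)
        PT.id.snd.fst (pt_mk_update q₁ PT.id.fst.fst k PT.id.snd.snd)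
        (pt_mk_update q₀ PT.id.fst.fst k PT.id.snd.snd)) ?_ ?_
    · intro p h
      simp [h]
    · intro p b t h
      cases b <;> simp [h]
  | .guess q₀ q₁ =>
    refine (PT.cond PT.id.snd (pt_mk q₁ fun k => pt_stk PT.id.fst k)
      (pt_mk q₀ fun k => pt_stk PT.id.fst k)).of_eq fun p => ?_
    cases p.2 <;> rfl
  | .query k qyes qno => exact absurd hq (hM q k qyes qno)
  | .halt _ => exact PT.id.fst

theorem length_stk_step_le (c : M.Cfg) (b : Bool) (k : M.Stack) :
    ((M.step O c b).stk k).length ≤ (c.stk k).length + 1 := by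
  unfold step
  split
  · rename_i k' a q h
    by_cases hk : k = k'
    · subst hk; simp
    · simp [hk]
  · rename_i k' _ _ _ h
    split
    · simp
    · rename_i s hs
      by_cases hk : k = k'
      · subst hk; simp [hs]; omega
      · simp [hk]
    · rename_i s hs
      by_cases hk : k = k'
      · subst hk; simp [hs]; omega
      · simp [hk]
  all_goals simp

theorem length_stk_run_le (g : List Bool) (c : M.Cfg) (k : M.Stack) :
    ((M.run O g c).stk k).length ≤ (c.stk k).length + g.length := by
  induction g generalizing c with
  | nil => simp [run]
  | cons b g ih =>
    have h1 := ih (M.step O c b)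
    have h2 := length_stk_step_le (O := O) c b k
    simp only [run, List.foldl_cons, List.length_cons] at *
    omega

/-- A step lengthens a stack by at most one bit, so all configurations on the path have size linear
in `x` and `g`. This is the bound that `PT.foldl` requires. -/
theorem pt_run (hM : M.QueryFree) {x g : α → List Bool} (hx : PT O x) (hg : PT O g) :
    PT O fun a => M.run ⊥ (g a) (M.init (x a)) := by
  refine PT.foldl (step := fun _ c b => M.step ⊥ c b) hg
    (init := fun a => M.init (x a)) ?_ ((pt_step hM).comp PT.id.snd)
    (B := fun a => Fintype.card M.State + Fintype.card M.Stack * (2 * (sz (x a) + sz (g a)) + 1) + 1)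
    ?_ ?_
  · refine pt_mk M.start fun k => ?_
    by_cases h : k = M.inp
    · simpa [h] using hx
    · simpa [h] using PT.const []
  · exact ((PolyBound.const _).add ((PolyBound.const _).mul (((PolyBound.const 2).mul
      (hx.polyBound.add hg.polyBound)).add (.const 1)))).add (.const 1)
  · intro a l' hl'
    change sz (M.run ⊥ l' (M.init (x a))) ≤ _
    have h1 : (Fintype.equivFin M.State (M.run ⊥ l' (M.init (x a))).state : ℕ) ≤
        Fintype.card M.State := (Fin.isLt _).le
    have h2 : sz (M.stackList (M.run ⊥ l' (M.init (x a)))) ≤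
        Fintype.card M.Stack * (2 * (sz (x a) + sz (g a)) + 1) := by
      refine (sz_le_length_mul (c := 2 * (sz (x a) + sz (g a))) fun l hl => ?_).trans ?_
      · obtain ⟨i, rfl⟩ := List.mem_ofFn.mp hl
        refine (sz_bits_le _).trans (Nat.mul_le_mul_left 2 ((length_stk_run_le _ _ _).trans ?_))
        have h3 := PT.length_le_sz (x a)
        have h4 := (PT.length_le_sz l').trans (sz_le_of_prefix hl')
        have h5 : ((M.init (x a)).stk ((Fintype.equivFin M.Stack).symm i)).length ≤
            (x a).length := by
          simp only [init]
          split_ifs <;> simp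
        omega
      · simp [stackList]
    have h3 : sz (M.run ⊥ l' (M.init (x a))) =
      (Fintype.equivFin M.State (M.run ⊥ l' (M.init (x a))).state : ℕ) +
        sz (M.stackList (M.run ⊥ l' (M.init (x a)))) + 1 := by
      conv_rhs => rw [← sz_nat (Fintype.equivFin M.State (M.run ⊥ l' (M.init (x a))).state : ℕ)]
      rfl
    omega

open Classical in
theorem pt_accepting (hM : M.QueryFree) {x g : α → List Bool} (hx : PT O x) (hg : PT O g) :
    PT O fun a => decide (M.run ⊥ (g a) (M.init (x a))).Accepting :=
  PT.finCases (h := fun q _ => decide (M.prog q = .halt true)) (pt_state (pt_run hM hx hg))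
    fun _ => PT.const _

end Machine

/-! ### Evaluation of circuits -/

namespace Gate

/-- The number of the gate type. -/
def tag : Gate → ℕ
  | input _ => 0
  | not _ => 1
  | and _ => 2
  | or _ => 3
  | mod _ => 4

/-- The arguments of a gate as a tree. -/
def payload : Gate → Dat
  | input i => enc i
  | not j => enc j
  | and js => enc js
  | or js => enc js
  | mod js => enc js

end Gate

instance : Enc Gate := ⟨fun g => enc (g.tag, g.payload)⟩

namespace Dat

/-- The numbers along the right spine. -/
def toNats (t : Dat) : List ℕ := t.toList.map size

theorem toNats_enc (l : List ℕ) : (enc l).toNats = l := by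
  rw [toNats, toList_enc, List.map_map]
  conv_rhs => rw [← List.map_id l]
  exact List.map_congr_left fun n _ => size_enc n

/-- The gate with the given tag and arguments. -/
def mkGate (t : Dat) : ℕ → Gate
  | 0 => .input t.size
  | 1 => .not t.size
  | 2 => .and t.toNats
  | 3 => .or t.toNats
  | _ => .mod t.toNats

/-- Read a gate from a tree. -/
def toGate (t : Dat) : Gate := mkGate t.tl (min t.hd.size 4)

theorem toGate_enc (g : Gate) : (enc g).toGate = g := by
  have h : (enc g).toGate = mkGate g.payload (min (enc g.tag).size 4) := rfl
  rw [h, size_enc]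
  cases g <;> simp [Gate.tag, Gate.payload, mkGate, size_enc, toNats_enc]

end Dat

namespace PT

variable {O : Language Bool} {α β : Type} [Enc α] [Enc β]

theorem toNats {e : α → Dat} (he : PT O e) : PT O fun a => (e a).toNats :=
  map (f := fun _ b => Dat.size b) he.toList PT.id.snd.size

theorem toGate {e : α → Dat} (he : PT O e) : PT O fun a => (e a).toGate := by
  refine natMinCases 4 (h := fun i a => Dat.mkGate (e a).tl i) he.hd.size fun i => ?_
  match i with
  | 0 => exact ((const 0).pair he.tl.size).congr_enc fun _ => rfl
  | 1 => exact ((const 1).pair he.tl.size).congr_enc fun _ => rfl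
  | 2 => exact ((const 2).pair he.tl.toNats).congr_enc fun _ => rfl
  | 3 => exact ((const 3).pair he.tl.toNats).congr_enc fun _ => rfl
  | (n + 4) => exact ((const 4).pair he.tl.toNats).congr_enc fun _ => rfl

/-- The payload can be read as a number and as a list of numbers whatever the tag is; the tag then
selects the branch that uses the right reading. -/
theorem gateCases {g : α → Gate} {fi fn : α × ℕ → β} {fa fo fm : α × List ℕ → β} {h : α → β}
    (hg : PT O g) (hi : PT O fi) (hn : PT O fn) (ha : PT O fa) (ho : PT O fo) (hm : PT O fm)
    (h₀ : ∀ a i, g a = .input i → h a = fi (a, i)) (h₁ : ∀ a j, g a = .not j → h a = fn (a, j))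
    (h₂ : ∀ a js, g a = .and js → h a = fa (a, js)) (h₃ : ∀ a js, g a = .or js → h a = fo (a, js))
    (h₄ : ∀ a js, g a = .mod js → h a = fm (a, js)) : PT O h := by
  have hg' : PT O fun a => ((g a).tag, (g a).payload) := hg.congr_enc fun _ => rfl
  have hnat := (PT.id (O := O) (α := α)).pair hg'.snd.size
  have hlist := (PT.id (O := O) (α := α)).pair hg'.snd.toNats
  let k : ℕ → α → β := fun i a =>
    match i with
    | 0 => fi (a, (g a).payload.size)
    | 1 => fn (a, (g a).payload.size)
    | 2 => fa (a, (g a).payload.toNats)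
    | 3 => fo (a, (g a).payload.toNats)
    | _ => fm (a, (g a).payload.toNats)
  refine (natMinCases 4 (h := k) hg'.fst fun i => ?_).of_eq fun a => ?_
  · match i with
    | 0 => exact hi.comp hnat
    | 1 => exact hn.comp hnat
    | 2 => exact ha.comp hlist
    | 3 => exact ho.comp hlist
    | (n + 4) => exact hm.comp hlist
  · cases hga : g a with
    | input i => simp [h₀ a i hga, k, hga, Gate.tag, Gate.payload, Dat.size_enc]
    | not j => simp [h₁ a j hga, k, hga, Gate.tag, Gate.payload, Dat.size_enc]
    | and js => simp [h₂ a js hga, k, hga, Gate.tag, Gate.payload, Dat.toNats_enc]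
    | or js => simp [h₃ a js hga, k, hga, Gate.tag, Gate.payload, Dat.toNats_enc]
    | mod js => simp [h₄ a js hga, k, hga, Gate.tag, Gate.payload, Dat.toNats_enc]

theorem gateEval {m : ℕ} (hm : 0 < m) {x v : α → List Bool} {g : α → Gate} (hx : PT O x)
    (hv : PT O v) (hg : PT O g) : PT O fun a => (g a).eval m (x a) (v a) := by
  have hbit : PT O fun p : (α × List ℕ) × ℕ => (v p.1.1).getD p.2 false :=
    (hv.comp PT.id.fst.fst).getD PT.id.snd (const false)
  refine gateCases hg ((hx.comp PT.id.fst).getD PT.id.snd (const false))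
    ((hv.comp PT.id.fst).getD PT.id.snd (const false)).not
    (all (f := fun p j => (v p.1).getD j false) PT.id.snd hbit)
    (any (f := fun p j => (v p.1).getD j false) PT.id.snd hbit)
    ((countP (f := fun p j => (v p.1).getD j false) PT.id.snd hbit).mod m hm).isZero ?_ ?_ ?_ ?_ ?_
  · intro a i h; simp only [h, Gate.eval]
  · intro a i h; simp only [h, Gate.eval]
  · intro a i h; simp only [h, Gate.eval]
  · intro a i h; simp only [h, Gate.eval]
  · intro a i h
    simp only [h, Gate.eval, Nat.dvd_iff_mod_eq_zero]

theorem gateArgs {g : α → Gate} (hg : PT O g) : PT O fun a => (g a).args := by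
  refine gateCases hg (const []) (PT.id.snd.cons (const [])) PT.id.snd PT.id.snd PT.id.snd
    ?_ ?_ ?_ ?_ ?_ <;> intro a i h <;> simp only [h, Gate.args]

theorem foldrMax {l : α → List ℕ} (hl : PT O l) : PT O fun a => (l a).foldr Max.max 0 := by
  refine foldr (step := fun _ b c => Max.max b c) hl (const 0) (PT.id.snd.fst.max PT.id.snd.snd)
    hl.polyBound ?_
  intro a l' hl'
  refine le_trans ?_ (sz_le_of_suffix hl')
  induction l' with
  | nil => simp
  | cons b l' ih =>
    have := ih ((List.suffix_cons b l').trans hl')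
    simp at *
    omega

theorem gateDepth {d : α → List ℕ} {g : α → Gate} (hd : PT O d) (hg : PT O g) :
    PT O fun a => (g a).depth (d a) := by
  have h : PT O fun a => ((g a).args.map fun j => (d a).getD j 0).foldr Max.max 0 + 1 :=
    (foldrMax (map (f := fun a j => (d a).getD j 0) hg.gateArgs
      ((hd.comp PT.id.fst).getD PT.id.snd (const 0)))).succ
  have h' := h.comp (f := fun p : α × List ℕ => p.1) PT.id.fst
  refine gateCases hg (const 0) (h.comp (f := fun p : α × ℕ => p.1) PT.id.fst) h' h' h'
    ?_ ?_ ?_ ?_ ?_ <;> intro a i h <;> simp only [h, Gate.depth]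

theorem encodeNat {n : α → ℕ} (hn : PT O n) : PT O fun a => encodeNat (n a) :=
  (replicate (const true) hn).append (const [false])

theorem encodeArgs {l : α → List ℕ} (hl : PT O l) : PT O fun a => encodeArgs (l a) :=
  (flatMap (f := fun _ j => true :: ACCUniform.encodeNat j) hl
    ((const true).cons PT.id.snd.encodeNat)).append (const [false])

theorem gateEncode {g : α → Gate} (hg : PT O g) : PT O fun a => (g a).encode := by
  have hargs : PT O fun p : α × List ℕ => ACCUniform.encodeArgs p.2 := PT.id.snd.encodeArgs
  have hnat : PT O fun p : α × ℕ => ACCUniform.encodeNat p.2 := PT.id.snd.encodeNat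
  refine gateCases hg ((const false).cons ((const false).cons hnat))
    ((const false).cons ((const true).cons hnat))
    ((const true).cons ((const false).cons ((const false).cons hargs)))
    ((const true).cons ((const false).cons ((const true).cons hargs)))
    ((const true).cons ((const true).cons hargs))
    ?_ ?_ ?_ ?_ ?_ <;> intro a i h <;> simp only [h, Gate.encode]

end PT

/-! ### Lists of gates -/

/-- The gates may form the initial part of a circuit, if `pos` of them have been checked. -/
def wfFrom (n : ℕ) : ℕ → List Gate → Prop
  | _, [] => True
  | pos, g :: G => g.WellFormed n pos ∧ wfFrom n (pos + 1) G

theorem wfFrom_iff (n pos : ℕ) (G : List Gate) :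
    wfFrom n pos G ↔ ∀ (i : ℕ) (h : i < G.length), G[i].WellFormed n (pos + i) := by
  induction G generalizing pos with
  | nil => simp [wfFrom]
  | cons g G ih =>
    simp only [wfFrom, ih]
    constructor
    · rintro ⟨h0, h⟩ i hi
      cases i with
      | zero => exact h0
      | succ i =>
        have := h i (by simpa using hi)
        simpa [Nat.add_assoc, Nat.add_comm 1 i] using this
    · intro h
      refine ⟨h 0 (by simp), fun i hi => ?_⟩
      have := h (i + 1) (by simpa using hi)
      simpa [Nat.add_assoc, Nat.add_comm 1 i] using this

/-- The values of the gates. -/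
def gateValues (m : ℕ) (x : List Bool) (G : List Gate) : List Bool :=
  G.foldl (fun v g => v ++ [g.eval m x v]) []

/-- The depths of the gates. -/
def gateDepths (G : List Gate) : List ℕ :=
  G.foldl (fun d g => d ++ [g.depth d]) []

theorem foldr_max_le {l : List ℕ} {c : ℕ} (h : ∀ a ∈ l, a ≤ c) : l.foldr max 0 ≤ c := by
  induction l with
  | nil => simp
  | cons a l ih =>
    have h1 := h a (by simp)
    have h2 := ih fun b hb => h b (by simp [hb])
    simp [h1, h2]

theorem Gate.depth_le {d : List ℕ} {c : ℕ} (h : ∀ a ∈ d, a ≤ c) (g : Gate) : g.depth d ≤ c + 1 := by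
  have key : (g.args.map fun j => d.getD j 0).foldr max 0 + 1 ≤ c + 1 := by
    refine Nat.succ_le_succ (foldr_max_le fun a ha => ?_)
    obtain ⟨j, -, rfl⟩ := List.mem_map.mp ha
    rw [List.getD_eq_getElem?_getD]
    rcases hj : d[j]? with _ | b
    · simp
    · exact h b (List.mem_of_getElem? hj)
  cases g with
  | input i => simp [Gate.depth]
  | _ => exact key

theorem length_gateValues (m : ℕ) (x : List Bool) (G : List Gate) :
    (gateValues m x G).length = G.length := by
  induction G using List.reverseRecOn with
  | nil => rfl
  | append_singleton G g ih => simp [gateValues] at *; exact ih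

theorem length_gateDepths (G : List Gate) : (gateDepths G).length = G.length := by
  induction G using List.reverseRecOn with
  | nil => rfl
  | append_singleton G g ih => simp [gateDepths] at *; exact ih

/-- Holds without well-formedness, since a dangling reference counts as depth zero. It bounds the
unary depth table while arbitrary guessed gates are processed. -/
theorem gateDepths_le (G : List Gate) : ∀ a ∈ gateDepths G, a ≤ G.length := by
  induction G using List.reverseRecOn with
  | nil => simp [gateDepths]
  | append_singleton G g ih =>
    have h : gateDepths (G ++ [g]) = gateDepths G ++ [g.depth (gateDepths G)] := by
      simp [gateDepths]
    intro a ha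
    rw [h, List.mem_append, List.mem_singleton] at ha
    rw [List.length_append, List.length_singleton]
    rcases ha with ha | rfl
    · exact (ih a ha).trans (Nat.le_succ _)
    · exact g.depth_le ih

/-! ### Checking and evaluating gate lists in polynomial time -/

namespace PT

variable {O : Language Bool} {α : Type} [Enc α]

open Classical in
theorem wellFormed {n pos : α → ℕ} {g : α → Gate} (hn : PT O n) (hp : PT O pos) (hg : PT O g) :
    PT O fun a => decide ((g a).WellFormed (n a) (pos a)) := by
  have h : PT O fun p : α × List ℕ => decide (∀ j ∈ p.2, j < pos p.1) :=
    (all (f := fun p j => decide (j < pos p.1)) PT.id.snd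
      (PT.id.snd.lt (hp.comp PT.id.fst.fst))).of_eq fun p => by
        rw [Bool.eq_iff_iff]
        simp
  refine gateCases hg (PT.id.snd.lt (hn.comp PT.id.fst)) (PT.id.snd.lt (hp.comp PT.id.fst)) h h h
    ?_ ?_ ?_ ?_ ?_ <;> intro a i h <;> rw [decide_eq_decide] <;> simp [h, Gate.WellFormed, Gate.args]

open Classical in
theorem wfFrom {n : α → ℕ} {G : α → List Gate} (hn : PT O n) (hG : PT O G) :
    PT O fun a => decide (wfFrom (n a) 0 (G a)) := by
  have h : ∀ n (G : List Gate) (p : ℕ × Bool), G.foldl (fun p g =>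
      (p.1 + 1, p.2 && decide (g.WellFormed n p.1))) p =
        (p.1 + G.length, p.2 && decide (ACCUniform.wfFrom n p.1 G)) := by
    intro n G
    induction G with
    | nil =>
      intro p
      have : decide (ACCUniform.wfFrom n p.1 []) = true := decide_eq_true trivial
      simp [this]
    | cons g G ih =>
      intro p
      rw [List.foldl_cons, ih]
      have : decide (ACCUniform.wfFrom n p.1 (g :: G)) = (decide (g.WellFormed n p.1) &&
          decide (ACCUniform.wfFrom n (p.1 + 1) G)) := by
        rw [← Bool.decide_and]
        exact decide_eq_decide.mpr Iff.rfl
      simp only [this, List.length_cons, Bool.and_assoc]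
      congr 1
      omega
  refine (foldl (step := fun a p g => (p.1 + 1, p.2 && decide (g.WellFormed (n a) p.1))) hG
    ((const 0).pair (const true))
    (PT.id.snd.fst.fst.succ.pair (PT.id.snd.fst.snd.and (wellFormed (hn.comp PT.id.fst)
      PT.id.snd.fst.fst PT.id.snd.snd))) (hG.polyBound.add (.const 2)) ?_).snd.of_eq ?_
  · intro a l' hl'
    rw [h]
    have h1 := (length_le_sz l').trans (sz_le_of_prefix hl')
    have h2 := sz_bool_le (true && decide (ACCUniform.wfFrom (n a) 0 l'))
    simp only [sz_pair, sz_nat] at *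
    omega
  · intro a
    rw [h]
    simp

theorem gateValues {m : ℕ} (hm : 0 < m) {x : α → List Bool} {G : α → List Gate} (hx : PT O x)
    (hG : PT O G) : PT O fun a => gateValues m (x a) (G a) := by
  refine foldl (step := fun a v g => v ++ [g.eval m (x a) v]) hG (const [])
    (PT.id.snd.fst.append ((gateEval hm (hx.comp PT.id.fst) PT.id.snd.fst PT.id.snd.snd).cons
      (const []))) ((PolyBound.const 2).mul hG.polyBound) ?_
  intro a l' hl'
  refine (sz_bits_le _).trans (Nat.mul_le_mul_left 2 ?_)
  refine le_trans (le_of_eq ?_) ((length_le_sz l').trans (sz_le_of_prefix hl'))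
  exact length_gateValues m (x a) l'

theorem gateDepths {G : α → List Gate} (hG : PT O G) : PT O fun a => gateDepths (G a) := by
  refine foldl (step := fun a d g => d ++ [g.depth d]) hG (const [])
    (PT.id.snd.fst.append ((gateDepth PT.id.snd.fst PT.id.snd.snd).cons
      (const []))) (hG.polyBound.mul (hG.polyBound.add (.const 1))) ?_
  intro a l' hl'
  have h1 := (length_le_sz l').trans (sz_le_of_prefix hl')
  refine (sz_le_length_mul (l := ACCUniform.gateDepths l') (c := sz (G a)) fun b hb => ?_).trans ?_
  · rw [sz_nat]
    exact (gateDepths_le l' b hb).trans h1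
  · rw [length_gateDepths]
    gcongr

end PT


/-! ### Binary counters -/

/-- The number with the given binary digits, the most significant one first. -/
def binVal : List Bool → ℕ
  | [] => 0
  | b :: l => (bif b then 2 ^ l.length else 0) + binVal l

/-- Add one to a binary number of fixed length; the first component is the carry. -/
def binSucc (l : List Bool) : Bool × List Bool :=
  l.foldr (fun b p => (p.1 && b, Bool.xor p.1 b :: p.2)) (true, [])

theorem length_binSucc (l : List Bool) : (binSucc l).2.length = l.length := by
  induction l with
  | nil => rfl
  | cons b l ih => simpa [binSucc] using ih

/-- The carry out of the top digit is accounted for with its weight; in this form the statement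
passes through the induction. -/
theorem binVal_binSucc (l : List Bool) :
    binVal (binSucc l).2 + (bif (binSucc l).1 then 2 ^ l.length else 0) = binVal l + 1 := by
  induction l with
  | nil => rfl
  | cons b l ih =>
    have h : binSucc (b :: l) =
      ((binSucc l).1 && b, Bool.xor (binSucc l).1 b :: (binSucc l).2) := rfl
    rw [h]
    simp only [binVal, length_binSucc, List.length_cons, pow_succ]
    cases hc : (binSucc l).1 <;> cases b <;> simp [hc] at * <;> omega

theorem binVal_lt (l : List Bool) : binVal l < 2 ^ l.length := by
  induction l with
  | nil => simp [binVal]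
  | cons b l ih => cases b <;> simp [binVal, pow_succ] <;> omega

theorem binVal_binSucc_of_lt {l : List Bool} (h : binVal l + 1 < 2 ^ l.length) :
    binVal (binSucc l).2 = binVal l + 1 := by
  have h1 := binVal_binSucc l
  cases hc : (binSucc l).1 <;> simp [hc] at h1 <;> omega

theorem binVal_replicate_false (n : ℕ) : binVal (List.replicate n false) = 0 := by
  induction n with
  | zero => rfl
  | succ n ih => simp [List.replicate_succ, binVal, ih]

/-- The number of elements of `X` that satisfy `f`, in binary with `n` digits. -/
def binCount {α : Type} (n : ℕ) (f : α → Bool) (X : List α) : List Bool :=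
  X.foldr (fun x c => bif f x then (binSucc c).2 else c) (List.replicate n false)

theorem length_binCount {α : Type} (n : ℕ) (f : α → Bool) (X : List α) :
    (binCount n f X).length = n := by
  induction X with
  | nil => simp [binCount]
  | cons x X ih =>
    rw [binCount, List.foldr_cons]
    cases f x
    · exact ih
    · exact (length_binSucc _).trans ih

theorem binVal_binCount {α : Type} {n : ℕ} (f : α → Bool) {X : List α} (h : X.length < 2 ^ n) :
    binVal (binCount n f X) = X.countP f := by
  induction X with
  | nil => simpa [binCount] using binVal_replicate_false n
  | cons x X ih =>
    rw [List.length_cons] at h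
    have h1 := ih (by omega)
    have h2 : X.countP f ≤ X.length := List.countP_le_length
    have h0 : binCount n f (x :: X) =
      bif f x then (binSucc (binCount n f X)).2 else binCount n f X := rfl
    rw [h0, List.countP_cons]
    cases hx : f x
    · simpa using h1
    · have h3 : binVal (binSucc (binCount n f X)).2 = binVal (binCount n f X) + 1 :=
        binVal_binSucc_of_lt (by rw [length_binCount]; omega)
      rw [h1] at h3
      simpa using h3

namespace PT

variable {O : Language Bool} {α β : Type} [Enc α] [Enc β]

theorem binSucc {l : α → List Bool} (hl : PT O l) : PT O fun a => (binSucc (l a)).2 := by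
  refine (foldr (step := fun _ b (p : Bool × List Bool) => (p.1 && b, Bool.xor p.1 b :: p.2)) hl
    ((const true).pair (const [])) ((PT.id.snd.snd.fst.and PT.id.snd.fst).pair
      ((PT.id.snd.snd.fst.xor PT.id.snd.fst).cons PT.id.snd.snd.snd))
    (((PolyBound.const 2).mul hl.polyBound).add (.const 2)) ?_).snd
  intro a l' hl'
  change sz (ACCUniform.binSucc l') ≤ _
  have h1 := sz_bits_le (ACCUniform.binSucc l').2
  have h2 := sz_bool_le (ACCUniform.binSucc l').1
  have h3 := (length_le_sz l').trans (sz_le_of_suffix hl')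
  rw [length_binSucc] at h1
  rw [sz_prod]
  omega

theorem binCount {n : α → ℕ} {f : α → β → Bool} {X : α → List β} (hn : PT O n)
    (hf : PT O fun p : α × β => f p.1 p.2) (hX : PT O X) :
    PT O fun a => binCount (n a) (f a) (X a) := by
  refine foldr (step := fun a x c => bif f a x then (ACCUniform.binSucc c).2 else c) hX
    (replicate (const false) hn)
    (cond (hf.comp (f := fun p : α × β × List Bool => (p.1, p.2.1)) (PT.id.fst.pair PT.id.snd.fst))
      PT.id.snd.snd.binSucc PT.id.snd.snd) ((PolyBound.const 2).mul hn.natBound) ?_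
  intro a l' _
  refine (sz_bits_le _).trans (Nat.mul_le_mul_left 2 (le_of_eq ?_))
  exact length_binCount (n a) (f a) l'

end PT

/-! ### All strings of a given length -/

/-- Prepend both bits to all strings. -/
def extend (X : List (List Bool)) : List (List Bool) :=
  X.map (List.cons true) ++ X.map (List.cons false)

/-- The list of all strings of length `n`. -/
def strings (n : ℕ) : List (List Bool) := extend^[n] [[]]

theorem strings_succ (n : ℕ) : strings (n + 1) = extend (strings n) :=
  Function.iterate_succ_apply' _ _ _

theorem mem_strings (n : ℕ) (x : List Bool) : x ∈ strings n ↔ x.length = n := by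
  induction n generalizing x with
  | zero => simp [strings]
  | succ n ih =>
    rw [strings_succ]
    cases x with
    | nil => simp [extend]
    | cons b x => cases b <;> simp [extend, ih]

theorem length_strings (n : ℕ) : (strings n).length = 2 ^ n := by
  induction n with
  | zero => rfl
  | succ n ih => simp [strings_succ, extend, ih, pow_succ, Nat.mul_two]

theorem sz_strings_le (n : ℕ) : sz (strings n) ≤ 2 ^ n * (2 * n + 1) := by
  rw [← length_strings]
  refine sz_le_length_mul fun x hx => (sz_bits_le x).trans ?_
  rw [(mem_strings n x).mp hx]

/-! ### Functions computed in exponential time -/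

/-- `f` is computed by a tree program of exponential cost. -/
def ET (O : Language Bool) {α β : Type} [Enc α] [Enc β] (f : α → β) : Prop :=
  ∃ t : Fn, (∀ a, t.eval O (enc a) = enc (f a)) ∧
    ∃ b : ℕ → ℕ, ExpBound b ∧ ∀ a : α, t.cost O (enc a) ≤ b (sz a)

theorem PolyBound.expBound {α : Type} [Enc α] {u : α → ℕ} (h : PolyBound u) :
    ∃ b : ℕ → ℕ, ExpBound b ∧ ∀ a, u a ≤ b (sz a) := by
  obtain ⟨k, hk⟩ := h
  exact ⟨fun n => (n + 2) ^ k, (ExpBound.id.add (.const 2)).pow k, hk⟩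

namespace ET

variable {O : Language Bool} {α β γ : Type} [Enc α] [Enc β] [Enc γ]

theorem pair {f : α → β} {g : α → γ} (hf : ET O f) (hg : ET O g) : ET O fun a => (f a, g a) := by
  obtain ⟨t, ht, b, hb, hp⟩ := hf
  obtain ⟨u, hu, c, hc, hq⟩ := hg
  refine ⟨.pair t u, fun a => by simp [Fn.eval, ht, hu], fun n => b n + c n +
    30 * (n + b n + c n + 1), (hb.add hc).add ((ExpBound.const 30).mul
      (((ExpBound.id.add hb).add hc).add (.const 1))), fun a => ?_⟩
  have h1 := t.size_eval_le_cost O (enc a)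
  have h2 := u.size_eval_le_cost O (enc a)
  have h3 := hp a
  have h4 := hq a
  simp only [Fn.cost, sz] at *
  omega

/-- Here intermediate values may be exponentially large. A step of polynomial cost on such a value
costs `(2^{O(n)})^k`, which is again `2^{O(n)}`. -/
theorem iterateTree {e : α → Dat} {init : α → γ} {step : γ → γ} (he : PT O e) (hi : PT O init)
    (hs : PT O step) {B : ℕ → ℕ} (hB : ExpBound B)
    (hb : ∀ a, ∀ i ≤ (e a).size, sz (step^[i] (init a)) ≤ B (sz a)) :
    ET O fun a => step^[(e a).size] (init a) := by
  obtain ⟨be, hbe, hes⟩ := he.polyBound.expBound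
  obtain ⟨bi, hbi, his⟩ := hi.polyBound.expBound
  obtain ⟨t, ht, hp⟩ := he
  obtain ⟨u, hu, hq⟩ := hi
  obtain ⟨v, hv, k, hr⟩ := hs
  obtain ⟨bt, hbt, hts⟩ := hp.expBound
  obtain ⟨bu, hbu, hus⟩ := hq.expBound
  refine ⟨.comp (.iter v) (.pair t u), fun a => ?_, fun n => bt n + bu n +
    30 * (n + be n + bi n + 1) + (30 * (be n + B n + 2) + 30 * (be n * (B n + 2) ^ k + B n)),
    ((hbt.add hbu).add ((ExpBound.const 30).mul (((ExpBound.id.add hbe).add hbi).add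
      (.const 1)))).add (((ExpBound.const 30).mul ((hbe.add hB).add (.const 2))).add
      ((ExpBound.const 30).mul ((hbe.mul ((hB.add (.const 2)).pow k)).add hB))), fun a => ?_⟩
  · simp [Fn.eval, ht, hu, eval_iterate hv]
  · have h1 := Fn.cost_iter_le hv hr (e a) (init a) (B (sz a)) (hb a)
    have h2 : (Fn.comp (.iter v) (.pair t u)).cost O (enc a) = t.cost O (enc a) +
        u.cost O (enc a) + 30 * (sz a + sz (e a) + sz (init a) + 1) +
          (Fn.iter v).cost O (.cons (e a) (enc (init a))) := by
      simp only [Fn.cost, Fn.eval, ht, hu, sz, enc_dat]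
    have h3 := hes a
    have h4 := his a
    have h5 := hts a
    have h6 := hus a
    have h7 : (e a).size * (B (sz a) + 2) ^ k ≤ be (sz a) * (B (sz a) + 2) ^ k :=
      Nat.mul_le_mul_right _ h3
    rw [h2]
    simp only [sz_dat] at *
    omega

end ET

/-- The resources for the verifier on input `z`: all strings of the relevant length and a number that
bounds the length of certificates. -/
def resources (K c : ℕ) (z : Dat) : List (List Bool) × ℕ :=
  (strings z.hd.size, (fun x => 2 ^ c * x)^[z.size] K)

theorem iterate_mul_left (m K n : ℕ) : (fun x => m * x)^[n] K = m ^ n * K := by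
  induction n with
  | zero => simp
  | succ n ih => rw [Function.iterate_succ_apply', ih, pow_succ]; ring

/-- Both components arise from linearly many iterations of a polynomial-cost step that enlarges its
argument: prepending both bits doubles the list of strings, and multiplication by `2 ^ c` produces
the unary length bound. -/
theorem et_resources (O : Language Bool) (K c : ℕ) : ET O (resources K c) := by
  refine ET.pair ?_ ?_
  · refine ET.iterateTree (e := fun z : Dat => z.hd) (step := extend) PT.id.hd (PT.const [[]]) ?_
      (B := fun n => 2 ^ n * (2 * n + 1)) ?_ ?_
    · exact (PT.map (f := fun _ x => true :: x) PT.id ((PT.const true).cons PT.id.snd)).append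
        (PT.map (f := fun _ x => false :: x) PT.id ((PT.const false).cons PT.id.snd))
    · refine ExpBound.mul ⟨1, fun n => by simp⟩ (((ExpBound.const 2).mul .id).add (.const 1))
    · intro z i hi
      have h : i ≤ sz z := hi.trans z.size_hd_le
      refine (sz_strings_le i).trans ?_
      gcongr
      norm_num
  · refine ET.iterateTree (e := fun z : Dat => z) (step := fun x => 2 ^ c * x) PT.id (PT.const K)
      ((PT.const _).mul PT.id) (B := fun n => (2 ^ c) ^ n * K) ?_ ?_
    · refine ExpBound.mul ⟨c + 1, fun n => ?_⟩ (.const K)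
      rw [← pow_mul]
      refine (Nat.pow_le_pow_right (by norm_num) (Nat.mul_le_mul_right n (Nat.le_succ c))).trans ?_
      exact Nat.le_mul_of_pos_left _ (by omega)
    · intro z i hi
      rw [iterate_mul_left, sz_nat]
      exact Nat.mul_le_mul_right K (Nat.pow_le_pow_right (by positivity) hi)

/-! ### The verifier -/

/-- The output of a list of gates. -/
def gateOutput (m : ℕ) (G : List Gate) (x : List Bool) : Bool :=
  (gateValues m x G).getLastD false

/-- The depth of a list of gates. -/
def depthOf (G : List Gate) : ℕ := (gateDepths G).foldr max 0

/-- The string that is maximized in the search for a circuit: the number of accepted strings in `X`,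
then the depth, where a smaller depth gives a larger string, then the description. -/
def profile (m n : ℕ) (X : List (List Bool)) (G : List Gate) : List Bool :=
  binCount (n + 1) (gateOutput m G) X ++
    (List.replicate (depthOf G) false ++ true :: G.flatMap Gate.encode)

open Classical in
/-- The certificate given by the gates `G` and the choice sequences `W` shows that there is a profile
of length at most `Q` that extends the reverse of `w`. -/
noncomputable def check (M : Machine) (m n Q : ℕ) (w : List Bool) (X : List (List Bool))
    (G : List Gate) (W : List (List Bool)) : Bool :=
  (!G.isEmpty && decide (wfFrom n 0 G)) &&
    (X.all (fun x => !gateOutput m G x ||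
      W.any fun g => decide (M.run ⊥ g (M.init x)).Accepting) &&
    (decide ((profile m n X G).length ≤ Q) && w.reverse.isPrefixOf (profile m n X G)))

namespace PT

variable {O : Language Bool} {α : Type} [Enc α]

theorem gateOutput {m : ℕ} (hm : 0 < m) {G : α → List Gate} {x : α → List Bool} (hG : PT O G)
    (hx : PT O x) : PT O fun a => gateOutput m (G a) (x a) :=
  (gateValues hm hx hG).getLastD (const false)

theorem profile {m : ℕ} (hm : 0 < m) {n : α → ℕ} {X : α → List (List Bool)} {G : α → List Gate}
    (hn : PT O n) (hX : PT O X) (hG : PT O G) : PT O fun a => profile m (n a) (X a) (G a) :=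
  (binCount (f := fun a x => ACCUniform.gateOutput m (G a) x) hn.succ
    (gateOutput hm (hG.comp PT.id.fst) PT.id.snd) hX).append
    ((replicate (const false) hG.gateDepths.foldrMax).append ((const true).cons
      (flatMap (f := fun _ g => Gate.encode g) hG PT.id.snd.gateEncode)))

theorem check {M : Machine} (hM : M.QueryFree) {m : ℕ} (hm : 0 < m) {n Q : α → ℕ}
    {w : α → List Bool} {X : α → List (List Bool)} {G : α → List Gate} {W : α → List (List Bool)}
    (hn : PT O n) (hQ : PT O Q) (hw : PT O w) (hX : PT O X) (hG : PT O G) (hW : PT O W) :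
    PT O fun a => check M m (n a) (Q a) (w a) (X a) (G a) (W a) := by
  classical
  refine (hG.isEmpty.not.and (wfFrom hn hG)).and ((all (f := fun a x =>
    !ACCUniform.gateOutput m (G a) x || (W a).any fun g =>
      decide (M.run ⊥ g (M.init x)).Accepting) hX ?_).and
    (((profile hm hn hX hG).length.le hQ).and (hw.reverse.isPrefixOf (profile hm hn hX hG))))
  refine (gateOutput hm (hG.comp PT.id.fst) PT.id.snd).not.or
    (any (f := fun p g => decide (M.run ⊥ g (M.init p.2)).Accepting) (hW.comp PT.id.fst) ?_)
  exact Machine.pt_accepting hM PT.id.fst.snd PT.id.snd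

end PT

/-- The verifier: `z` holds the length, the bound and the prefix, `r` the list of strings, and `t` the
certificate. -/
noncomputable def verify (M : Machine) (m : ℕ) (z r t : Dat) : Bool :=
  check M m z.hd.size z.tl.hd.size z.tl.tl.toBits (r.hd.toList.map Dat.toBits)
    (t.hd.toList.map Dat.toGate) (t.tl.toList.map Dat.toBits)

theorem pt_verify (O : Language Bool) {M : Machine} (hM : M.QueryFree) {m : ℕ} (hm : 0 < m) :
    PT O fun p : Dat × Dat × Dat => verify M m p.1 p.2.1 p.2.2 :=
  PT.check hM hm PT.id.fst.hd.size PT.id.fst.tl.hd.size PT.id.fst.tl.tl.toBits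
    (PT.map (f := fun _ t => Dat.toBits t) PT.id.snd.fst.hd.toList PT.id.snd.toBits)
    (PT.map (f := fun _ t => Dat.toGate t) PT.id.snd.snd.hd.toList PT.id.snd.toGate)
    (PT.map (f := fun _ t => Dat.toBits t) PT.id.snd.snd.tl.toList PT.id.snd.toBits)


/-! ### Greedy search for the lexicographically largest string -/

/-- The lexicographic order, where a string comes after its prefixes. -/
def LexLe : List Bool → List Bool → Prop
  | [], _ => True
  | _ :: _, [] => False
  | a :: s, b :: t => (a = b ∧ LexLe s t) ∨ (a = false ∧ b = true)

namespace LexLe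

theorem refl (s : List Bool) : LexLe s s := by
  induction s with
  | nil => trivial
  | cons a s ih => exact .inl ⟨rfl, ih⟩

theorem append_right {s t : List Bool} (h : LexLe s t) (u : List Bool) : LexLe s (t ++ u) := by
  induction s generalizing t with
  | nil => trivial
  | cons a s ih =>
    cases t with
    | nil => exact h.elim
    | cons b t => exact h.imp_left fun h => ⟨h.1, ih h.2⟩

theorem append_left {s t : List Bool} (h : LexLe s t) (u : List Bool) : LexLe (u ++ s) (u ++ t) := by
  induction u with
  | nil => exact h
  | cons a u ih => exact .inl ⟨rfl, ih⟩

/-- On strings of equal length the lexicographic order is the numerical one, so the counts at the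
front of two profiles are compared first. -/
theorem binVal_lt_or {a b s t : List Bool} (hl : a.length = b.length) (h : LexLe (a ++ s) (b ++ t)) :
    binVal a < binVal b ∨ (a = b ∧ LexLe s t) := by
  induction a generalizing b with
  | nil =>
    obtain rfl := List.length_eq_zero_iff.mp hl.symm
    exact .inr ⟨rfl, h⟩
  | cons x a ih =>
    cases b with
    | nil => simp at hl
    | cons y b =>
      have hl' : a.length = b.length := by simpa using hl
      rcases h with ⟨rfl, h⟩ | ⟨rfl, rfl⟩
      · rcases ih hl' h with h1 | ⟨rfl, h1⟩
        · left
          simp only [binVal, hl']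
          omega
        · exact .inr ⟨rfl, h1⟩
      · left
        have h1 := binVal_lt a
        simp only [binVal, cond_false, cond_true, hl'] at *
        omega

/-- The terminating one comes earlier in the code of the smaller number and makes that string
larger: maximizing the string minimizes the depth. -/
theorem le_of_replicate {d e : ℕ} {s t : List Bool}
    (h : LexLe (List.replicate d false ++ true :: s) (List.replicate e false ++ true :: t)) :
    e ≤ d := by
  induction e generalizing d with
  | zero => omega
  | succ e ih =>
    cases d with
    | zero => simp [List.replicate_succ, LexLe] at h
    | succ d =>
      have h1 : LexLe (List.replicate d false ++ true :: s) (List.replicate e false ++ true :: t) := by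
        simpa [List.replicate_succ, LexLe] using h
      have := ih h1
      omega

end LexLe

/-- Extend the reversed prefix `w` by one bit, by a one if possible. -/
def greedyStep (q : List Bool → Bool) (w : List Bool) : List Bool :=
  bif q (true :: w) then true :: w else bif q (false :: w) then false :: w else w

theorem length_greedyStep_iterate_le (q : List Bool → Bool) (i : ℕ) :
    ((greedyStep q)^[i] []).length ≤ i := by
  induction i with
  | zero => simp
  | succ i ih =>
    rw [Function.iterate_succ_apply', greedyStep]
    cases q (true :: (greedyStep q)^[i] []) <;> cases q (false :: (greedyStep q)^[i] []) <;>
      simp <;> omega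

/-- Greedy search finds the largest element of a set of strings of bounded length. -/
theorem greedy_spec {S : Set (List Bool)} {q : List Bool → Bool} {Q : ℕ}
    (hq : ∀ w, q w = true ↔ ∃ s ∈ S, w.reverse <+: s) (hS : S.Nonempty)
    (hQ : ∀ s ∈ S, s.length ≤ Q) :
    ((greedyStep q)^[Q] []).reverse ∈ S ∧ ∀ s ∈ S, LexLe s ((greedyStep q)^[Q] []).reverse := by
  -- Invariant for the current prefix: it extends to an element of `S`; each element of `S` is below
  -- it or extends it; and the search either gained a bit in every round or is stuck for good.
  have key : ∀ i, q ((greedyStep q)^[i] []) = true ∧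
      (∀ s ∈ S, LexLe s ((greedyStep q)^[i] []).reverse ∨ ((greedyStep q)^[i] []).reverse <+: s) ∧
      (((greedyStep q)^[i] []).length = i ∨ ∀ b, q (b :: (greedyStep q)^[i] []) = false) := by
    intro i
    induction i with
    | zero =>
      obtain ⟨s, hs⟩ := hS
      exact ⟨(hq _).mpr ⟨s, hs, by simp⟩, fun s _ => .inr (by simp), .inl rfl⟩
    | succ i ih =>
      rw [Function.iterate_succ_apply']
      generalize (greedyStep q)^[i] [] = w at ih
      obtain ⟨h1, h2, h3⟩ := ih
      cases ht : q (true :: w)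
      · cases hf : q (false :: w)
        · have hw : greedyStep q w = w := by simp [greedyStep, ht, hf]
          rw [hw]
          exact ⟨h1, h2, .inr fun b => by cases b <;> assumption⟩
        · have hw : greedyStep q w = false :: w := by simp [greedyStep, ht, hf]
          rw [hw]
          refine ⟨hf, fun s hs => ?_, .inl ?_⟩
          · rw [List.reverse_cons]
            rcases h2 s hs with h | ⟨t, rfl⟩
            · exact .inl (h.append_right _)
            · cases t with
              | nil => exact .inl (by simpa using (LexLe.refl w.reverse).append_right [false])
              | cons c t =>
                cases c
                · exact .inr ⟨t, by simp⟩
                · have := (hq (true :: w)).mpr ⟨_, hs, ⟨t, by simp⟩⟩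
                  simp [ht] at this
          · rcases h3 with h3 | h3
            · simp [h3]
            · simp [hf] at h3
      · have hw : greedyStep q w = true :: w := by simp [greedyStep, ht]
        rw [hw]
        refine ⟨ht, fun s hs => ?_, .inl ?_⟩
        · rw [List.reverse_cons]
          rcases h2 s hs with h | ⟨t, rfl⟩
          · exact .inl (h.append_right _)
          · cases t with
            | nil => exact .inl (by simpa using (LexLe.refl w.reverse).append_right [true])
            | cons c t =>
              cases c
              -- An element that continues with a zero falls behind once the prefix takes a one.
              · exact .inl (LexLe.append_left (s := false :: t) (t := [true]) (Or.inr ⟨rfl, rfl⟩) _)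
              · exact .inr ⟨t, by simp⟩
        · rcases h3 with h3 | h3
          · simp [h3]
          · simp [ht] at h3
  obtain ⟨h1, h2, h3⟩ := key Q
  generalize (greedyStep q)^[Q] [] = w at *
  -- After `Q` rounds the prefix cannot be properly extended within `S`: either it has length `Q`,
  -- or the search is stuck.
  have hext : ∀ s ∈ S, w.reverse <+: s → s = w.reverse := by
    rintro s hs ⟨t, rfl⟩
    cases t with
    | nil => simp
    | cons b t =>
      rcases h3 with h3 | h3
      · have := hQ _ hs
        simp at this
        omega
      · have := (hq (b :: w)).mpr ⟨_, hs, ⟨t, by simp⟩⟩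
        simp [h3] at this
  obtain ⟨s, hs, hws⟩ := (hq w).mp h1
  refine ⟨hext s hs hws ▸ hs, fun s hs => (h2 s hs).elim id fun h => ?_⟩
  rw [hext s hs h]
  exact .refl _

/-- The prefix gains at most one bit per round, which bounds the intermediate results. -/
theorem PT.greedy {O : Language Bool} {α : Type} [Enc α] {q : α → List Bool → Bool} {Q : α → ℕ}
    (hq : PT O fun p : α × List Bool => q p.1 p.2) (hQ : PT O Q) :
    PT O fun a => (greedyStep (q a))^[Q a] [] := by
  refine PT.iterate hQ (PT.const []) ?_ ((PolyBound.const 2).mul hQ.natBound) fun a i hi =>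
    (sz_bits_le _).trans (Nat.mul_le_mul_left 2 ((length_greedyStep_iterate_le _ i).trans hi))
  have h1 : PT O fun p : α × List Bool => true :: p.2 := (PT.const true).cons PT.id.snd
  have h0 : PT O fun p : α × List Bool => false :: p.2 := (PT.const false).cons PT.id.snd
  exact PT.cond (hq.comp (PT.id.fst.pair h1)) h1 (PT.cond (hq.comp (PT.id.fst.pair h0)) h0 PT.id.snd)

/-! ### Profiles of circuits -/

/-- The gates `G` form a circuit with `n` inputs that accepts only strings in `A`. -/
def SoundGates (A : Language Bool) (m n : ℕ) (G : List Gate) : Prop :=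
  G ≠ [] ∧ wfFrom n 0 G ∧ ∀ x : List Bool, x.length = n → gateOutput m G x = true → x ∈ A

/-- The profiles of length at most `Q` of the circuits that accept only strings in `A`. -/
def profiles (A : Language Bool) (m n Q : ℕ) : Set (List Bool) :=
  {s | s.length ≤ Q ∧ ∃ G, SoundGates A m n G ∧ s = profile m n (strings n) G}

/-- A sound circuit accepts a subset of what a correct one accepts. -/
theorem countP_strings {A : Language Bool} {m n : ℕ} {G H : List Gate} (hG : SoundGates A m n G)
    (hH : ∀ x : List Bool, x.length = n → (x ∈ A ↔ gateOutput m H x = true)) :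
    (strings n).countP (gateOutput m G) ≤ (strings n).countP (gateOutput m H) :=
  List.countP_mono_left fun x hx h =>
    have hx' := (mem_strings n x).mp hx
    (hH x hx').mp (hG.2.2 x hx' h)

/-- A subset that is at least as large is everything. This turns maximality of the count into
correctness, with no certificate of non-membership. -/
theorem iff_of_countP_le {α : Type} {p q : α → Bool} {l : List α} (h : ∀ x ∈ l, p x = true → q x = true)
    (hl : l.countP q ≤ l.countP p) : ∀ x ∈ l, q x = true → p x = true := by
  induction l with
  | nil => simp
  | cons a l ih =>
    have h1 : l.countP p ≤ l.countP q := List.countP_mono_left fun x hx => h x (by simp [hx])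
    have h2 := h a (by simp)
    simp only [List.countP_cons] at hl
    have h3 : l.countP q ≤ l.countP p := by
      cases hp : p a <;> cases hq : q a <;> simp [hp, hq] at * <;> omega
    intro x hx
    rcases List.mem_cons.mp hx with rfl | hx
    · cases hp : p x <;> cases hq : q x <;> simp [hp, hq] at * <;> omega
    · exact ih (fun x hx => h x (by simp [hx])) h3 x hx

/-- A circuit with the largest profile is correct, and of smallest depth. -/
theorem of_lexLe_profile {A : Language Bool} {m n : ℕ} {G H : List Gate} (hG : SoundGates A m n G)
    (hH : ∀ x : List Bool, x.length = n → (x ∈ A ↔ gateOutput m H x = true))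
    (h : LexLe (profile m n (strings n) H) (profile m n (strings n) G)) :
    (∀ x : List Bool, x.length = n → (x ∈ A ↔ gateOutput m G x = true)) ∧ depthOf G ≤ depthOf H := by
  -- The count can be as large as `2 ^ n`, so `n` digits would overflow.
  have hn : (strings n).length < 2 ^ (n + 1) := by
    rw [length_strings]
    exact Nat.pow_lt_pow_right (by norm_num) (by omega)
  have hc := countP_strings hG hH
  rcases h.binVal_lt_or (by simp only [length_binCount]) with h1 | ⟨h1, h2⟩
  · rw [binVal_binCount _ hn, binVal_binCount _ hn] at h1
    omega
  · refine ⟨fun x hx => ⟨fun hxA => ?_, hG.2.2 x hx⟩, h2.le_of_replicate⟩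
    have h3 := congrArg binVal h1
    rw [binVal_binCount _ hn, binVal_binCount _ hn] at h3
    refine iff_of_countP_le (p := gateOutput m G) (q := gateOutput m H) (l := strings n)
      (fun y hy hGy => ?_) h3.le x ((mem_strings n x).mpr hx) ((hH x hx).mp hxA)
    have hy' := (mem_strings n y).mp hy
    exact (hH y hy').mp (hG.2.2 y hy' hGy)

/-- The description part of a profile. -/
def descriptionOf (n : ℕ) (s : List Bool) : List Bool :=
  ((s.drop (n + 1)).dropWhile fun b => !b).tail

/-- The count has the fixed length `n + 1` and the depth field ends with its first one, so the
fields can be separated without knowing the circuit. -/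
theorem descriptionOf_profile (m n : ℕ) (X : List (List Bool)) (G : List Gate) :
    descriptionOf n (profile m n X G) = G.flatMap Gate.encode := by
  have h : ∀ d (l : List Bool), (List.replicate d false ++ true :: l).dropWhile (fun b => !b) =
      true :: l := by
    intro d l
    induction d with
    | zero => simp
    | succ d ih => simp [List.replicate_succ, ih]
  rw [descriptionOf, profile, List.drop_left' (length_binCount _ _ _), h, List.tail_cons]


/-! ### The oracle -/

/-- The language of the searches that can be continued. -/
def searchOracle (M : Machine) (m K c : ℕ) : Language Bool :=
  {x | ∃ w : List Bool, w.length = sz (resources K c (Dat.ofCode x)) ∧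
    verify M m (Dat.ofCode x) (enc (resources K c (Dat.ofCode x))) (Dat.ofCode w) = true}

/-- The resources have exponential cost, and the check is polynomial in input, resources and
certificate together, as `mem_NE_of_verifier` requires. -/
theorem searchOracle_mem_NE {M : Machine} (hM : M.QueryFree) {m : ℕ} (hm : 0 < m) (K c : ℕ) :
    searchOracle M m K c ∈ NE := by
  obtain ⟨B, hB, b, ⟨e, he⟩, hBb⟩ := et_resources ⊥ K c
  obtain ⟨V, hV, k, hk⟩ := (pt_verify ⊥ hM hm).comp (f := fun v : Dat => (v.hd, v.tl.hd, v.tl.tl))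
    (PT.id.hd.pair (PT.id.tl.hd.pair PT.id.tl.tl))
  refine mem_NE_of_verifier B V (b := fun n => e * 2 ^ (e * n)) ⟨e, fun n => le_rfl⟩
    (fun z => (hBb z).trans (he _)) (fun a b hab => ?_) k hk _ fun x => ?_
  · dsimp only
    gcongr
    norm_num
  · have h : ∀ b : Bool, enc b ≠ .nil ↔ b = true := by
      intro b
      cases b <;> simp
    have hB' := hB (Dat.ofCode x)
    have hV' : ∀ r t : Dat, V.eval ⊥ (.cons (Dat.ofCode x) (.cons r t)) =
      enc (verify M m (Dat.ofCode x) r t) := fun r t => hV _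
    rw [enc_dat] at hB'
    simp only [hB', hV', h]
    exact Iff.rfl

theorem verify_enc (M : Machine) (m n Q : ℕ) (w : List Bool) (X : List (List Bool)) (p : ℕ)
    (t : Dat) : verify M m (enc (n, Q, w)) (enc (X, p)) t =
      check M m n Q w X (t.hd.toList.map Dat.toGate) (t.tl.toList.map Dat.toBits) := by
  have hX : (enc X).toList.map Dat.toBits = X := by
    rw [Dat.toList_enc, List.map_map]
    conv_rhs => rw [← List.map_id X]
    exact List.map_congr_left fun x _ => Dat.toBits_enc x
  change check M m (enc n).size (enc Q).size (enc w).toBits ((enc X).toList.map Dat.toBits) _ _ = _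
  rw [Dat.size_enc, Dat.size_enc, Dat.toBits_enc, hX]

/-- A short path is padded. A long one is cut at `T`, where the machine has already halted. This
controls the size of certificates. -/
theorem Machine.Accepts.exists_length_eq {M : Machine} {O : Language Bool} {x : List Bool} {T : ℕ}
    (hT : M.HaltsWithin O x T) (h : M.Accepts O x) :
    ∃ g : List Bool, g.length = T ∧ (M.run O g (M.init x)).Accepting := by
  obtain ⟨g, hg⟩ := h
  rcases le_total g.length T with hl | hl
  · refine ⟨g ++ List.replicate (T - g.length) false, by simp; omega, ?_⟩
    rw [Machine.run_append, hg.halted.run_eq]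
    exact hg
  · refine ⟨g.take T, by simp; omega, ?_⟩
    have h1 := hT (g.take T) (by simp; omega)
    rwa [← List.take_append_drop T g, Machine.run_append, h1.run_eq] at hg

theorem sz_gate_lt (g : Gate) : sz g + 1 ≤ 2 * g.encode.length := by
  have h : ∀ js : List ℕ, sz js + 1 ≤ (encodeArgs js).length := by
    intro js
    induction js with
    | nil => simp [encodeArgs]
    | cons j js ih =>
      simp only [encodeArgs, encodeNat, List.flatMap_cons, List.length_append, List.length_cons,
        List.length_replicate, List.length_nil, sz_cons, sz_nat] at *
      omega
  have h0 : sz g = g.tag + g.payload.size + 1 := by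
    change sz (g.tag, g.payload) = _
    simp
  rw [h0]
  cases g with
  | input i => simp [Gate.tag, Gate.payload, Gate.encode, encodeNat, Dat.size_enc]; omega
  | not i => simp [Gate.tag, Gate.payload, Gate.encode, encodeNat, Dat.size_enc]; omega
  | and js => have := h js; simp [Gate.tag, Gate.payload, Gate.encode, sz] at *; omega
  | or js => have := h js; simp [Gate.tag, Gate.payload, Gate.encode, sz] at *; omega
  | mod js => have := h js; simp [Gate.tag, Gate.payload, Gate.encode, sz] at *; omega

theorem sz_gates_le (G : List Gate) : sz G ≤ 2 * (G.flatMap Gate.encode).length := by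
  induction G with
  | nil => simp
  | cons g G ih =>
    have := sz_gate_lt g
    simp only [List.flatMap_cons, List.length_append, sz_cons]
    omega

/-- The left side bounds the code of a gate list of size at most `2 * Q` together with `2 ^ n`
choice sequences of `cA * 2 ^ (cA * n)` bits each. With `P` for the power on the right, `2 ^ n * 2 ^
(cA * n)`, `2 ^ n` and `Q` are at most `P`; the coefficients `4`, `4 * cA`, `2` and `3` add up to `4
* cA + 9`. -/
theorem certificate_size_le {cA n Q w : ℕ} :
    2 * (2 * Q + 2 ^ n * (2 * (cA * 2 ^ (cA * n)) + 1) + 1) + 1 ≤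
      (2 ^ (cA + 1)) ^ (n + (Q + w + 1) + 1) * (4 * cA + 9) := by
  set P := (2 ^ (cA + 1)) ^ (n + (Q + w + 1) + 1) with hP
  have h1 : 2 ^ n * 2 ^ (cA * n) ≤ P := by
    rw [hP, ← pow_mul, ← pow_add]
    refine Nat.pow_le_pow_right (by norm_num) ?_
    nlinarith
  have h2 : 2 ^ n ≤ P := (Nat.le_mul_of_pos_right _ (by positivity)).trans h1
  have h3 : Q ≤ P := by
    refine (Nat.lt_two_pow_self (n := Q)).le.trans ?_
    rw [hP, ← pow_mul]
    refine Nat.pow_le_pow_right (by norm_num) ?_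
    nlinarith
  have h4 : 0 < P := by positivity
  have h5 : cA * (2 ^ n * 2 ^ (cA * n)) ≤ cA * P := Nat.mul_le_mul_left _ h1
  nlinarith

/-- A certificate proves soundness because each accepted string comes with an accepting path of `M`.
Conversely, a sound circuit whose profile fits into `Q`, with one path for each string of length
`n`, is small enough to be guessed. -/
theorem mem_searchOracle {M : Machine} {A : Language Bool} {cA : ℕ}
    (hA : ∀ x : List Bool, M.HaltsWithin ⊥ x (cA * 2 ^ (cA * x.length)) ∧ (x ∈ A ↔ M.Accepts ⊥ x))
    (m n Q : ℕ) (w : List Bool) :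
    (enc (n, Q, w)).code ∈ searchOracle M m (4 * cA + 9) (cA + 1) ↔
      ∃ s ∈ profiles A m n Q, w.reverse <+: s := by
  classical
  have hres : resources (4 * cA + 9) (cA + 1) (enc (n, Q, w)) =
      (strings n, (2 ^ (cA + 1)) ^ (n + (Q + sz w + 1) + 1) * (4 * cA + 9)) := by
    have h1 : (enc (n, Q, w)).hd.size = n := Dat.size_enc n
    have h2 : (enc (n, Q, w)).size = n + (Q + sz w + 1) + 1 := by
      change sz (n, Q, w) = _
      simp
    rw [resources, iterate_mul_left, h1, h2]
  have hdef : (enc (n, Q, w)).code ∈ searchOracle M m (4 * cA + 9) (cA + 1) ↔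
      ∃ v : List Bool, v.length = sz (resources (4 * cA + 9) (cA + 1) (enc (n, Q, w))) ∧
        verify M m (enc (n, Q, w)) (enc (resources (4 * cA + 9) (cA + 1) (enc (n, Q, w))))
          (Dat.ofCode v) = true := by
    have := Dat.ofCode_code (enc (n, Q, w))
    conv_rhs => rw [← this]
    exact Iff.rfl
  rw [hdef, hres]
  simp only [verify_enc, sz_pair, sz_nat]
  constructor
  · rintro ⟨v, -, hv⟩
    generalize (Dat.ofCode v).hd.toList.map Dat.toGate = G at hv
    generalize (Dat.ofCode v).tl.toList.map Dat.toBits = W at hv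
    simp only [check, Bool.and_eq_true, decide_eq_true_eq, List.all_eq_true, Bool.or_eq_true,
      List.any_eq_true, List.isPrefixOf_iff_prefix, Bool.not_eq_true'] at hv
    obtain ⟨⟨h1, h2⟩, h3, h4, h5⟩ := hv
    refine ⟨_, ⟨h4, G, ⟨by simpa using h1, h2, fun x hx hGx => ?_⟩, rfl⟩, h5⟩
    rcases h3 x ((mem_strings n x).mpr hx) with h | ⟨g, -, hg⟩
    · simp [hGx] at h
    · exact (hA x).2.mpr ⟨g, hg⟩
  · rintro ⟨s, ⟨h4, G, ⟨h1, h2, h3⟩, rfl⟩, h5⟩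
    -- Strings outside `A` get a dummy sequence of the same length; a sound circuit rejects them, so
    -- it is never used.
    have hwit : ∀ x : List Bool, ∃ g : List Bool, x.length = n →
        g.length = cA * 2 ^ (cA * n) ∧ (x ∈ A → (M.run ⊥ g (M.init x)).Accepting) := by
      intro x
      by_cases hx : x ∈ A
      · obtain ⟨g, hg, hg'⟩ := ((hA x).2.mp hx).exists_length_eq (hA x).1
        exact ⟨g, fun h => ⟨h ▸ hg, fun _ => hg'⟩⟩
      · exact ⟨List.replicate (cA * 2 ^ (cA * n)) false, fun _ => ⟨by simp, fun h => absurd h hx⟩⟩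
    choose f hf using hwit
    set t : Dat := .cons (enc G) (enc ((strings n).map f)) with ht
    have hG : t.hd.toList.map Dat.toGate = G := by
      change (enc G).toList.map Dat.toGate = G
      rw [Dat.toList_enc, List.map_map]
      conv_rhs => rw [← List.map_id G]
      exact List.map_congr_left fun x _ => Dat.toGate_enc x
    have hW : t.tl.toList.map Dat.toBits = (strings n).map f := by
      change (enc ((strings n).map f)).toList.map Dat.toBits = _
      rw [Dat.toList_enc, List.map_map]
      conv_rhs => rw [← List.map_id ((strings n).map f)]
      exact List.map_congr_left fun x _ => Dat.toBits_enc x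
    have hsG : sz G ≤ 2 * Q := by
      refine (sz_gates_le G).trans (Nat.mul_le_mul_left 2 (le_trans ?_ h4))
      simp [profile]
      omega
    have hsW : sz ((strings n).map f) ≤ 2 ^ n * (2 * (cA * 2 ^ (cA * n)) + 1) := by
      rw [← length_strings n, ← List.length_map (as := strings n) f]
      refine sz_le_length_mul fun g hg => (sz_bits_le g).trans ?_
      obtain ⟨x, hx, rfl⟩ := List.mem_map.mp hg
      rw [(hf x ((mem_strings n x).mp hx)).1]
    have hlen : t.code.length ≤ (2 ^ (cA + 1)) ^ (n + (Q + sz w + 1) + 1) * (4 * cA + 9) := by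
      refine le_trans ?_ (certificate_size_le (cA := cA) (n := n) (Q := Q) (w := sz w))
      have : t.size = sz G + sz ((strings n).map f) + 1 := rfl
      rw [Dat.length_code, this]
      omega
    -- Certificates must have exactly the size of the resources; the padding is ignored, as the code
    -- is prefix-free.
    refine ⟨t.code ++ List.replicate (sz (strings n) + (2 ^ (cA + 1)) ^ (n + (Q + sz w + 1) + 1) *
      (4 * cA + 9) + 1 - t.code.length) false, ?_, ?_⟩
    · rw [List.length_append, List.length_replicate]
      omega
    · rw [Dat.ofCode_code_append, hG, hW]
      simp only [check, Bool.and_eq_true, decide_eq_true_eq, List.all_eq_true, Bool.or_eq_true,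
        List.any_eq_true, List.isPrefixOf_iff_prefix, Bool.not_eq_true']
      refine ⟨⟨by simpa using h1, h2⟩, fun x hx => ?_, h4, h5⟩
      cases hGx : gateOutput m G x
      · exact .inl rfl
      · have hx' := (mem_strings n x).mp hx
        exact .inr ⟨f x, List.mem_map_of_mem hx, (hf x hx').2 (h3 x hx' hGx)⟩


/-! ### Size and length of the description -/

theorem length_encodeArgs (js : List ℕ) : (encodeArgs js).length = js.sum + 2 * js.length + 1 := by
  induction js with
  | nil => rfl
  | cons j js ih =>
    simp only [encodeArgs, encodeNat, List.flatMap_cons, List.length_append, List.length_cons,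
      List.length_replicate, List.length_nil, List.sum_cons] at *
    omega

theorem Gate.succ_length_args_le (g : Gate) : 1 + g.args.length ≤ g.encode.length := by
  cases g <;> simp [args, encode, encodeNat, length_encodeArgs] <;> omega

theorem Gate.length_encode_le {n pos D : ℕ} {g : Gate} (hg : g.WellFormed n pos) (hn : n ≤ D)
    (hpos : pos ≤ D) : g.encode.length ≤ (1 + g.args.length) * (D + 4) := by
  have h : ∀ js : List ℕ, (∀ j ∈ js, j < pos) →
      3 + (encodeArgs js).length ≤ (1 + js.length) * (D + 4) := by
    intro js hjs
    have h1 : js.sum ≤ js.length * D := by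
      rw [← smul_eq_mul]
      exact List.sum_le_card_nsmul js D fun j hj => (hjs j hj).le.trans hpos
    rw [length_encodeArgs]
    nlinarith
  cases g with
  | input i =>
    simp only [WellFormed] at hg
    simp [args, encode, encodeNat]
    omega
  | not j =>
    simp only [WellFormed, args, List.mem_singleton, forall_eq] at hg
    simp [args, encode, encodeNat]
    omega
  | and js => have := h js hg; simp only [args, encode, List.length_cons]; omega
  | or js => have := h js hg; simp only [args, encode, List.length_cons]; omega
  | mod js => have := h js hg; simp only [args, encode, List.length_cons]; omega

namespace Circuit

variable {n : ℕ} (C : Circuit n)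

theorem size_le_length_encode : C.size ≤ C.encode.length := by
  rw [size, encode, List.length_flatMap]
  exact List.sum_le_sum fun g _ => g.succ_length_args_le

theorem length_gates_le_size : C.gates.length ≤ C.size := by
  rw [size]
  induction C.gates with
  | nil => simp
  | cons g G ih => simp only [List.map_cons, List.sum_cons, List.length_cons]; omega

theorem depth_le_size : C.depth ≤ C.size :=
  (foldr_max_le (gateDepths_le C.gates)).trans C.length_gates_le_size

/-- Positions are written in unary, but well-formedness bounds each of them by the number of gates
or of inputs. -/
theorem length_encode_le : C.encode.length ≤ C.size * (C.size + n + 4) := by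
  have h : ∀ g ∈ C.gates, g.encode.length ≤ (1 + g.args.length) * (C.size + n + 4) := by
    intro g hg
    obtain ⟨i, hi, rfl⟩ := List.getElem_of_mem hg
    exact Gate.length_encode_le (C.wellFormed i hi) (Nat.le_add_left _ _)
      (hi.le.trans (C.length_gates_le_size.trans (Nat.le_add_right _ _)))
  rw [encode, List.length_flatMap]
  refine (List.sum_le_sum h).trans ?_
  rw [List.sum_map_mul_right, size]

theorem soundGates {m : ℕ} {A : Language Bool}
    (hC : ∀ x : List Bool, x.length = n → (x ∈ A ↔ C.eval m x = true)) : SoundGates A m n C.gates := by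
  refine ⟨C.nonempty, (wfFrom_iff n 0 C.gates).mpr fun i h => ?_, fun x hx h => (hC x hx).mpr h⟩
  rw [Nat.zero_add]
  exact C.wellFormed i h

end Circuit

theorem polyBound_eval (p : Polynomial ℕ) : PolyBound fun n : ℕ => p.eval n := by
  induction p using Polynomial.induction_on' with
  | add p q hp hq => simpa using hp.add hq
  | monomial k a => simpa using (PolyBound.const (α := ℕ) a).mul (PolyBound.size.pow k)

/-! ### Uniformization -/

theorem hasUniformACC_of_hasACC {k : ℕ} {A : Language Bool} (hA : A ∈ NE) (h : HasACC k A) :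
    HasUniformACC k A := by
  classical
  obtain ⟨M, hM, cA, hcA⟩ := hA
  obtain ⟨m, hm, C, ⟨⟨p, hp⟩, d, hd⟩, hC⟩ := h
  have hC' : ∀ n, ∀ x : List Bool, x.length = n → (x ∈ A ↔ gateOutput m (C n).gates x = true) := by
    rintro n x rfl
    exact hC x
  -- Room for the profile of the given circuit: `n + 1` digits and a separator, the depth (at most
  -- the size), and the description.
  have hpoly : PolyBound fun n : ℕ => n + 2 + p.eval n + p.eval n * (p.eval n + n + 4) := by
    have hn : PolyBound fun n : ℕ => n := by simpa using PolyBound.size (α := ℕ)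
    have h := polyBound_eval p
    exact ((hn.add (.const 2)).add h).add (h.mul ((h.add hn).add (.const 4)))
  obtain ⟨K, hK⟩ := hpoly
  simp only [sz_nat] at hK
  have hmem : ∀ n, profile m n (strings n) (C n).gates ∈ profiles A m n ((n + 2) ^ K) := by
    refine fun n => ⟨le_trans ?_ (hK n), _, (C n).soundGates (hC' n), rfl⟩
    have h1 := (C n).depth_le_size
    have h2 := (C n).length_encode_le
    have h3 := hp n
    have h4 : (C n).size * ((C n).size + n + 4) ≤ p.eval n * (p.eval n + n + 4) := by gcongr
    have h5 : (profile m n (strings n) (C n).gates).length =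
        n + 1 + ((C n).depth + ((C n).encode.length + 1)) := by
      rw [profile, List.length_append, length_binCount, List.length_append, List.length_replicate,
        List.length_cons]
      rfl
    omega
  set O := searchOracle M m (4 * cA + 9) (cA + 1) with hO
  let q : ℕ → List Bool → Bool := fun n w => decide ((enc (n, (n + 2) ^ K, w)).code ∈ O)
  let r : ℕ → List Bool := fun n => ((greedyStep (q n))^[(n + 2) ^ K] []).reverse
  have hr : ∀ n, r n ∈ profiles A m n ((n + 2) ^ K) ∧
      ∀ s ∈ profiles A m n ((n + 2) ^ K), LexLe s (r n) := fun n =>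
    greedy_spec (fun w => by simpa [q] using mem_searchOracle hcA m n ((n + 2) ^ K) w)
      ⟨_, hmem n⟩ fun s hs => hs.1
  choose hr hmax using hr
  choose hlen G hG hrG using hr
  let D : (n : ℕ) → Circuit n := fun n => ⟨G n, (hG n).1, fun i hi => by
    simpa using (wfFrom_iff n 0 (G n)).mp (hG n).2.1 i hi⟩
  -- The given circuit is itself a candidate, so the largest profile is at least its profile; the
  -- circuit found is thus correct and no deeper.
  have hopt : ∀ n, _ ∧ _ := fun n =>
    of_lexLe_profile (hG n) (hC' n) (hrG n ▸ hmax n _ (hmem n))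
  refine ⟨m, hm, D, ⟨⟨(Polynomial.X + 2) ^ K, fun n => ?_⟩, d, fun n => ?_⟩, fun x => ?_,
    fun x => descriptionOf x.length (r x.length), ⟨O, searchOracle_mem_NE hM (by omega) _ _, ?_⟩,
    fun j => ?_⟩
  · refine (D n).size_le_length_encode.trans ?_
    have h1 : (D n).encode = (G n).flatMap Gate.encode := rfl
    have h2 := hlen n
    rw [hrG n, profile, List.length_append, List.length_append, List.length_cons, ← h1] at h2
    simp
    omega
  · exact (hopt n).2.trans (hd n)
  · exact (hopt x.length).1 x rfl
  · have hn : PT O fun n : ℕ => n := PT.id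
    have hQ : PT O fun n : ℕ => (n + 2) ^ K := hn.succ.succ.pow K
    have hq : PT O fun p : ℕ × List Bool => q p.1 p.2 :=
      PT.query (PT.id.fst.pair ((hQ.comp PT.id.fst).pair PT.id.snd))
    -- The output routine reverses its list, so the description is computed backwards.
    have hdesc : PT O fun n : ℕ => (descriptionOf n (r n)).reverse :=
      (((PT.greedy hq hQ).reverse.drop hn.succ).dropWhile PT.id.not).tail.reverse
    obtain ⟨F, hF, k, hk⟩ := hdesc
    simpa using mem_FPWith F k _ hF (fun n => by simpa using hk n)
  · simp only [List.length_replicate]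
    rw [hrG j, descriptionOf_profile]
    rfl

end ACCUniform

theorem theorem1 (k : ℕ) :
    (∀ A ∈ ACCUniform.NE, ACCUniform.HasACC k A) ↔
      (∀ A ∈ ACCUniform.NE, ACCUniform.HasUniformACC k A) := by
  refine ⟨fun h A hA => ACCUniform.hasUniformACC_of_hasACC hA (h A hA), fun h A hA => ?_⟩
  obtain ⟨m, hm, C, hC, hdec, -⟩ := h A hA
  exact ⟨m, hm, C, hC, hdec⟩
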